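/- **Theorem 1.2.** Let $k$ be an algebraically closed field, $G$ a semisimple linear algebraic group over $k$ (every closed connected solvable normal subgroup is trivial), $T\subseteq G$ a maximal torus, and $X$ a projective variety with a very ample $G$-linearized line bundle $L$, given as a $G$-stable irreducible closed subset $X\subseteq\mathbb P(V^*)$ with $L=\mathcal O(1)|_X$, where $V$ is a finite-dimensional rational representation of $G$ (for example $V=H^0(X,L)$); points of $\mathbb P(V^*)$ are lines in $V^*$. *Notation.* Let $M=\mathrm{Hom}(T,k^*)$ be the character lattice, $M_{\mathbb R}=M\otimes\mathbb R$, $N_{\mathbb R}$ the space of real one-parameter subgroups (the dual of $M_{\mathbb R}$), $W=N_G(T)/T$ the Weyl group, and $F\subset N_{\mathbb R}$ a closed fundamental chamber of $W$. Let $\Xi_V\subset M$ be the finite set of weights of $V$ and, for $x\in\mathbb P(V^*)$, let $\Xi_x\subseteq\Xi_V$ be the set of weights $\chi$ such that some $s\in V_\chi$ satisfies $s(x)\neq0$. For $\lambda\in N_{\mathbb R}$ put $\Xi_{V,\lambda\ge0}=\{\chi\in\Xi_V:\langle\lambda,\chi\rangle\ge0\}$ and $\Xi_{V,\lambda=0}=\{\chi\in\Xi_V:\langle\lambda,\chi\rangle=0\}$.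 Let $P_s^F$ be the finite set of those inclusion-maximal members of $\{\Xi_{V,\lambda\ge0}:0\ne\lambda\in N_{\mathbb R}\}$ which are of the form $\Xi_{V,\lambda\ge0}$ with $0\neq\lambda\in F$. Write $\mathrm{Conv}$ for convex hulls and $\mathrm{relint}$ for relative interiors. *Stability.* For $H\in\{T,G\}$, a point $x\in X$ is $H$-semistable if some $H$-invariant section of some $L^m$, $m>0$, does not vanish at $x$; it is $H$-stable if such a section $s$ can be chosen so that moreover the orbit $Hx$ is closed in $X_s=\{s\neq0\}$ and $\dim Hx=\dim H$ (equivalently, $x$ has finite stabilizer in $H$). A point is *strictly $T$-polystable* if it is $T$-semistable, not $T$-stable, has a positive-dimensional (i.e. infinite) stabilizer in $T$, and its $T$-orbit is closed in the $T$-semistable locus. The same definitions are used for $\mathbb P(V^*)$ in place of $X$. For a linear subspace $A\subseteq M_{\mathbb R}$ let $Y_A(X)$ be the set of strictly $T$-polystable $x\in X$ such that $\Xi_x$ spans $A$ and $0\in\mathrm{relint}\,\mathrm{Conv}(\Xi_x)$. Let $\mathcal P$ be the set of all $\Xi_A:=\Xi_V\cap A$, where $A\subsetneq M_{\mathbb R}$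 is a proper linear subspace spanned by $\Xi_A$ such that $0\in\mathrm{relint}\,\mathrm{Conv}(\Xi_A)$. *Algorithm 3.* Input: $P_s^F$, each member being given as $\Xi_{V,\lambda\ge0}$ with a chosen $0\ne\lambda\in F$ (together with $\Xi_V$ and $W$). Start with $P=\mathcal S=\emptyset$. (i) For each $\Xi_{V,\lambda\ge0}\in P_s^F$: if $0\in\mathrm{relint}\,\mathrm{Conv}(\Xi_{V,\lambda=0})$, add $\Xi_{V,\lambda=0}$ to $P$; if $0\in\mathrm{Conv}(\Xi_{V,\lambda=0})$, add $\Xi_{V,\lambda=0}$ to $\mathcal S$. (ii) For each $S\in\mathcal S$ and each $S'\subseteq S$ with $\dim\mathrm{Conv}(S')<\dim\mathrm{Conv}(S)$ and $0\in\mathrm{relint}\,\mathrm{Conv}(S')$, add $\mathrm{Span}(S')\cap\Xi_V$ to $P$. (iii) For each $S$ still in $P$ and each $w\in W$: if $wS\ne S$ and $wS\in P$, remove $wS$ from $P$. Output: $P_{ps}^F:=P$. *Claim.* $P_s^F$ is finite, and so is the image of $W$ in $\mathrm{Aut}(M)$. Moreover: 1. A point $x\in X$ is strictly $T$-polystable if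 and only if $\Xi_x$ lies in a proper linear subspace of $M_{\mathbb R}$ and $0\in\mathrm{relint}\,\mathrm{Conv}(\Xi_x)$. 2. $\mathcal P$ indexes the strata in $\mathbb P(V^*)$: $Y_A(\mathbb P(V^*))\ne\emptyset$ if and only if $A=\mathrm{Span}(S)$ for some $S\in\mathcal P$; and for each $S\in\mathcal P$ there is $x\in Y_{\mathrm{Span}(S)}(\mathbb P(V^*))$ with $\Xi_x=S$. 3. For every choice of the representatives $\lambda$ and of the orders in which the loops are run, the output $P_{ps}^F$ of Algorithm 3 is contained in $\mathcal P$ and contains exactly one element of each $W$-orbit on $\mathcal P$. It determines the strictly $T$-polystable locus of $X$ up to the Weyl group: this locus equals $\bigcup_{S\in P_{ps}^F}\bigcup_{g\in N_G(T)} g\cdot Y_{\mathrm{Span}(S)}(X)$; and the set of strictly $T$-polystable points of $X$ which are $G$-semistable and not $G$-stable equals the same union with each $Y_{\mathrm{Span}(S)}(X)$ replaced by its subset of $G$-semistable points. -/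

import Mathlib

open scoped LinearAlgebra.Projectivization TensorProduct Topology

namespace TPolystable

/-! ## Linear algebraic groups over an algebraically closed field (classical language) -/

section Groups

variable {k : Type*} [Field k] {n : ℕ}

/-- The regular functions on `GL n k`: polynomials in the entries of `g` and of `g⁻¹`. -/
def regularGL (k : Type*) [Field k] (n : ℕ) : Subalgebra k (GL (Fin n) k → k) :=
  Algebra.adjoin k
    ({f | ∃ i j, f = fun g : GL (Fin n) k => (g : Matrix (Fin n) (Fin n) k) i j} ∪
      {f | ∃ i j, f = fun g : GL (Fin n) k => ((g⁻¹ : GL (Fin n) k) : Matrix (Fin n) (Fin n) k) i j})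

/-- The Zariski topology of `GL n k`; the basic open sets are the non-vanishing loci of regular
functions. -/
@[reducible] def zariskiGL (k : Type*) [Field k] (n : ℕ) : TopologicalSpace (GL (Fin n) k) :=
  TopologicalSpace.generateFrom {U | ∃ f ∈ regularGL k n, U = {g | f g ≠ 0}}

/-- `H` is a linear algebraic group: a Zariski closed subgroup of `GL n k`. -/
def IsAlgebraicSubgroup (H : Subgroup (GL (Fin n) k)) : Prop :=
  IsClosed[zariskiGL k n] (H : Set (GL (Fin n) k))

/-- The regular functions on a subgroup `H` of `GL n k`: restrictions of regular functions
on `GL n k`. -/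
def IsRegular (H : Subgroup (GL (Fin n) k)) (f : H → k) : Prop :=
  ∃ F ∈ regularGL k n, ∀ h : H, f h = F (h : GL (Fin n) k)

/-- A semisimple group: a linear algebraic group all of whose (closed) connected solvable normal
subgroups are trivial. -/
def IsSemisimpleGroup (G : Subgroup (GL (Fin n) k)) : Prop :=
  IsAlgebraicSubgroup G ∧
    ∀ H : Subgroup (GL (Fin n) k), H ≤ G → IsAlgebraicSubgroup H →
      @IsConnected _ (zariskiGL k n) (H : Set (GL (Fin n) k)) →
      (H.subgroupOf G).Normal → Group.IsSolvable H → H = ⊥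

/-- The regular functions on `(kˣ)ᵈ`: Laurent polynomials. -/
def regularTorus (k : Type*) [Field k] (d : ℕ) : Subalgebra k ((Fin d → kˣ) → k) :=
  Algebra.adjoin k
    ({f | ∃ i, f = fun t => ((t i : kˣ) : k)} ∪ {f | ∃ i, f = fun t => (((t i)⁻¹ : kˣ) : k)})

/-- `T` is a torus: a linear algebraic group that is isomorphic, as an algebraic group,
to `(kˣ)ᵈ` for some `d`. -/
def IsTorus (T : Subgroup (GL (Fin n) k)) : Prop :=
  IsAlgebraicSubgroup T ∧
    ∃ (d : ℕ) (e : (Fin d → kˣ) ≃* T),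
      (∀ i j, (fun t => ((e t : GL (Fin n) k) : Matrix (Fin n) (Fin n) k) i j)
        ∈ regularTorus k d) ∧
      ∀ i, IsRegular T fun t => ((e.symm t i : kˣ) : k)

/-- `T` is a maximal torus of `G`. -/
def IsMaximalTorus (G T : Subgroup (GL (Fin n) k)) : Prop :=
  Maximal (fun S : Subgroup (GL (Fin n) k) => IsTorus S ∧ S ≤ G) T

/-! ## Characters, the spaces `M_ℝ` and `N_ℝ`, the Weyl group and its chambers -/

theorem regularGL_comp_inv {F : GL (Fin n) k → k} (hF : F ∈ regularGL k n) :
    (fun g => F g⁻¹) ∈ regularGL k n := by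
  unfold regularGL at hF ⊢
  induction hF using Algebra.adjoin_induction with
  | mem f hf =>
    apply Algebra.subset_adjoin
    rcases hf with ⟨i, j, rfl⟩ | ⟨i, j, rfl⟩
    · exact Or.inr ⟨i, j, rfl⟩
    · exact Or.inl ⟨i, j, by simp⟩
  | algebraMap r => exact Subalgebra.algebraMap_mem _ r
  | add f g _ _ hf hg => exact Subalgebra.add_mem _ hf hg
  | mul f g _ _ hf hg => exact Subalgebra.mul_mem _ hf hg

/-- The (multiplicative) group of characters `T → kˣ` that are morphisms of algebraic groups. -/
def charGroup (T : Subgroup (GL (Fin n) k)) : Subgroup (T →* kˣ) where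
  carrier := {χ | IsRegular T fun t => ((χ t : kˣ) : k)}
  one_mem' := ⟨1, Subalgebra.one_mem _, fun h => by simp⟩
  mul_mem' := by
    rintro a b ⟨F, hF, hFa⟩ ⟨F', hF', hFb⟩
    exact ⟨F * F', Subalgebra.mul_mem _ hF hF', fun h => by simp [← hFa, ← hFb]⟩
  inv_mem' := by
    rintro a ⟨F, hF, hFa⟩
    refine ⟨_, regularGL_comp_inv hF, fun h => ?_⟩
    have := hFa h⁻¹
    simpa using this

/-- The character lattice `M = Hom(T, kˣ)`, written additively. -/
abbrev M (T : Subgroup (GL (Fin n) k)) : Type _ := Additive (charGroup T)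

/-- The value `χ(t)` of a character. -/
def M.eval {T : Subgroup (GL (Fin n) k)} (χ : M T) (t : T) : kˣ :=
  ((Additive.toMul χ : charGroup T) : T →* kˣ) t

/-- `M_ℝ = ℝ ⊗ M`. -/
abbrev MR (T : Subgroup (GL (Fin n) k)) : Type _ := ℝ ⊗[ℤ] M T

/-- `N_ℝ`, the real vector space of (real) one-parameter subgroups of `T`, identified through the
perfect pairing of one-parameter subgroups and characters with the dual of `M_ℝ`.
So `lam x` is the pairing `⟨lam, x⟩`. -/
abbrev NR (T : Subgroup (GL (Fin n) k)) : Type _ := Module.Dual ℝ (MR T)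

/-- A character, seen in `M_ℝ`. -/
def toMR {T : Subgroup (GL (Fin n) k)} (χ : M T) : MR T := (1 : ℝ) ⊗ₜ[ℤ] χ

/-- The Weyl group `N_G(T)/T`, in its action on `M`: the automorphisms
`χ ↦ (t ↦ χ(g⁻¹ t g))` of `M` for `g ∈ G` normalizing `T`. -/
def weylGroup (G T : Subgroup (GL (Fin n) k)) : Subgroup (M T ≃ₗ[ℤ] M T) where
  carrier := {w | ∃ g ∈ G, g ∈ Subgroup.normalizer (T : Set (GL (Fin n) k)) ∧
    ∀ (χ : M T) (t t' : T), (t' : GL (Fin n) k) = g⁻¹ * t * g → (w χ).eval t = χ.eval t'}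
  one_mem' := ⟨1, G.one_mem, Subgroup.one_mem _, by
    intro χ t t' h
    have : t' = t := Subtype.ext (by simpa using h)
    simp [this]⟩
  mul_mem' := by
    rintro a b ⟨g, hg, hgn, ha⟩ ⟨h, hh, hhn, hb⟩
    refine ⟨g * h, G.mul_mem hg hh, Subgroup.mul_mem _ hgn hhn, fun χ t t' e => ?_⟩
    have hm : g⁻¹ * (t : GL (Fin n) k) * g ∈ T := by
      have := (Subgroup.mem_normalizer_iff.1 (Subgroup.inv_mem _ hgn) (t : GL (Fin n) k)).1 t.2
      simpa using this
    have h1 := ha (b χ) t ⟨_, hm⟩ rfl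
    have h2 := hb χ ⟨_, hm⟩ t' (by rw [e]; simp [mul_assoc])
    exact h1.trans h2
  inv_mem' := by
    rintro a ⟨g, hg, hgn, ha⟩
    refine ⟨g⁻¹, G.inv_mem hg, Subgroup.inv_mem _ hgn, fun χ t t' e => ?_⟩
    have h1 := ha (a⁻¹ χ) t' t (by rw [e]; simp [mul_assoc])
    rw [← h1]
    simp

/-- `α ∈ M_ℝ` is the direction of a reflection in the Weyl group, that is, some element of the
Weyl group acts on `M_ℝ` as `x ↦ x - f(x) α` with `f(α) = 2`. For connected `G` these vectors are
the nonzero real multiples of the roots. -/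
def IsReflectionVector (G T : Subgroup (GL (Fin n) k)) (α : MR T) : Prop :=
  ∃ w ∈ weylGroup G T, ∃ f : Module.Dual ℝ (MR T), f α = 2 ∧
    ∀ χ : M T, toMR (w χ) = toMR χ - f (toMR χ) • α

/-- A (closed) fundamental chamber of the Weyl group action on `N_ℝ`: choose `p ∈ N_ℝ` on no
reflecting hyperplane; the chamber is the intersection of the half-spaces `⟨-, α⟩ ≥ 0` over the
`α` that are positive on `p`. -/
def IsFundamentalChamber (G T : Subgroup (GL (Fin n) k)) (F : Set (NR T)) : Prop :=
  ∃ p : NR T, (∀ α, IsReflectionVector G T α → p α ≠ 0) ∧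
    F = {lam | ∀ α, IsReflectionVector G T α → 0 < p α → 0 ≤ lam α}

/-- A representation of a linear algebraic group is rational if its matrix coefficients are
regular functions. -/
def IsRationalRep {H : Subgroup (GL (Fin n) k)} {V : Type*} [AddCommGroup V] [Module k V]
    (ρ : Representation k H V) : Prop :=
  ∀ (v : V) (l : Module.Dual k V), IsRegular H fun h => l (ρ h v)

/-- The weight space `V_χ`. -/
def weightSpace {T : Subgroup (GL (Fin n) k)} {V : Type*} [AddCommGroup V] [Module k V]
    (σ : Representation k T V) (χ : M T) : Submodule k V where
  carrier := {v | ∀ t, σ t v = ((χ.eval t : kˣ) : k) • v}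
  zero_mem' := fun t => by simp
  add_mem' := fun {a b} ha hb t => by rw [map_add, ha t, hb t, smul_add]
  smul_mem' := fun c v hv t => by rw [map_smul, hv t, smul_comm]

theorem finite_weights {T : Subgroup (GL (Fin n) k)} {V : Type*} [AddCommGroup V] [Module k V]
    [FiniteDimensional k V] (σ : Representation k T V) :
    {χ : M T | weightSpace σ χ ≠ ⊥}.Finite := by
  have hex : ∀ χ : {χ : M T | weightSpace σ χ ≠ ⊥}, ∃ v ∈ weightSpace σ χ.1, v ≠ 0 :=
    fun χ => (Submodule.ne_bot_iff _).1 χ.2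
  choose v hv hv0 using hex
  have hinj : Function.Injective
      (fun χ : {χ : M T | weightSpace σ χ ≠ ⊥} =>
        ((Units.coeHom k).comp (Additive.toMul χ.1 : charGroup T).1 : T →* k)) := by
    intro a b hab
    apply Subtype.ext
    apply Additive.toMul.injective
    apply Subtype.ext
    ext t
    exact DFunLike.congr_fun hab t
  have hchar := (linearIndependent_monoidHom T k).comp _ hinj
  have hli : LinearIndependent k v := by
    rw [linearIndependent_iff']
    intro s c hc i hi
    rw [linearIndependent_iff'] at hchar
    by_contra hci
    have key : ∀ l : Module.Dual k V, c i * l (v i) = 0 := by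
      intro l
      refine hchar s (fun j => c j * l (v j)) ?_ i hi
      ext t
      have := congrArg (fun x => l (σ t x)) hc
      simp only [map_sum, map_smul, map_zero] at this
      rw [Finset.sum_apply, Pi.zero_apply, ← this]
      refine Finset.sum_congr rfl fun j _ => ?_
      rw [hv j t]
      simp only [Pi.smul_apply, Function.comp_apply, smul_eq_mul, map_smul]
      simp only [MonoidHom.comp_apply, Units.coeHom_apply, M.eval]
      ring
    have : v i = 0 := (Module.forall_dual_apply_eq_zero_iff k (v i)).1 fun l =>
      (mul_eq_zero.1 (key l)).resolve_left hci
    exact hv0 i this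
  exact hli.finite

theorem IsMaximalTorus.le {G T : Subgroup (GL (Fin n) k)} (hT : IsMaximalTorus G T) : T ≤ G :=
  hT.prop.2

/-- The restriction of a representation of `G` to a subgroup `T`. -/
def restrict {G T : Subgroup (GL (Fin n) k)} {V : Type*} [AddCommGroup V] [Module k V]
    (h : T ≤ G) (ρ : Representation k G V) : Representation k T V :=
  MonoidHom.comp ρ (Subgroup.inclusion h)

end Groups

/-! ## Projective varieties `X ⊆ ℙ(V*)` and geometric invariant theory -/

section Geometry

variable {k : Type*} [Field k] {V : Type*} [AddCommGroup V] [Module k V]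

/-- `f` is a homogeneous polynomial function of degree `m` on `V*`: it lies in the algebra of
functions generated by the elements of `V`, and is homogeneous of degree `m`. -/
def IsHomogeneousPoly (m : ℕ) (f : Module.Dual k V → k) : Prop :=
  f ∈ Algebra.adjoin k {g : Module.Dual k V → k | ∃ v : V, g = fun φ => φ v} ∧
    ∀ (c : k) (φ : Module.Dual k V), f (c • φ) = c ^ m * f φ

/-- The Zariski topology of `ℙ(V*)`, whose points are the lines of `V*`. -/
@[reducible] def zariskiProj (k V : Type*) [Field k] [AddCommGroup V] [Module k V] :
    TopologicalSpace (ℙ k (Module.Dual k V)) :=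
  TopologicalSpace.generateFrom
    {U | ∃ (m : ℕ) (f : Module.Dual k V → k), IsHomogeneousPoly m f ∧ U = {x | f x.rep ≠ 0}}

/-- `X` is a projective variety in `ℙ(V*)`: an irreducible Zariski closed subset. -/
def IsProjectiveVariety (X : Set (ℙ k (Module.Dual k V))) : Prop :=
  IsClosed[zariskiProj k V] X ∧ @IsIrreducible _ (zariskiProj k V) X

/-- The affine cone over `X` without its vertex. -/
def cone (X : Set (ℙ k (Module.Dual k V))) : Set (Module.Dual k V) :=
  {φ | ∃ h : φ ≠ 0, Projectivization.mk k φ h ∈ X}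

/-- `s` represents a section of `L^m`, where `L` is the restriction of `𝒪(1)` to `X`: a function
on the punctured cone over `X` that is, locally in the Zariski topology, a quotient `f / g` of
homogeneous polynomials with `deg f = deg g + m`. -/
def IsSection (X : Set (ℙ k (Module.Dual k V))) (m : ℕ) (s : Module.Dual k V → k) : Prop :=
  ∀ φ ∈ cone X, ∃ (e : ℕ) (f g : Module.Dual k V → k),
    IsHomogeneousPoly (e + m) f ∧ IsHomogeneousPoly e g ∧ g φ ≠ 0 ∧
      ∀ ψ ∈ cone X, g ψ ≠ 0 → s ψ = f ψ / g ψ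

variable {H : Type*} [Group H]

/-- `s` represents an `H`-invariant section of `L^m` over `X`. -/
def IsInvariantSection (σ : Representation k H V) (X : Set (ℙ k (Module.Dual k V))) (m : ℕ)
    (s : Module.Dual k V → k) : Prop :=
  IsSection X m s ∧ ∀ (h : H), ∀ φ ∈ cone X, s (σ.dual h φ) = s φ

theorem dual_injective (σ : Representation k H V) (h : H) : Function.Injective (σ.dual h) := by
  intro a b hab
  have := congrArg (σ.dual h⁻¹) hab
  simpa only [← Module.End.mul_apply, ← map_mul, inv_mul_cancel, map_one, Module.End.one_apply]
    using this

/-- The action of `H` on `ℙ(V*)`. -/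
def act (σ : Representation k H V) (h : H) :
    ℙ k (Module.Dual k V) → ℙ k (Module.Dual k V) :=
  Projectivization.map (σ.dual h) (dual_injective σ h)

/-- The orbit of a point. -/
def orbit (σ : Representation k H V) (x : ℙ k (Module.Dual k V)) :
    Set (ℙ k (Module.Dual k V)) :=
  Set.range fun h => act σ h x

/-- The stabilizer of a point. -/
def stab (σ : Representation k H V) (x : ℙ k (Module.Dual k V)) : Set H :=
  {h | act σ h x = x}

/-- `Z` is a Zariski closed subset of `Y`, for the topology that `Y` inherits from `ℙ(V*)`. -/
def IsClosedIn (Z Y : Set (ℙ k (Module.Dual k V))) : Prop :=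
  ∃ C : Set (ℙ k (Module.Dual k V)), IsClosed[zariskiProj k V] C ∧ Z = C ∩ Y

/-- The semistable locus `X^ss` for the action of `H` on `(X, L)`. -/
def semistable (σ : Representation k H V) (X : Set (ℙ k (Module.Dual k V))) :
    Set (ℙ k (Module.Dual k V)) :=
  {x | x ∈ X ∧ ∃ m > 0, ∃ s, IsInvariantSection σ X m s ∧ s x.rep ≠ 0}

/-- The stable locus `X^s`: some invariant section `s` of a positive power of `L` does not vanish
at `x`, the orbit of `x` has the dimension of the group (that is, the stabilizer of `x` is
finite), and the orbit is closed in `X_s = {y ∈ X | s(y) ≠ 0}`. -/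
def stable (σ : Representation k H V) (X : Set (ℙ k (Module.Dual k V))) :
    Set (ℙ k (Module.Dual k V)) :=
  {x | x ∈ X ∧ ∃ m > 0, ∃ s, IsInvariantSection σ X m s ∧ s x.rep ≠ 0 ∧
    (stab σ x).Finite ∧ IsClosedIn (orbit σ x) {y | y ∈ X ∧ s y.rep ≠ 0}}

/-- The strictly polystable locus: the points of `X^ss \ X^s` whose stabilizer has positive
dimension (that is, is infinite) and whose orbit is closed in `X^ss`. -/
def strictlyPolystable (σ : Representation k H V) (X : Set (ℙ k (Module.Dual k V))) :
    Set (ℙ k (Module.Dual k V)) :=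
  {x | x ∈ semistable σ X \ stable σ X ∧ (stab σ x).Infinite ∧
    IsClosedIn (orbit σ x) (semistable σ X)}

end Geometry

/-! ## States -/

section States

variable {k : Type*} [Field k] {n : ℕ} {G T : Subgroup (GL (Fin n) k)}

/-- A finite set of characters, seen in `M_ℝ`. -/
def realize (S : Finset (M T)) : Set (MR T) := toMR '' (S : Set (M T))

/-- The linear span in `M_ℝ` of a finite set of characters. -/
def spanR (S : Finset (M T)) : Submodule ℝ (MR T) := Submodule.span ℝ (realize S)

/-- The trivial character lies in the convex hull of `S`. -/
def ZeroMemConv (S : Finset (M T)) : Prop := (0 : MR T) ∈ convexHull ℝ (realize S)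

/-- The trivial character lies in the relative interior of the convex hull of `S` (for the
canonical topology of the finite-dimensional real vector space `M_ℝ`). -/
def ZeroMemRelint (S : Finset (M T)) : Prop :=
  (0 : MR T) ∈ @intrinsicInterior ℝ (MR T) (MR T) _ _ _ (moduleTopology ℝ (MR T)) _
    (convexHull ℝ (realize S))

/-- The dimension of the convex hull of `S` (`0` if `S` is empty). -/
noncomputable def dimConv (S : Finset (M T)) : ℕ :=
  Module.finrank ℝ (vectorSpan ℝ (convexHull ℝ (realize S)))

/-- The action of an automorphism of `M` on finite sets of characters. -/
def moveState (w : M T ≃ₗ[ℤ] M T) (S : Finset (M T)) : Finset (M T) :=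
  S.map w.toEquiv.toEmbedding

open Classical in
/-- The members of `S` that lie in a linear subspace `A` of `M_ℝ`. -/
noncomputable def inter (S : Finset (M T)) (A : Submodule ℝ (MR T)) : Finset (M T) :=
  S.filter fun χ => toMR χ ∈ A

open Classical in
/-- `{χ ∈ S | ⟨lam, χ⟩ ≥ 0}`. -/
noncomputable def geState (S : Finset (M T)) (lam : NR T) : Finset (M T) :=
  S.filter fun χ => 0 ≤ lam (toMR χ)

open Classical in
/-- `{χ ∈ S | ⟨lam, χ⟩ = 0}`. -/
noncomputable def eqState (S : Finset (M T)) (lam : NR T) : Finset (M T) :=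
  S.filter fun χ => lam (toMR χ) = 0

variable {V : Type*} [AddCommGroup V] [Module k V] [FiniteDimensional k V]

/-- The state `Ξ_V`: the set of the weights of `V`. -/
noncomputable def stateV (σ : Representation k T V) : Finset (M T) :=
  (finite_weights σ).toFinset

open Classical in
/-- The state `Ξ_x` of a point `x ∈ ℙ(V*)`: the weights `χ` such that some `s ∈ V_χ` does not
vanish at `x`. -/
noncomputable def stateOf (σ : Representation k T V) (x : ℙ k (Module.Dual k V)) :
    Finset (M T) :=
  (stateV σ).filter fun χ => ∃ s ∈ weightSpace σ χ, x.rep s ≠ 0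

/-- `P_s^F` for a set `Ξ` of weights: the states `Ξ_{lam ≥ 0}` that are maximal among all states of
this form (with `lam ≠ 0` in `N_ℝ`) and that are defined by some `lam` in the chamber `F`. -/
def PsF (Ξ : Finset (M T)) (F : Set (NR T)) : Set (Finset (M T)) :=
  {S | Maximal (fun S' => ∃ lam : NR T, lam ≠ 0 ∧ S' = geState Ξ lam) S ∧
    ∃ lam ∈ F, lam ≠ 0 ∧ S = geState Ξ lam}

/-- The subset `Y_A` of `X`: the strictly `T`-polystable points `x` such that the convex hull of
`Ξ_x` spans `A` and contains the trivial character in its relative interior. -/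
def stratum (σ : Representation k T V) (X : Set (ℙ k (Module.Dual k V)))
    (A : Submodule ℝ (MR T)) : Set (ℙ k (Module.Dual k V)) :=
  {x | x ∈ strictlyPolystable σ X ∧ spanR (stateOf σ x) = A ∧ ZeroMemRelint (stateOf σ x)}

/-- The states `Ξ_A = Ξ ∩ A`, for the proper linear subspaces `A` of `M_ℝ` such that the convex
hull of `Ξ_A` spans `A` and contains the trivial character in its relative interior. -/
def polystableStates (Ξ : Finset (M T)) : Set (Finset (M T)) :=
  {S | ∃ A : Submodule ℝ (MR T), A ≠ ⊤ ∧ S = inter Ξ A ∧ spanR S = A ∧ ZeroMemRelint S}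

end States

/-! ## The algorithm -/

section Algorithm

variable {k : Type*} [Field k] {n : ℕ} {T : Subgroup (GL (Fin n) k)}

/-- `enum` lists the members of every finite set of states, in an arbitrary order: it fixes the
order in which the loops over finite sets are run. -/
def IsEnumeration (enum : Finset (Finset (M T)) → List (Finset (M T))) : Prop :=
  ∀ 𝒮 S, S ∈ enum 𝒮 ↔ S ∈ 𝒮

open Classical in
/-- First loop, over the `lam` that define the members of the input. The pair `(P, Sp)` holds the
states found so far and the states to be searched. -/
noncomputable def loopInput (Ξ : Finset (M T)) (input : List (NR T)) :
    Finset (Finset (M T)) × Finset (Finset (M T)) :=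
  input.foldl
    (fun Q lam =>
      (if ZeroMemRelint (eqState Ξ lam) then insert (eqState Ξ lam) Q.1 else Q.1,
        if ZeroMemConv (eqState Ξ lam) then insert (eqState Ξ lam) Q.2 else Q.2))
    (∅, ∅)

open Classical in
/-- Second loop: for all `S ∈ Sp` and all `S' ⊆ S`, if the convex hull of `S'` has smaller
dimension than that of `S` and has the trivial character in its relative interior, then
`Span S' ∩ Ξ` is added to `P`. -/
noncomputable def loopSubsets (Ξ : Finset (M T))
    (enum : Finset (Finset (M T)) → List (Finset (M T)))
    (P Sp : Finset (Finset (M T))) : Finset (Finset (M T)) :=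
  (enum Sp).foldl
    (fun P S => (enum S.powerset).foldl
      (fun P S' =>
        if dimConv S' < dimConv S then
          if ZeroMemRelint S' then insert (inter Ξ (spanR S')) P else P
        else P)
      P)
    P

open Classical in
/-- Third loop: for all `S` that are (still) in `P` and all `w` in the Weyl group, if `w S ≠ S`
and `w S ∈ P` then `w S` is removed from `P`. -/
noncomputable def loopWeyl (weyl : List (M T ≃ₗ[ℤ] M T))
    (enum : Finset (Finset (M T)) → List (Finset (M T)))
    (P : Finset (Finset (M T))) : Finset (Finset (M T)) :=
  (enum P).foldl
    (fun P S =>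
      if S ∈ P then
        weyl.foldl
          (fun P w => if moveState w S ≠ S ∧ moveState w S ∈ P then P.erase (moveState w S) else P)
          P
      else P)
    P

/-- The algorithm. Its input is the set of weights `Ξ`, a list of the `lam` that define the states
`Ξ_{lam ≥ 0}` in `P_s^F`, and a list of the elements of the Weyl group; its output is the value of
the variable `P` after the three loops. -/
noncomputable def polystableAlgorithm (Ξ : Finset (M T)) (weyl : List (M T ≃ₗ[ℤ] M T))
    (enum : Finset (Finset (M T)) → List (Finset (M T))) (input : List (NR T)) :
    Finset (Finset (M T)) :=
  loopWeyl weyl enum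
    (loopSubsets Ξ enum (loopInput Ξ input).1 (loopInput Ξ input).2)

/-- The list `input` presents `P_s^F`: it consists of nonzero elements `lam` of `F`, and the states
`Ξ_{lam ≥ 0}` they define are exactly the members of `P_s^F`. -/
def Presents (Ξ : Finset (M T)) (F : Set (NR T)) (input : List (NR T)) : Prop :=
  (∀ lam ∈ input, lam ∈ F ∧ lam ≠ 0) ∧ {S | ∃ lam ∈ input, S = geState Ξ lam} = PsF Ξ F

end Algorithm

end TPolystable

/-!
Polystability for the torus `T` translates into convex geometry of the set of weights of a point,
its state; the algorithm is then correct because of the geometry of the states and of the Weyl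
chambers.

*Torus actions.* Regular functions on `T ≅ (kˣ)ᵈ` are Laurent polynomials, and the monomials are
linearly independent characters. Hence the coordinates form a basis of `M`, every homomorphism
`M → kˣ` is evaluation at a point of `T` (`exists_eval_eq`), and rational representations have bases
of weight vectors (`exists_weightBasis`).

*Numerical criteria.* If `0` is not in the convex hull of the state of `x`, some functional is
positive on the state. It may be taken integral, because an integral functional with the same signs
on a finite set always exists (`exists_int_functional_sign_eq`). The corresponding one-parameter
subgroup contracts the cone over the orbit to the origin, so no invariant section is nonzero at `x`
(`zeroMemConv_of_mem_semistable`). Conversely a relation with natural coefficients between the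
weights yields an invariant monomial (`mem_semistable_of_relation`). If `0` is in the hull but not
in its relative interior, a one-parameter subgroup moves `x` to a semistable limit with a smaller
state, so the orbit is not closed (`zeroMemRelint_of_isClosedIn_orbit`). If `0` is in the relative
interior, the orbit is closed: the binomial equations of the orbit hold on its closure, they force
all the coordinates of a semistable point of the closure to be nonzero, and, as `kˣ` is divisible,
nonzero coordinates that satisfy them come from a point of `T` (`mem_orbit_of_mem_orbitClosure`).
The stabilizer is infinite if and only if the state does not span `M_ℝ` (`stab_infinite`,
`stab_finite`). Together this is `mem_strictlyPolystable_iff`.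

*The Weyl group.* It permutes the finitely many weights of the natural representation and is
determined by this permutation, so it is finite (`finite_weylGroup`). The translates of a chamber
cover `N_ℝ`: among the translates of a functional, one that maximizes an invariant scalar product
with the generic point of the chamber lies in the chamber (`exists_moveNR_mem_chamber`).

*The algorithm.* A polystable state `S` spans a proper subspace, so it is killed by some nonzero
functional `lam`. Enlarging `Ξ_{lam ≥ 0}` to a maximal member and translating into the chamber
gives `moveState w S ⊆ Ξ_{nu ≥ 0}` with `nu` in the input; as `0` is in the relative interior, `nu`
vanishes on `moveState w S`, so this state lies in `Ξ_{nu = 0}` (`exists_input_supset`). Either it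
has the dimension of `Ξ_{nu = 0}` and equals it, or it has smaller dimension and is found by the
second loop (`loopSubsets_spec`). The third loop keeps one member of each orbit
(`loopWeyl_spec`). Finally the normalizer of `T` permutes the strata compatibly with the action of
the Weyl group on states (`act_mem_stratum`), which gives the description of the strictly polystable
locus (`inter_strictlyPolystable_eq`).
-/

namespace TPolystable

/-! ### Characters and representations of tori -/

section Torus

variable {k : Type*} [Field k] {n : ℕ} {T : Subgroup (GL (Fin n) k)}

/-- The character `t ↦ ∏ tᵢ ^ aᵢ` of `(kˣ)ᵈ`. -/
def monomialChar (k : Type*) [Field k] {d : ℕ} (a : Fin d → ℤ) : (Fin d → kˣ) →* kˣ where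
  toFun t := ∏ i, t i ^ a i
  map_one' := by simp
  map_mul' s t := by simp [mul_zpow, Finset.prod_mul_distrib]

theorem monomialChar_apply {d : ℕ} (a : Fin d → ℤ) (t : Fin d → kˣ) :
    monomialChar k a t = ∏ i, t i ^ a i := rfl

theorem monomialChar_add {d : ℕ} (a b : Fin d → ℤ) :
    monomialChar k (a + b) = monomialChar k a * monomialChar k b := by
  ext t
  simp [monomialChar_apply, zpow_add, Finset.prod_mul_distrib]

theorem monomialChar_single {d : ℕ} (i : Fin d) (m : ℤ) (t : Fin d → kˣ) :
    monomialChar k (Pi.single i m) t = t i ^ m := by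
  rw [monomialChar_apply, Finset.prod_eq_single i]
  · simp
  · intro j _ hj
    simp [hj]
  · simp

theorem exists_unit_zpow_ne_one (k : Type*) [Field k] [Infinite k] {m : ℤ} (hm : m ≠ 0) :
    ∃ c : kˣ, c ^ m ≠ 1 := by
  by_contra! h
  have hpos : 0 < m.natAbs := Int.natAbs_pos.2 hm
  have h' : ∀ c : kˣ, c ^ m.natAbs = 1 := by
    intro c
    have := h c
    rcases Int.natAbs_eq m with e | e
    · rw [e, zpow_natCast] at this
      exact this
    · rw [e, zpow_neg, zpow_natCast, inv_eq_one] at this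
      exact this
  classical
  have hfin : {x : k | x ^ m.natAbs = 1}.Finite := by
    refine ((Polynomial.nthRoots m.natAbs (1 : k)).toFinset.finite_toSet).subset fun x hx => ?_
    simpa [Polynomial.mem_nthRoots hpos] using hx
  have : (Set.univ : Set k).Finite := by
    refine (hfin.union (Set.finite_singleton 0)).subset fun x _ => ?_
    by_cases hx : x = 0
    · exact Or.inr hx
    · left
      have := congrArg (Units.val) (h' (Units.mk0 x hx))
      simpa using this
  exact Set.infinite_univ this

theorem monomialChar_injective (k : Type*) [Field k] [Infinite k] (d : ℕ) :
    Function.Injective (monomialChar k : (Fin d → ℤ) → _) := by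
  intro a b hab
  by_contra hne
  obtain ⟨i, hi⟩ := Function.ne_iff.1 hne
  obtain ⟨c, hc⟩ := exists_unit_zpow_ne_one k (sub_ne_zero.2 hi)
  apply hc
  have h1 : ∀ a : Fin d → ℤ, monomialChar k a (Pi.mulSingle i c) = c ^ a i := by
    intro a
    rw [monomialChar_apply, Finset.prod_eq_single i]
    · simp
    · intro j _ hj
      simp [hj]
    · simp
  have := DFunLike.congr_fun hab (Pi.mulSingle i c)
  rw [h1, h1] at this
  rw [zpow_sub, this, mul_inv_cancel]

/-- A character with values in `kˣ`, as a homomorphism to the multiplicative monoid of `k`. -/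
abbrev toFieldHom {A : Type*} [Group A] (χ : A →* kˣ) : A →* k := (Units.coeHom k).comp χ

theorem toFieldHom_injective {A : Type*} [Group A] :
    Function.Injective (toFieldHom : (A →* kˣ) → (A →* k)) := by
  intro a b hab
  ext t
  exact DFunLike.congr_fun hab t

theorem linearIndependent_monomialChar (k : Type*) [Field k] [Infinite k] (d : ℕ) :
    LinearIndependent k
      (fun (a : Fin d → ℤ) (t : Fin d → kˣ) => ((monomialChar k a t : kˣ) : k)) :=
  (linearIndependent_monoidHom (Fin d → kˣ) k).comp (fun a => toFieldHom (monomialChar k a))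
    (toFieldHom_injective.comp (monomialChar_injective k d))

/-- Laurent polynomials are linear combinations of monomials. -/
theorem regularTorus_le_span (k : Type*) [Field k] (d : ℕ) :
    Subalgebra.toSubmodule (regularTorus k d) ≤ Submodule.span k
      (Set.range fun (a : Fin d → ℤ) (t : Fin d → kˣ) => ((monomialChar k a t : kˣ) : k)) := by
  unfold regularTorus
  rw [Algebra.adjoin_eq_span]
  apply Submodule.span_mono
  intro f hf
  induction hf using Submonoid.closure_induction with
  | mem f hf =>
    rcases hf with ⟨i, rfl⟩ | ⟨i, rfl⟩
    · exact ⟨Pi.single i 1, by funext t; simp [monomialChar_single]⟩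
    · exact ⟨Pi.single i (-1), by funext t; simp [monomialChar_single]⟩
  | one => exact ⟨0, by funext t; simp [monomialChar_apply]⟩
  | mul f g _ _ hf hg =>
    obtain ⟨a, rfl⟩ := hf
    obtain ⟨b, rfl⟩ := hg
    exact ⟨a + b, by funext t; simp [monomialChar_add]⟩

theorem regularTorus_comp_inv {d : ℕ} {f : (Fin d → kˣ) → k} (hf : f ∈ regularTorus k d) :
    (fun t => f t⁻¹) ∈ regularTorus k d := by
  unfold regularTorus at hf ⊢
  induction hf using Algebra.adjoin_induction with
  | mem f hf =>
    apply Algebra.subset_adjoin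
    rcases hf with ⟨i, rfl⟩ | ⟨i, rfl⟩
    · exact Or.inr ⟨i, rfl⟩
    · exact Or.inl ⟨i, by simp⟩
  | algebraMap r => exact Subalgebra.algebraMap_mem _ r
  | add f g _ _ hf hg => exact Subalgebra.add_mem _ hf hg
  | mul f g _ _ hf hg => exact Subalgebra.mul_mem _ hf hg

/-- Regular functions on a torus become Laurent polynomials in the coordinates. -/
theorem regularTorus_of_isRegular {d : ℕ} (e : (Fin d → kˣ) ≃* T)
    (he : ∀ i j, (fun t => ((e t : GL (Fin n) k) : Matrix (Fin n) (Fin n) k) i j)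
      ∈ regularTorus k d) {f : T → k} (hf : IsRegular T f) :
    (fun t => f (e t)) ∈ regularTorus k d := by
  obtain ⟨F, hF, hfF⟩ := hf
  simp only [hfF]
  clear hfF
  unfold regularGL at hF
  induction hF using Algebra.adjoin_induction with
  | mem f hf =>
    rcases hf with ⟨i, j, rfl⟩ | ⟨i, j, rfl⟩
    · exact he i j
    · have := regularTorus_comp_inv (he i j)
      simpa only [map_inv, Subgroup.coe_inv] using this
  | algebraMap r => exact Subalgebra.algebraMap_mem _ r
  | add f g _ _ hf hg => exact Subalgebra.add_mem _ hf hg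
  | mul f g _ _ hf hg => exact Subalgebra.mul_mem _ hf hg

theorem eval_zero (t : T) : (0 : M T).eval t = 1 := rfl

theorem eval_mul (χ : M T) (s t : T) : χ.eval (s * t) = χ.eval s * χ.eval t :=
  map_mul (Additive.toMul χ : charGroup T).1 s t

theorem eval_one (χ : M T) : χ.eval 1 = 1 := map_one (Additive.toMul χ : charGroup T).1

theorem eval_inv (χ : M T) (t : T) : χ.eval t⁻¹ = (χ.eval t)⁻¹ :=
  map_inv (Additive.toMul χ : charGroup T).1 t

/-- Evaluation at `t`, as a homomorphism on characters. -/
def evalHom (t : T) : M T →+ Additive kˣ where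
  toFun χ := Additive.ofMul (χ.eval t)
  map_zero' := rfl
  map_add' _ _ := rfl

theorem eval_zsmul (m : ℤ) (χ : M T) (t : T) : (m • χ).eval t = χ.eval t ^ m := by
  have := map_zsmul (evalHom t) m χ
  exact congrArg Additive.toMul this

theorem eval_sum {ι : Type*} (s : Finset ι) (f : ι → M T) (t : T) :
    (∑ i ∈ s, f i).eval t = ∏ i ∈ s, (f i).eval t := by
  have := map_sum (evalHom t) f s
  exact congrArg Additive.toMul this

theorem eval_ext {χ ψ : M T} (h : ∀ t, χ.eval t = ψ.eval t) : χ = ψ := by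
  apply Additive.toMul.injective
  apply Subtype.ext
  ext t
  exact congrArg Units.val (h t)

/-- The `i`-th coordinate of a torus, as a character. -/
def coordChar {d : ℕ} (e : (Fin d → kˣ) ≃* T)
    (he : ∀ i, IsRegular T fun t => ((e.symm t i : kˣ) : k)) (i : Fin d) : M T :=
  Additive.ofMul (⟨(Pi.evalMonoidHom _ i).comp e.symm.toMonoidHom, he i⟩ : charGroup T)

theorem coordChar_eval {d : ℕ} (e : (Fin d → kˣ) ≃* T)
    (he : ∀ i, IsRegular T fun t => ((e.symm t i : kˣ) : k)) (i : Fin d) (t : T) :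
    (coordChar e he i).eval t = e.symm t i := rfl

theorem sum_coordChar_eval {d : ℕ} (e : (Fin d → kˣ) ≃* T)
    (he : ∀ i, IsRegular T fun t => ((e.symm t i : kˣ) : k)) (a : Fin d → ℤ) (t : T) :
    (∑ i, a i • coordChar e he i).eval t = monomialChar k a (e.symm t) := by
  rw [eval_sum, monomialChar_apply]
  simp [eval_zsmul, coordChar_eval]

/-- The coordinates of a torus form a basis of its character lattice. -/
theorem exists_charBasis [Infinite k] (hT : IsTorus T) :
    ∃ (d : ℕ) (e : (Fin d → kˣ) ≃* T) (b : Module.Basis (Fin d) ℤ (M T)),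
      (∀ i j, (fun t => ((e t : GL (Fin n) k) : Matrix (Fin n) (Fin n) k) i j)
        ∈ regularTorus k d) ∧ ∀ i t, (b i).eval t = e.symm t i := by
  obtain ⟨-, d, e, he, he'⟩ := hT
  have hli : LinearIndependent ℤ (coordChar e he') := by
    rw [Fintype.linearIndependent_iff]
    intro a ha i
    have : monomialChar k a = monomialChar k 0 := by
      refine MonoidHom.ext fun t => ?_
      have h1 := sum_coordChar_eval e he' a (e t)
      rw [ha, eval_zero] at h1
      simp only [MulEquiv.symm_apply_apply] at h1
      rw [← h1]
      simp [monomialChar_apply]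
    exact congrFun (monomialChar_injective k d this) i
  have hsp : ⊤ ≤ Submodule.span ℤ (Set.range (coordChar e he')) := by
    intro χ _
    have hreg := regularTorus_of_isRegular e he (f := fun t => ((χ.eval t : kˣ) : k))
      (Additive.toMul χ : charGroup T).2
    have hmem := regularTorus_le_span k d hreg
    have key : ∃ a : Fin d → ℤ, toFieldHom (monomialChar k a) =
        toFieldHom (((Additive.toMul χ : charGroup T) : T →* kˣ).comp e.toMonoidHom) := by
      by_contra hno
      have := (linearIndependent_monoidHom (Fin d → kˣ) k).notMem_span_image
        (s := Set.range fun a => toFieldHom (monomialChar k a)) (x := toFieldHom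
          (((Additive.toMul χ : charGroup T) : T →* kˣ).comp e.toMonoidHom))
        (by rintro ⟨a, ha⟩; exact hno ⟨a, ha⟩)
      apply this
      rw [← Set.range_comp]
      exact hmem
    obtain ⟨a, ha⟩ := key
    have : χ = ∑ i, a i • coordChar e he' i := by
      apply eval_ext
      intro t
      rw [sum_coordChar_eval]
      have := DFunLike.congr_fun (toFieldHom_injective ha) (e.symm t)
      rw [this]
      simp [M.eval]
    rw [this]
    exact Submodule.sum_mem _ fun i _ => Submodule.smul_mem _ _
      (Submodule.subset_span (Set.mem_range_self i))
  exact ⟨d, e, Module.Basis.mk hli hsp, he, fun i t => by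
    rw [Module.Basis.mk_apply, coordChar_eval]⟩

/-- Every homomorphism `M → kˣ` is the evaluation at a point of the torus. -/
theorem exists_eval_eq [Infinite k] (hT : IsTorus T) (h : M T →+ Additive kˣ) :
    ∃ t : T, ∀ χ : M T, χ.eval t = (h χ).toMul := by
  obtain ⟨d, e, b, -, hb⟩ := exists_charBasis hT
  refine ⟨e fun i => (h (b i)).toMul, fun χ => ?_⟩
  have : (evalHom (e fun i => (h (b i)).toMul)).toIntLinearMap = h.toIntLinearMap := by
    refine b.ext fun i => ?_
    change Additive.ofMul ((b i).eval _) = h (b i)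
    rw [hb]
    simp
  exact congrArg Additive.toMul (LinearMap.congr_fun this χ)

theorem charLattice_free [Infinite k] (hT : IsTorus T) : Module.Free ℤ (M T) := by
  obtain ⟨d, e, b, -, hb⟩ := exists_charBasis hT
  exact Module.Free.of_basis b

theorem charLattice_finite [Infinite k] (hT : IsTorus T) : Module.Finite ℤ (M T) := by
  obtain ⟨d, e, b, -, hb⟩ := exists_charBasis hT
  exact Module.Finite.of_basis b

/-- Only finitely many elements of a torus have a given exponent. -/
theorem finite_torsion [Infinite k] (hT : IsTorus T) (N : ℕ) (hN : 0 < N) :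
    {t : T | ∀ χ : M T, χ.eval t ^ N = 1}.Finite := by
  classical
  obtain ⟨d, e, b, -, hb⟩ := exists_charBasis hT
  have hfin : {c : kˣ | c ^ N = 1}.Finite := by
    refine Set.Finite.of_finite_image (f := Units.val) ?_ Units.val_injective.injOn
    refine ((Polynomial.nthRoots N (1 : k)).toFinset.finite_toSet).subset ?_
    rintro _ ⟨c, hc, rfl⟩
    have : (c : k) ^ N = 1 := by rw [← Units.val_pow_eq_pow_val, hc]; rfl
    simpa [Polynomial.mem_nthRoots hN] using this
  refine Set.Finite.of_finite_image (f := e.symm) ?_ e.symm.injective.injOn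
  refine (Set.Finite.pi' (t := fun _ : Fin d => {c : kˣ | c ^ N = 1}) fun _ => hfin).subset ?_
  rintro _ ⟨t, ht, rfl⟩ i
  have := ht (b i)
  rwa [hb] at this

variable {V : Type*} [AddCommGroup V] [Module k V]

/-- A vector of a rational representation of a torus is a sum of weight vectors: the matrix
coefficients are Laurent polynomials, whose monomials are linearly independent characters. -/
theorem mem_span_weightVectors [Infinite k] [FiniteDimensional k V] (hT : IsTorus T)
    (σ : Representation k T V) (hσ : IsRationalRep σ) (v : V) :
    v ∈ Submodule.span k {w | ∃ χ : M T, w ∈ weightSpace σ χ} := by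
  classical
  obtain ⟨d, e, b, he, hb⟩ := exists_charBasis hT
  let B := Module.finBasis k V
  have h1 : ∀ j, ∃ c : (Fin d → ℤ) →₀ k, (fun z => B.coord j (σ (e z) v)) =
      c.sum fun a r => r • fun z => ((monomialChar k a z : kˣ) : k) := by
    intro j
    have := regularTorus_le_span k d (regularTorus_of_isRegular e he (hσ v (B.coord j)))
    obtain ⟨c, hc⟩ := Finsupp.mem_span_range_iff_exists_finsupp.1 this
    exact ⟨c, hc.symm⟩
  choose c hc using h1
  let s : Finset (Fin d → ℤ) := Finset.univ.biUnion fun j => (c j).support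
  let u : (Fin d → ℤ) → V := fun a => ∑ j, c j a • B j
  have h2 : ∀ z, σ (e z) v = ∑ a ∈ s, ((monomialChar k a z : kˣ) : k) • u a := by
    intro z
    rw [← B.sum_repr (σ (e z) v)]
    simp only [u, Finset.smul_sum]
    rw [Finset.sum_comm]
    refine Finset.sum_congr rfl fun j _ => ?_
    have h3 := congrFun (hc j) z
    rw [Finsupp.sum_of_support_subset (s := s) _
        (Finset.subset_biUnion_of_mem (fun j => (c j).support) (Finset.mem_univ j)) _ (by simp),
      Finset.sum_apply] at h3
    rw [Module.Basis.coord_apply] at h3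
    rw [h3, Finset.sum_smul]
    refine Finset.sum_congr rfl fun a _ => ?_
    simp only [Pi.smul_apply, smul_eq_mul, smul_smul]
    rw [mul_comm]
  have h4 : ∀ a ∈ s, ∀ z', σ (e z') (u a) = ((monomialChar k a z' : kˣ) : k) • u a := by
    intro a ha z'
    rw [← sub_eq_zero, ← Module.forall_dual_apply_eq_zero_iff k]
    intro l
    have hli := linearIndependent_iff'.1 (linearIndependent_monomialChar k d) s
      (fun a => l (σ (e z') (u a) - ((monomialChar k a z' : kˣ) : k) • u a)) ?_ a ha
    · exact hli
    funext z
    rw [Finset.sum_apply]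
    simp only [Pi.smul_apply, smul_eq_mul, Pi.zero_apply]
    have h5 : σ (e (z' * z)) v = σ (e z') (σ (e z) v) := by
      rw [map_mul, map_mul]; rfl
    rw [h2, h2, map_sum, ← sub_eq_zero, ← Finset.sum_sub_distrib] at h5
    have h6 := congrArg l h5
    rw [map_zero, map_sum, ← neg_eq_zero, ← Finset.sum_neg_distrib] at h6
    rw [← h6]
    refine Finset.sum_congr rfl fun a _ => ?_
    simp only [map_mul, map_sub, map_smul, smul_eq_mul, Units.val_mul]
    ring
  have h7 : v = ∑ a ∈ s, u a := by
    have := h2 1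
    simpa using this
  rw [h7]
  refine Submodule.sum_mem _ fun a ha => Submodule.subset_span ⟨∑ i, a i • b i, fun t => ?_⟩
  have h8 := h4 a ha (e.symm t)
  rw [MulEquiv.apply_symm_apply] at h8
  rw [h8, eval_sum, monomialChar_apply]
  simp [eval_zsmul, hb]

/-- A rational representation of a torus has a basis of weight vectors. -/
theorem exists_weightBasis [Infinite k] [FiniteDimensional k V] (hT : IsTorus T)
    (σ : Representation k T V) (hσ : IsRationalRep σ) :
    ∃ (m : ℕ) (b : Module.Basis (Fin m) k V) (wt : Fin m → M T),
      ∀ i, b i ∈ weightSpace σ (wt i) := by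
  have hsp : ⊤ ≤ Submodule.span k {w | ∃ χ : M T, w ∈ weightSpace σ χ} :=
    fun v _ => mem_span_weightVectors hT σ hσ v
  let b₀ := Module.Basis.ofSpan hsp
  let := FiniteDimensional.fintypeBasisIndex b₀
  let b := b₀.reindex (Fintype.equivFin _)
  have hb : ∀ i, ∃ χ : M T, b i ∈ weightSpace σ χ := by
    intro i
    rw [Module.Basis.reindex_apply]
    exact Module.Basis.ofSpan_subset hsp (Set.mem_range_self _)
  choose wt hwt using hb
  exact ⟨_, b, wt, hwt⟩

end Torus

/-! ### Relative interiors and linear functionals -/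

section Convexity

variable {E : Type*} [NormedAddCommGroup E] [NormedSpace ℝ E]

/-- The segment from a point of the set to the origin can be prolonged inside the set. -/
theorem exists_neg_smul_mem_of_zero_mem_intrinsicInterior {K : Set E}
    (h : (0 : E) ∈ intrinsicInterior ℝ K) {x : E} (hx : x ∈ K) :
    ∃ ε : ℝ, 0 < ε ∧ (-ε) • x ∈ K := by
  obtain ⟨y, hy, hy0⟩ := mem_intrinsicInterior.1 h
  have h0 : (0 : E) ∈ affineSpan ℝ K := hy0 ▸ y.2
  have hmem : ∀ r : ℝ, r • x ∈ affineSpan ℝ K := by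
    intro r
    have := AffineMap.lineMap_mem (Q := affineSpan ℝ K) r h0 (subset_affineSpan ℝ K hx)
    simpa [AffineMap.lineMap_apply] using this
  let γ : ℝ → affineSpan ℝ K := fun r => ⟨r • x, hmem r⟩
  have hγ : Continuous γ := Continuous.subtype_mk (by fun_prop) _
  have hopen : IsOpen (γ ⁻¹' interior ((↑) ⁻¹' K : Set (affineSpan ℝ K))) :=
    isOpen_interior.preimage hγ
  have hγ0 : γ 0 = y := Subtype.ext (by simp [γ, hy0])
  have h0mem : (0 : ℝ) ∈ γ ⁻¹' interior ((↑) ⁻¹' K : Set (affineSpan ℝ K)) := by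
    rw [Set.mem_preimage, hγ0]
    exact hy
  obtain ⟨ε, hε, hball⟩ := Metric.isOpen_iff.1 hopen 0 h0mem
  refine ⟨ε / 2, by positivity, ?_⟩
  have : -(ε / 2) ∈ Metric.ball (0 : ℝ) ε := by
    rw [mem_ball_zero_iff, norm_neg, Real.norm_of_nonneg (by positivity)]
    linarith
  have hin : γ (-(ε / 2)) ∈ interior ((↑) ⁻¹' K : Set (affineSpan ℝ K)) := hball this
  have := interior_subset hin
  exact this

/-- By Hahn-Banach: if the origin is not an interior point, some nonzero functional has constant
sign. -/
theorem zero_mem_interior_convexHull_of_functional [FiniteDimensional ℝ E] {s : Set E}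
    (hs : s.Nonempty) (hspan : Submodule.span ℝ s = ⊤)
    (h : ∀ f : E →ₗ[ℝ] ℝ, (∀ x ∈ s, 0 ≤ f x) → ∀ x ∈ s, f x = 0) :
    (0 : E) ∈ interior (convexHull ℝ s) := by
  -- as `s` spans, a functional of constant sign on `s` vanishes
  have h' : ∀ f : E →ₗ[ℝ] ℝ, (∀ x ∈ s, 0 ≤ f x) → f = 0 := by
    intro f hf
    refine LinearMap.ext_on hspan fun x hx => ?_
    rw [h f hf x hx, LinearMap.zero_apply]
  have hne : (interior (convexHull ℝ s)).Nonempty := by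
    rw [interior_convexHull_nonempty_iff_affineSpan_eq_top]
    by_contra htop
    obtain ⟨p, hp⟩ := hs
    have hlt : vectorSpan ℝ s < ⊤ := by
      rw [lt_top_iff_ne_top]
      intro hv
      apply htop
      rw [AffineSubspace.affineSpan_eq_top_iff_vectorSpan_eq_top_of_nonempty ℝ E E ⟨p, hp⟩]
      exact hv
    obtain ⟨f, hf0, hf⟩ := Submodule.exists_le_ker_of_lt_top _ hlt
    have hconst : ∀ x ∈ s, f x = f p := by
      intro x hx
      have : f (x -ᵥ p) = 0 := hf (vsub_mem_vectorSpan ℝ hx hp)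
      rwa [vsub_eq_sub, map_sub, sub_eq_zero] at this
    rcases le_total 0 (f p) with h0 | h0
    · exact hf0 (h' f fun x hx => by rw [hconst x hx]; exact h0)
    · refine hf0 (neg_eq_zero.1 (h' (-f) fun x hx => ?_))
      rw [LinearMap.neg_apply, hconst x hx]
      linarith
  by_contra h0
  obtain ⟨f, hf0, hf⟩ :=
    geometric_hahn_banach_of_nonempty_interior_point (convex_convexHull ℝ s) h0 hne
  apply hf0
  have := h' (-(f : E →ₗ[ℝ] ℝ)) fun x hx => by
    have := hf x (subset_convexHull ℝ s hx)
    simpa using this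
  ext x
  have := LinearMap.congr_fun this x
  simpa using this

/-- The origin is in the relative interior of a hull if and only if no supporting functional at the
origin separates properly. -/
theorem zero_mem_intrinsicInterior_convexHull_iff [FiniteDimensional ℝ E] {s : Set E} :
    (0 : E) ∈ intrinsicInterior ℝ (convexHull ℝ s) ↔
      s.Nonempty ∧ ∀ f : E →ₗ[ℝ] ℝ, (∀ x ∈ s, 0 ≤ f x) → ∀ x ∈ s, f x = 0 := by
  constructor
  · intro h
    refine ⟨convexHull_nonempty_iff.1 ⟨0, intrinsicInterior_subset h⟩, fun f hf x hx => ?_⟩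
    obtain ⟨ε, hε, hmem⟩ :=
      exists_neg_smul_mem_of_zero_mem_intrinsicInterior h (subset_convexHull ℝ s hx)
    have hK : convexHull ℝ s ⊆ {y | 0 ≤ f y} :=
      convexHull_min hf (convex_halfSpace_ge f.isLinear 0)
    have h1 : 0 ≤ f ((-ε) • x) := hK hmem
    have h2 := hf x hx
    rw [map_smul, smul_eq_mul] at h1
    nlinarith
  · rintro ⟨hs, h⟩
    let A := Submodule.span ℝ s
    let s' : Set A := A.subtype ⁻¹' s
    have himg : A.subtype '' s' = s := by
      rw [Set.image_preimage_eq_inter_range]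
      simp [A, Submodule.subset_span]
    have hspan : Submodule.span ℝ s' = ⊤ := Submodule.span_span_coe_preimage
    have h0 : (0 : A) ∈ interior (convexHull ℝ s') := by
      refine zero_mem_interior_convexHull_of_functional ?_ hspan fun f hf x hx => ?_
      · obtain ⟨p, hp⟩ := hs
        exact ⟨⟨p, Submodule.subset_span hp⟩, hp⟩
      · obtain ⟨g, hg⟩ := LinearMap.exists_extend f
        have hgf : ∀ a : A, g a = f a := fun a => LinearMap.congr_fun hg a
        rw [← hgf]
        refine h g (fun y hy => ?_) x hx
        have := hf ⟨y, Submodule.subset_span hy⟩ hy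
        rwa [← hgf] at this
    have h1 := (A.subtypeₗᵢ.toAffineIsometry).intrinsicInterior_image (convexHull ℝ s')
    have h2 : A.subtypeₗᵢ.toAffineIsometry '' (convexHull ℝ s') = convexHull ℝ s := by
      have := A.subtype.image_convexHull s'
      rw [himg] at this
      exact this
    rw [h2] at h1
    rw [h1]
    exact ⟨0, interior_subset_intrinsicInterior h0, rfl⟩

theorem exists_pos_functional_of_zero_notMem_convexHull [FiniteDimensional ℝ E] {s : Set E}
    (hs : s.Finite) (h : (0 : E) ∉ convexHull ℝ s) :
    ∃ f : E →ₗ[ℝ] ℝ, ∀ x ∈ s, 0 < f x := by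
  obtain ⟨f, u, hu, hf⟩ := geometric_hahn_banach_point_closed (convex_convexHull ℝ s)
    (hs.isCompact_convexHull ℝ).isClosed h
  rw [map_zero] at hu
  exact ⟨f, fun x hx => hu.trans (hf x (subset_convexHull ℝ s hx))⟩

end Convexity

section ModuleTopology

variable (E : Type*) [AddCommGroup E] [Module ℝ E] [Module.Finite ℝ E]

/-- The norm of a finite-dimensional real vector space given by coordinates. -/
noncomputable abbrev coordNorm : NormedAddCommGroup E :=
  NormedAddCommGroup.induced E _ (Module.finBasis ℝ E).equivFun.toLinearMap
    (Module.finBasis ℝ E).equivFun.injective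

/-- A finite-dimensional real vector space is a normed space for `coordNorm`. -/
noncomputable abbrev coordNormedSpace :
    @NormedSpace ℝ E _ (coordNorm E).toSeminormedAddCommGroup :=
  NormedSpace.induced ℝ E _ (Module.finBasis ℝ E).equivFun.toLinearMap

variable {E}

/-- The module topology of a finite-dimensional space is the topology of its coordinate norm, which
gives access to the theorems on normed spaces. -/
theorem intrinsicInterior_moduleTopology (s : Set E) :
    @intrinsicInterior ℝ E E _ _ _ (moduleTopology ℝ E) _ s =
      @intrinsicInterior ℝ E E _ _ _
        (coordNorm E).toPseudoMetricSpace.toUniformSpace.toTopologicalSpace _ s := by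
  let := coordNorm E
  let := coordNormedSpace E
  have : IsModuleTopology ℝ E := isModuleTopologyOfFiniteDimensional
  rw [← eq_moduleTopology ℝ E]

theorem zero_mem_relint_convexHull_iff {s : Set E} :
    (0 : E) ∈ @intrinsicInterior ℝ E E _ _ _ (moduleTopology ℝ E) _ (convexHull ℝ s) ↔
      s.Nonempty ∧ ∀ f : E →ₗ[ℝ] ℝ, (∀ x ∈ s, 0 ≤ f x) → ∀ x ∈ s, f x = 0 := by
  rw [intrinsicInterior_moduleTopology]
  let := coordNorm E
  let := coordNormedSpace E
  exact zero_mem_intrinsicInterior_convexHull_iff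

theorem exists_neg_smul_mem_of_zero_mem_relint {K : Set E}
    (h : (0 : E) ∈ @intrinsicInterior ℝ E E _ _ _ (moduleTopology ℝ E) _ K) {x : E}
    (hx : x ∈ K) : ∃ ε : ℝ, 0 < ε ∧ (-ε) • x ∈ K := by
  rw [intrinsicInterior_moduleTopology] at h
  let := coordNorm E
  let := coordNormedSpace E
  exact exists_neg_smul_mem_of_zero_mem_intrinsicInterior h hx

theorem exists_pos_functional {s : Set E} (hs : s.Finite) (h : (0 : E) ∉ convexHull ℝ s) :
    ∃ f : E →ₗ[ℝ] ℝ, ∀ x ∈ s, 0 < f x := by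
  let := coordNorm E
  let := coordNormedSpace E
  exact exists_pos_functional_of_zero_notMem_convexHull hs h

end ModuleTopology

/-! ### Integral approximation -/

section Integrality

/-- A real-valued functional on a finitely generated abelian group can be replaced by an
integral one that has the same sign on each member of a given finite set. The image of the
functional is free, with a basis `r`; perturb the members of `r` to rational numbers, which does not
affect the zeros, and clear denominators. -/
theorem exists_int_functional_sign_eq {A : Type*} [AddCommGroup A] [Module.Finite ℤ A]
    (f : A →+ ℝ) (s : Finset A) :
    ∃ g : A →+ ℤ, ∀ a ∈ s, SignType.sign (g a) = SignType.sign (f a) := by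
  classical
  let F := f.toIntLinearMap
  let R := LinearMap.range F
  obtain ⟨m, r⟩ : Σ m : ℕ, Module.Basis (Fin m) ℤ R :=
    Module.basisOfFiniteTypeTorsionFree'
  let c : Fin m → A →ₗ[ℤ] ℤ := fun j => (r.coord j).comp F.rangeRestrict
  have hf : ∀ a, f a = ∑ j, (c j a : ℝ) * (r j : ℝ) := by
    intro a
    have h1 := congrArg (Subtype.val) (r.sum_repr (F.rangeRestrict a))
    rw [AddSubmonoidClass.coe_finsetSum] at h1
    have h2 : ((F.rangeRestrict a : R) : ℝ) = f a := rfl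
    rw [← h2, ← h1]
    refine Finset.sum_congr rfl fun j _ => ?_
    simp [c]
  have hzero : ∀ a, f a = 0 → ∀ j, c j a = 0 := by
    intro a ha j
    have : F.rangeRestrict a = 0 := Subtype.ext ha
    simp [c, this]
  let U : Set (Fin m → ℝ) := ⋂ a ∈ s, {q | (0 < f a → 0 < ∑ j, (c j a : ℝ) * q j) ∧
    (f a < 0 → ∑ j, (c j a : ℝ) * q j < 0)}
  have hU : IsOpen U := by
    refine isOpen_biInter_finset fun a _ => ?_
    have h1 : Continuous fun q : Fin m → ℝ => ∑ j, (c j a : ℝ) * q j := by fun_prop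
    have e : {q : Fin m → ℝ | (0 < f a → 0 < ∑ j, (c j a : ℝ) * q j) ∧
        (f a < 0 → ∑ j, (c j a : ℝ) * q j < 0)} =
        {q | 0 < f a → 0 < ∑ j, (c j a : ℝ) * q j} ∩
          {q | f a < 0 → ∑ j, (c j a : ℝ) * q j < 0} := rfl
    rw [e]
    refine IsOpen.inter ?_ ?_
    · by_cases h : 0 < f a
      · simpa [h] using isOpen_lt continuous_const h1
      · simp [h]
    · by_cases h : f a < 0
      · simpa [h] using isOpen_lt h1 continuous_const
      · simp [h]
  have hrU : (fun j => (r j : ℝ)) ∈ U := by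
    refine Set.mem_iInter₂.2 fun a _ => ?_
    have := hf a
    exact ⟨fun h => by rw [← this]; exact h, fun h => by rw [← this]; exact h⟩
  have hdense : DenseRange (Pi.map fun _ : Fin m => ((↑) : ℚ → ℝ)) :=
    DenseRange.piMap fun _ => Rat.denseRange_cast
  obtain ⟨q, hq⟩ := hdense.exists_mem_open hU ⟨_, hrU⟩
  let D : ℕ := ∏ j, (q j).den
  have hD : 0 < D := Finset.prod_pos fun j _ => (q j).den_pos
  have hint : ∀ j, ∃ p : ℤ, (p : ℝ) = D * q j := by
    intro j
    obtain ⟨e, he⟩ : (q j).den ∣ D := Finset.dvd_prod_of_mem _ (Finset.mem_univ j)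
    refine ⟨e * (q j).num, ?_⟩
    rw [he]
    have : ((q j : ℚ) : ℝ) * (q j).den = (q j).num := by exact_mod_cast (q j).mul_den_eq_num
    push_cast
    rw [← this]
    ring
  choose p hp using hint
  let g : A →ₗ[ℤ] ℤ := ∑ j, p j • c j
  have hg : ∀ a, (g a : ℝ) = D * ∑ j, (c j a : ℝ) * q j := by
    intro a
    simp only [g, LinearMap.sum_apply, LinearMap.smul_apply, smul_eq_mul]
    push_cast
    rw [Finset.mul_sum]
    refine Finset.sum_congr rfl fun j _ => ?_
    rw [hp]
    ring
  refine ⟨g.toAddMonoidHom, fun a ha => ?_⟩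
  change SignType.sign (g a) = _
  have hqa := Set.mem_iInter₂.1 hq a ha
  have hDr : (0 : ℝ) < D := by exact_mod_cast hD
  rcases lt_trichotomy (f a) 0 with h | h | h
  · have h1 : (g a : ℝ) < 0 := by rw [hg]; exact mul_neg_of_pos_of_neg hDr (hqa.2 h)
    rw [sign_neg h, sign_neg (by exact_mod_cast h1)]
  · have h1 : (g a : ℝ) = 0 := by rw [hg]; simp [hzero a h]
    rw [h, sign_zero, sign_eq_zero_iff]
    exact_mod_cast h1
  · have h1 : (0 : ℝ) < g a := by rw [hg]; exact mul_pos hDr (hqa.1 h)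
    rw [sign_pos h, sign_pos (by exact_mod_cast h1)]

end Integrality

/-! ### States and convexity -/

section StateConvexity

variable {k : Type*} [Field k] {n : ℕ} {T : Subgroup (GL (Fin n) k)}

/-- The map `M → M_ℝ`, as a `ℤ`-linear map. -/
def toMRHom : M T →ₗ[ℤ] MR T := (TensorProduct.mk ℤ ℝ (M T)) 1

/-- The real functional on `M_ℝ` that extends an additive map `M → ℝ`. -/
noncomputable def extendNR (g : M T →+ ℝ) : NR T := g.toIntLinearMap.liftBaseChange ℝ

theorem extendNR_toMR (g : M T →+ ℝ) (χ : M T) : extendNR g (toMR χ) = g χ := by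
  simp [extendNR, toMR]

/-- The restriction to `M` of an element of `N_ℝ`. -/
def restrictNR (lam : NR T) : M T →+ ℝ := lam.toAddMonoidHom.comp toMRHom.toAddMonoidHom

theorem span_range_toMR : Submodule.span ℝ (Set.range (toMR : M T → MR T)) = ⊤ := by
  rw [eq_top_iff]
  intro x _
  induction x using TensorProduct.induction_on with
  | zero => exact Submodule.zero_mem _
  | tmul r χ =>
    have : r ⊗ₜ[ℤ] χ = r • toMR χ := by simp [toMR, TensorProduct.smul_tmul']
    rw [this]
    exact Submodule.smul_mem _ _ (Submodule.subset_span ⟨χ, rfl⟩)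
  | add x y hx hy => exact Submodule.add_mem _ (hx trivial) (hy trivial)

theorem NR_ext {lam mu : NR T} (h : ∀ χ : M T, lam (toMR χ) = mu (toMR χ)) : lam = mu := by
  refine LinearMap.ext_on_range span_range_toMR h

theorem toMR_mem_realize {S : Finset (M T)} {χ : M T} (h : χ ∈ S) : toMR χ ∈ realize S :=
  ⟨χ, h, rfl⟩

theorem realize_finite (S : Finset (M T)) : (realize S).Finite := S.finite_toSet.image _

theorem ZeroMemConv.nonempty {S : Finset (M T)} (h : ZeroMemConv S) : S.Nonempty := by
  have : (realize S).Nonempty := convexHull_nonempty_iff.1 ⟨0, h⟩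
  simpa [realize] using this

theorem ZeroMemConv.mono {S S' : Finset (M T)} (h : ZeroMemConv S) (hS : S ⊆ S') :
    ZeroMemConv S' :=
  convexHull_mono (Set.image_mono (by exact_mod_cast hS)) h

theorem exists_weights_of_mem_convexHull {S : Finset (M T)} {x : MR T}
    (h : x ∈ convexHull ℝ (realize S)) :
    ∃ w : M T → ℝ, (∀ χ ∈ S, 0 ≤ w χ) ∧ ∑ χ ∈ S, w χ = 1 ∧ ∑ χ ∈ S, w χ • toMR χ = x := by
  classical
  let C : Set (MR T) := {x | ∃ w : M T → ℝ, (∀ χ ∈ S, 0 ≤ w χ) ∧ ∑ χ ∈ S, w χ = 1 ∧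
    ∑ χ ∈ S, w χ • toMR χ = x}
  have hC : Convex ℝ C := by
    rintro x ⟨w, hw, hw1, rfl⟩ y ⟨v, hv, hv1, rfl⟩ a b ha hb hab
    refine ⟨fun χ => a * w χ + b * v χ, fun χ hχ => ?_, ?_, ?_⟩
    · have := hw χ hχ
      have := hv χ hχ
      positivity
    · rw [Finset.sum_add_distrib, ← Finset.mul_sum, ← Finset.mul_sum, hw1, hv1]
      linarith
    · simp only [add_smul, mul_smul, Finset.sum_add_distrib, Finset.smul_sum]
  have hsub : realize S ⊆ C := by
    rintro _ ⟨χ, hχ, rfl⟩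
    have hχ' : χ ∈ S := hχ
    refine ⟨Pi.single χ 1, fun ψ _ => ?_, ?_, ?_⟩
    · rw [Pi.single_apply]
      split_ifs <;> norm_num
    · simp [Pi.single_apply, hχ']
    · simp [Pi.single_apply, ite_smul, hχ']
  exact convexHull_min hsub hC h

/-- The sign of an integral functional agrees with that of a real one on a finite set. -/
theorem exists_int_functional [Module.Finite ℤ (M T)] (lam : NR T) (S : Finset (M T)) :
    ∃ g : M T →+ ℤ, ∀ χ ∈ S, SignType.sign (g χ) = SignType.sign (lam (toMR χ)) :=
  exists_int_functional_sign_eq (restrictNR lam) S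

theorem ZeroMemRelint.zeroMemConv {S : Finset (M T)} (h : ZeroMemRelint S) : ZeroMemConv S := by
  let := moduleTopology ℝ (MR T)
  exact intrinsicInterior_subset h

/-- If the hull contains the origin, then its affine span is the linear span of the state. -/
theorem finrank_spanR_eq_dimConv {S : Finset (M T)} (h : ZeroMemConv S) :
    dimConv S = Module.finrank ℝ (spanR S) := by
  have hspan : Submodule.span ℝ (convexHull ℝ (realize S)) = spanR S := by
    apply le_antisymm
    · refine Submodule.span_le.2 (convexHull_min Submodule.subset_span (Submodule.convex _))
    · exact Submodule.span_mono (subset_convexHull ℝ _)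
  unfold dimConv
  rw [vectorSpan_eq_span_vsub_set_right ℝ (show (0 : MR T) ∈ convexHull ℝ (realize S) from h)]
  have e : (fun x : MR T => x -ᵥ (0 : MR T)) = id := by
    funext x
    exact sub_zero x
  rw [e, Set.image_id, hspan]

variable [Module.Finite ℤ (M T)]

theorem zeroMemRelint_iff (S : Finset (M T)) : ZeroMemRelint S ↔ S.Nonempty ∧
    ∀ lam : NR T, (∀ χ ∈ S, 0 ≤ lam (toMR χ)) → ∀ χ ∈ S, lam (toMR χ) = 0 := by
  refine zero_mem_relint_convexHull_iff.trans ?_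
  simp only [realize, Set.image_nonempty, Finset.coe_nonempty, Set.forall_mem_image,
    Finset.mem_coe]

theorem ZeroMemRelint.exists_neg_smul_mem {S : Finset (M T)} (h : ZeroMemRelint S) {χ : M T}
    (hχ : χ ∈ S) : ∃ ε : ℝ, 0 < ε ∧ (-ε) • toMR χ ∈ convexHull ℝ (realize S) :=
  exists_neg_smul_mem_of_zero_mem_relint h (subset_convexHull ℝ _ (toMR_mem_realize hχ))

/-- A larger state with the same span still has the origin in its relative interior. -/
theorem ZeroMemRelint.mono {S S' : Finset (M T)} (h : ZeroMemRelint S) (hS : S ⊆ S')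
    (hspan : ∀ χ ∈ S', toMR χ ∈ spanR S) : ZeroMemRelint S' := by
  rw [zeroMemRelint_iff] at h ⊢
  refine ⟨h.1.mono hS, fun lam hlam χ hχ => ?_⟩
  have h0 := h.2 lam fun ψ hψ => hlam ψ (hS hψ)
  have : spanR S ≤ LinearMap.ker lam := by
    refine Submodule.span_le.2 ?_
    rintro _ ⟨ψ, hψ, rfl⟩
    exact h0 ψ hψ
  exact this (hspan χ hχ)

theorem exists_int_functional_pos {S : Finset (M T)} (h : ¬ ZeroMemConv S) :
    ∃ g : M T →+ ℤ, ∀ χ ∈ S, 0 < g χ := by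
  obtain ⟨lam, hlam⟩ :=
    exists_pos_functional (realize_finite S) h
  obtain ⟨g, hg⟩ := exists_int_functional lam S
  refine ⟨g, fun χ hχ => ?_⟩
  rw [← sign_eq_one_iff, hg χ hχ, sign_eq_one_iff]
  exact hlam _ (toMR_mem_realize hχ)

theorem exists_int_functional_nonneg {S : Finset (M T)} (hS : S.Nonempty)
    (h : ¬ ZeroMemRelint S) :
    ∃ g : M T →+ ℤ, (∀ χ ∈ S, 0 ≤ g χ) ∧ ∃ χ ∈ S, 0 < g χ := by
  rw [zeroMemRelint_iff] at h
  push Not at h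
  obtain ⟨lam, hlam, χ, hχ, hne⟩ := h hS
  obtain ⟨g, hg⟩ := exists_int_functional lam S
  refine ⟨g, fun ψ hψ => ?_, χ, hχ, ?_⟩
  · rw [← sign_nonneg_iff, hg ψ hψ, sign_nonneg_iff]
    exact hlam ψ hψ
  · rw [← sign_eq_one_iff, hg χ hχ, sign_eq_one_iff]
    exact lt_of_le_of_ne (hlam χ hχ) (Ne.symm hne)

theorem exists_int_functional_vanishing {S : Finset (M T)} {A : Submodule ℝ (MR T)}
    (hA : A ≠ ⊤) (hS : realize S ⊆ A) :
    ∃ g : M T →+ ℤ, g ≠ 0 ∧ ∀ χ ∈ S, g χ = 0 := by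
  classical
  obtain ⟨lam, hlam, hle⟩ := Submodule.exists_le_ker_of_lt_top A (lt_top_iff_ne_top.2 hA)
  obtain ⟨χ, hχ⟩ : ∃ χ : M T, lam (toMR χ) ≠ 0 := by
    by_contra! h
    exact hlam (NR_ext h)
  obtain ⟨g, hg⟩ := exists_int_functional lam (insert χ S)
  refine ⟨g, ?_, fun ψ hψ => ?_⟩
  · rintro rfl
    have := hg χ (Finset.mem_insert_self _ _)
    rw [AddMonoidHom.zero_apply, sign_zero, eq_comm, sign_eq_zero_iff] at this
    exact hχ this
  · rw [← sign_eq_zero_iff, hg ψ (Finset.mem_insert_of_mem hψ), sign_eq_zero_iff]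
    exact hle (hS (toMR_mem_realize hψ))

variable [Module.Free ℤ (M T)]

/-- Real linear relations between characters can be replaced by integral ones with the same
signs. -/
theorem exists_int_relation {J : Type*} [Fintype J] (a : J → M T) (y : J → ℝ)
    (h : ∑ j, y j • toMR (a j) = 0) :
    ∃ m : J → ℤ, ∑ j, m j • a j = 0 ∧ ∀ j, SignType.sign (m j) = SignType.sign (y j) := by
  classical
  let b := Module.finBasis ℤ (M T)
  let f : (J → ℤ) →+ ℝ :=
    ∑ j, ((AddMonoidHom.mulRight (y j)).comp (Int.castAddHom ℝ)).comp (Pi.evalAddMonoidHom _ j)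
  have hf : ∀ v, f v = ∑ j, (v j : ℝ) * y j := by
    intro v
    simp [f]
  obtain ⟨g, hg⟩ := exists_int_functional_sign_eq f
    (Finset.univ.image (fun j => (Pi.single j 1 : J → ℤ)) ∪
      Finset.univ.image fun i => fun j => b.repr (a j) i)
  have hgv : ∀ v, g v = ∑ j, v j * g (Pi.single j 1) := by
    intro v
    conv_lhs => rw [← Finset.univ_sum_single v]
    rw [map_sum]
    refine Finset.sum_congr rfl fun j _ => ?_
    rw [← smul_eq_mul, ← map_zsmul, ← Pi.single_smul, smul_eq_mul, mul_one]
  refine ⟨fun j => g (Pi.single j 1), ?_, fun j => ?_⟩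
  · apply b.repr.injective
    ext i
    rw [map_sum, map_zero, Finsupp.finsetSum_apply]
    simp only [map_zsmul, Finsupp.smul_apply, smul_eq_mul, Finsupp.zero_apply]
    have h1 : g (fun j => b.repr (a j) i) = 0 := by
      rw [← sign_eq_zero_iff, hg _ (by simp), sign_eq_zero_iff, hf]
      have h2 := congrArg (extendNR ((Int.castAddHom ℝ).comp (b.coord i).toAddMonoidHom)) h
      rw [map_zero, map_sum] at h2
      rw [← h2]
      refine Finset.sum_congr rfl fun j _ => ?_
      rw [map_smul, extendNR_toMR, smul_eq_mul, mul_comm]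
      rfl
    rw [← h1, hgv]
    exact Finset.sum_congr rfl fun j _ => mul_comm _ _
  · rw [hg _ (by simp), hf]
    congr 1
    rw [Finset.sum_eq_single j] <;> simp +contextual

/-- Nonnegative real relations between the members of a state can be replaced by relations with
natural coefficients and the same support. -/
theorem exists_nat_relation (S : Finset (M T)) (y : M T → ℝ) (hy : ∀ χ ∈ S, 0 ≤ y χ)
    (h : ∑ χ ∈ S, y χ • toMR χ = 0) :
    ∃ m : M T → ℕ, ∑ χ ∈ S, m χ • χ = 0 ∧ ∀ χ ∈ S, 0 < y χ → 0 < m χ := by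
  classical
  obtain ⟨m, hm, hs⟩ := exists_int_relation (fun χ : S => (χ : M T)) (fun χ => y χ) (by
    rw [← h]
    exact Finset.sum_coe_sort S fun χ => y χ • toMR χ)
  have hnn : ∀ χ, 0 ≤ m χ := by
    intro χ
    rw [← sign_nonneg_iff, hs χ, sign_nonneg_iff]
    exact hy χ χ.2
  refine ⟨fun χ => if hχ : χ ∈ S then (m ⟨χ, hχ⟩).toNat else 0, ?_, fun χ hχ hpos => ?_⟩
  · rw [← hm, ← Finset.sum_coe_sort S]
    refine Finset.sum_congr rfl fun χ _ => ?_
    have e : ((m χ).toNat : ℤ) = m χ := Int.toNat_of_nonneg (hnn χ)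
    conv_rhs => rw [← e, natCast_zsmul]
    simp
  · have : 0 < m ⟨χ, hχ⟩ := by
      rw [← sign_eq_one_iff, hs, sign_eq_one_iff]
      exact hpos
    simp only [hχ, dif_pos]
    omega

/-- If the origin is in the convex hull, there is a nontrivial relation with natural
coefficients. -/
theorem ZeroMemConv.exists_nat_relation {S : Finset (M T)} (h : ZeroMemConv S) :
    ∃ m : M T → ℕ, ∑ χ ∈ S, m χ • χ = 0 ∧ 0 < ∑ χ ∈ S, m χ := by
  classical
  obtain ⟨w, hw, hw1, hw0⟩ := exists_weights_of_mem_convexHull h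
  obtain ⟨m, hm, hpos⟩ := TPolystable.exists_nat_relation S w hw hw0
  refine ⟨m, hm, ?_⟩
  obtain ⟨χ, hχ, hne⟩ : ∃ χ ∈ S, w χ ≠ 0 := by
    by_contra! h0
    rw [Finset.sum_eq_zero h0] at hw1
    exact zero_ne_one hw1
  exact Finset.sum_pos' (fun _ _ => Nat.zero_le _)
    ⟨χ, hχ, hpos χ hχ (lt_of_le_of_ne (hw χ hχ) (Ne.symm hne))⟩

/-- If the origin is in the relative interior, there is a relation with positive coefficients. -/
theorem ZeroMemRelint.exists_nat_relation {S : Finset (M T)} (h : ZeroMemRelint S) :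
    ∃ m : M T → ℕ, ∑ χ ∈ S, m χ • χ = 0 ∧ ∀ χ ∈ S, 0 < m χ := by
  classical
  have h1 : ∀ χ : S, ∃ y : M T → ℝ, (∀ ψ ∈ S, 0 ≤ y ψ) ∧ ∑ ψ ∈ S, y ψ • toMR ψ = 0 ∧
      0 < y χ := by
    intro χ
    obtain ⟨ε, hε, hmem⟩ := h.exists_neg_smul_mem χ.2
    obtain ⟨w, hw, -, hwx⟩ := exists_weights_of_mem_convexHull hmem
    refine ⟨w + Pi.single (χ : M T) ε, fun ψ hψ => ?_, ?_, ?_⟩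
    · have := hw ψ hψ
      rw [Pi.add_apply, Pi.single_apply]
      split_ifs <;> linarith
    · simp only [Pi.add_apply, add_smul, Finset.sum_add_distrib, hwx]
      simp [Pi.single_apply, ite_smul]
    · have := hw χ χ.2
      rw [Pi.add_apply, Pi.single_eq_same]
      linarith
  choose y hy hy0 hypos using h1
  obtain ⟨m, hm, hpos⟩ := TPolystable.exists_nat_relation S (fun ψ => ∑ χ : S, y χ ψ)
    (fun ψ hψ => Finset.sum_nonneg fun χ _ => hy χ ψ hψ) (by
      simp only [Finset.sum_smul]
      rw [Finset.sum_comm]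
      exact Finset.sum_eq_zero fun χ _ => hy0 χ)
  refine ⟨m, hm, fun χ hχ => hpos χ hχ ?_⟩
  exact Finset.sum_pos' (fun ψ _ => hy ψ χ hχ) ⟨⟨χ, hχ⟩, Finset.mem_univ _, hypos ⟨χ, hχ⟩⟩

/-- If a state spans `M_ℝ`, every character has a nonzero multiple in its integral span. -/
theorem exists_zsmul_eq_sum {S : Finset (M T)} (h : spanR S = ⊤) (χ : M T) :
    ∃ (N : ℤ) (m : S → ℤ), N ≠ 0 ∧ N • χ = ∑ ψ, m ψ • (ψ : M T) := by
  classical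
  have hχ : toMR χ ∈ Submodule.span ℝ (Set.range fun ψ : S => toMR (ψ : M T)) := by
    have e : (Set.range fun ψ : S => toMR (ψ : M T)) = realize S := by
      ext x
      simp [realize]
    rw [e]
    change toMR χ ∈ spanR S
    rw [h]
    exact Submodule.mem_top
  obtain ⟨c, hc⟩ := (Submodule.mem_span_range_iff_exists_fun ℝ).1 hχ
  obtain ⟨m, hm, hs⟩ := exists_int_relation (J := Option S)
    (fun j => j.elim χ fun ψ => ψ) (fun j => j.elim (-1) c) (by
      rw [Fintype.sum_option]
      simp only [Option.elim_none, Option.elim_some, hc]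
      module)
  refine ⟨-m none, fun ψ => m (some ψ), ?_, ?_⟩
  · have := hs none
    intro h0
    rw [neg_eq_zero.1 h0] at this
    simp at this
  · rw [Fintype.sum_option] at hm
    rw [neg_smul, neg_eq_iff_add_eq_zero]
    exact hm

end StateConvexity

/-! ### Homogeneous polynomials, sections and limits along curves -/

section Projective

variable {k : Type*} [Field k] {V : Type*} [AddCommGroup V] [Module k V]

theorem isHomogeneousPoly_one : IsHomogeneousPoly 0 (1 : Module.Dual k V → k) :=
  ⟨Subalgebra.one_mem _, fun c φ => by simp⟩

theorem isHomogeneousPoly_eval (v : V) :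
    IsHomogeneousPoly 1 (fun φ : Module.Dual k V => φ v) :=
  ⟨Algebra.subset_adjoin ⟨v, rfl⟩, fun c φ => by simp⟩

theorem IsHomogeneousPoly.mul {m m' : ℕ} {f g : Module.Dual k V → k}
    (hf : IsHomogeneousPoly m f) (hg : IsHomogeneousPoly m' g) :
    IsHomogeneousPoly (m + m') (f * g) :=
  ⟨Subalgebra.mul_mem _ hf.1 hg.1, fun c φ => by
    rw [Pi.mul_apply, Pi.mul_apply, hf.2, hg.2, pow_add]
    ring⟩

theorem IsHomogeneousPoly.sub {m : ℕ} {f g : Module.Dual k V → k}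
    (hf : IsHomogeneousPoly m f) (hg : IsHomogeneousPoly m g) : IsHomogeneousPoly m (f - g) :=
  ⟨Subalgebra.sub_mem _ hf.1 hg.1, fun c φ => by
    rw [Pi.sub_apply, Pi.sub_apply, hf.2, hg.2, mul_sub]⟩

theorem isHomogeneousPoly_monomial {J : Type*} (s : Finset J) (v : J → V) (a : J → ℕ) :
    IsHomogeneousPoly (∑ j ∈ s, a j) (fun φ : Module.Dual k V => ∏ j ∈ s, φ (v j) ^ a j) := by
  refine ⟨?_, fun c φ => ?_⟩
  · have e : (fun φ : Module.Dual k V => ∏ j ∈ s, φ (v j) ^ a j) =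
        ∏ j ∈ s, (fun φ : Module.Dual k V => φ (v j)) ^ a j := by
      funext φ
      simp
    rw [e]
    exact Subalgebra.prod_mem _ fun j _ =>
      Subalgebra.pow_mem _ (isHomogeneousPoly_eval (v j)).1 _
  · simp only [LinearMap.smul_apply, smul_eq_mul, mul_pow, Finset.prod_mul_distrib,
      Finset.prod_pow_eq_pow_sum]

theorem IsHomogeneousPoly.isSection {m : ℕ} {f : Module.Dual k V → k}
    (hf : IsHomogeneousPoly m f) (X : Set (ℙ k (Module.Dual k V))) : IsSection X m f :=
  fun φ _ => ⟨0, f, 1, by simpa using hf, isHomogeneousPoly_one, one_ne_zero,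
    fun ψ _ _ => by simp⟩

theorem rep_mem_cone {X : Set (ℙ k (Module.Dual k V))} {x : ℙ k (Module.Dual k V)}
    (hx : x ∈ X) : x.rep ∈ cone X :=
  ⟨x.rep_nonzero, by rwa [Projectivization.mk_rep]⟩

theorem smul_mem_cone {X : Set (ℙ k (Module.Dual k V))} {φ : Module.Dual k V}
    (hφ : φ ∈ cone X) {c : k} (hc : c ≠ 0) : c • φ ∈ cone X := by
  obtain ⟨h, hX⟩ := hφ
  refine ⟨smul_ne_zero hc h, ?_⟩
  have : Projectivization.mk k (c • φ) (smul_ne_zero hc h) = Projectivization.mk k φ h :=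
    (Projectivization.mk_eq_mk_iff' k _ _ _ _).2 ⟨c, rfl⟩
  rwa [this]

theorem mk_mem_of_mem_cone {X : Set (ℙ k (Module.Dual k V))} {φ : Module.Dual k V}
    (hφ : φ ∈ cone X) (h : φ ≠ 0) : Projectivization.mk k φ h ∈ X := hφ.2

theorem exists_rep_mk_eq_smul {φ : Module.Dual k V} (h : φ ≠ 0) :
    ∃ c : k, c ≠ 0 ∧ (Projectivization.mk k φ h).rep = c • φ := by
  obtain ⟨a, ha⟩ := Projectivization.exists_smul_eq_mk_rep k φ h
  exact ⟨a, a.ne_zero, ha.symm⟩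

theorem IsSection.apply_smul {X : Set (ℙ k (Module.Dual k V))} {m : ℕ}
    {s : Module.Dual k V → k} (hs : IsSection X m s) {φ : Module.Dual k V} (hφ : φ ∈ cone X)
    {c : k} (hc : c ≠ 0) : s (c • φ) = c ^ m * s φ := by
  obtain ⟨e, f, g, hf, hg, hgφ, h⟩ := hs φ hφ
  have hgc : g (c • φ) ≠ 0 := by
    rw [hg.2]
    exact mul_ne_zero (pow_ne_zero _ hc) hgφ
  rw [h φ hφ hgφ, h _ (smul_mem_cone hφ hc) hgc, hf.2, hg.2, pow_add]
  field_simp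

theorem IsHomogeneousPoly.rep_mk_ne_zero {m : ℕ} {f : Module.Dual k V → k}
    (hf : IsHomogeneousPoly m f) {φ : Module.Dual k V} (h : φ ≠ 0) :
    f (Projectivization.mk k φ h).rep ≠ 0 ↔ f φ ≠ 0 := by
  obtain ⟨c, hc, e⟩ := exists_rep_mk_eq_smul h
  rw [e, hf.2]
  simp [hc]

/-- The non-vanishing loci of homogeneous polynomials form a basis of the Zariski topology. -/
theorem exists_basic_open {U : Set (ℙ k (Module.Dual k V))} (hU : IsOpen[zariskiProj k V] U)
    {y : ℙ k (Module.Dual k V)} (hy : y ∈ U) :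
    ∃ (m : ℕ) (f : Module.Dual k V → k), IsHomogeneousPoly m f ∧ f y.rep ≠ 0 ∧
      ∀ z : ℙ k (Module.Dual k V), f z.rep ≠ 0 → z ∈ U := by
  have hU' : TopologicalSpace.GenerateOpen _ U := hU
  induction hU' with
  | basic U h =>
    obtain ⟨m, f, hf, rfl⟩ := h
    exact ⟨m, f, hf, hy, fun z hz => hz⟩
  | univ => exact ⟨0, 1, isHomogeneousPoly_one, one_ne_zero, fun _ _ => trivial⟩
  | inter U U' h h' ih ih' =>
    obtain ⟨m, f, hf, hfy, hfU⟩ := ih h hy.1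
    obtain ⟨m', f', hf', hfy', hfU'⟩ := ih' h' hy.2
    exact ⟨_, _, hf.mul hf', mul_ne_zero hfy hfy', fun z hz =>
      ⟨hfU z (left_ne_zero_of_mul hz), hfU' z (right_ne_zero_of_mul hz)⟩⟩
  | sUnion 𝒰 h ih =>
    obtain ⟨U, hU𝒰, hyU⟩ := hy
    obtain ⟨m, f, hf, hfy, hfU⟩ := ih U hU𝒰 (h U hU𝒰) hyU
    exact ⟨m, f, hf, hfy, fun z hz => ⟨U, hU𝒰, hfU z hz⟩⟩

/-- A polynomial map from the affine line to `V*`. -/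
def IsPolyCurve (Ψ : k → Module.Dual k V) : Prop :=
  ∀ v, ∃ p : Polynomial k, ∀ c, Ψ c v = p.eval c

theorem IsPolyCurve.exists_polynomial {Ψ : k → Module.Dual k V} (hΨ : IsPolyCurve Ψ)
    {m : ℕ} {f : Module.Dual k V → k} (hf : IsHomogeneousPoly m f) :
    ∃ p : Polynomial k, ∀ c, f (Ψ c) = p.eval c := by
  obtain ⟨hf, -⟩ := hf
  induction hf using Algebra.adjoin_induction with
  | mem f hf =>
    obtain ⟨v, rfl⟩ := hf
    exact hΨ v
  | algebraMap r => exact ⟨Polynomial.C r, fun c => by simp⟩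
  | add f g _ _ hf hg =>
    obtain ⟨p, hp⟩ := hf
    obtain ⟨q, hq⟩ := hg
    exact ⟨p + q, fun c => by simp [hp, hq]⟩
  | mul f g _ _ hf hg =>
    obtain ⟨p, hp⟩ := hf
    obtain ⟨q, hq⟩ := hg
    exact ⟨p * q, fun c => by simp [hp, hq]⟩

variable [Infinite k]

theorem polynomial_eq_of_eval_eq {p q r : Polynomial k} (hr : r ≠ 0)
    (h : ∀ c, r.eval c ≠ 0 → p.eval c = q.eval c) : p = q := by
  have : r * (p - q) = 0 := by
    apply Polynomial.funext
    intro c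
    by_cases hc : r.eval c = 0
    · simp [hc]
    · simp [h c hc]
  exact sub_eq_zero.1 ((mul_eq_zero.1 this).resolve_left hr)

/-- A closed set contains the limits of its curves. -/
theorem IsPolyCurve.limit_mem_cone {Ψ : k → Module.Dual k V} (hΨ : IsPolyCurve Ψ)
    {C : Set (ℙ k (Module.Dual k V))} (hC : IsClosed[zariskiProj k V] C)
    (h : ∀ c, c ≠ 0 → Ψ c ∈ cone C) (h0 : Ψ 0 ≠ 0) : Ψ 0 ∈ cone C := by
  refine ⟨h0, ?_⟩
  by_contra hno
  obtain ⟨m, f, hf, hfy, hfU⟩ := exists_basic_open hC.isOpen_compl hno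
  obtain ⟨p, hp⟩ := hΨ.exists_polynomial hf
  rw [hf.rep_mk_ne_zero, hp] at hfy
  have hpX : p * Polynomial.X = 0 := by
    apply Polynomial.funext
    intro c
    by_cases hc : c = 0
    · simp [hc]
    · have hz : f (Ψ c) = 0 := by
        by_contra hne
        obtain ⟨hne0, hmem⟩ := h c hc
        exact hfU _ ((hf.rep_mk_ne_zero hne0).2 hne) hmem
      rw [hp] at hz
      simp [hz]
  rcases mul_eq_zero.1 hpX with h1 | h1
  · simp [h1] at hfy
  · exact Polynomial.X_ne_zero h1

/-- If a section has a pole of order `r > 0` along a curve (that is, `cʳ s` is constant on it)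
although the limit of the curve exists, then the constant is zero. -/
theorem IsPolyCurve.section_eq_zero {Ψ : k → Module.Dual k V} (hΨ : IsPolyCurve Ψ)
    {X : Set (ℙ k (Module.Dual k V))} {m : ℕ} {s : Module.Dual k V → k} (hs : IsSection X m s)
    (h : ∀ c, Ψ c ∈ cone X) {r : ℕ} (hr : 0 < r) {K : k}
    (hK : ∀ c, c ≠ 0 → c ^ r * s (Ψ c) = K) : K = 0 := by
  obtain ⟨e, f, g, hf, hg, hg0, hsfg⟩ := hs _ (h 0)
  obtain ⟨p, hp⟩ := hΨ.exists_polynomial hf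
  obtain ⟨q, hq⟩ := hΨ.exists_polynomial hg
  have hq0 : q ≠ 0 := by
    rintro rfl
    rw [hq] at hg0
    simp at hg0
  have key : Polynomial.C K * q = Polynomial.X ^ r * p := by
    refine polynomial_eq_of_eval_eq (mul_ne_zero hq0 Polynomial.X_ne_zero) fun c hc => ?_
    rw [Polynomial.eval_mul, Polynomial.eval_X] at hc
    have hqc := left_ne_zero_of_mul hc
    have h1 := hK c (right_ne_zero_of_mul hc)
    rw [hsfg _ (h c) (by rwa [hq]), hp, hq] at h1
    simp only [Polynomial.eval_mul, Polynomial.eval_C, Polynomial.eval_pow, Polynomial.eval_X]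
    rw [← h1]
    field_simp
  have := congrArg (Polynomial.eval 0) key
  simp only [Polynomial.eval_mul, Polynomial.eval_C, Polynomial.eval_pow, Polynomial.eval_X,
    zero_pow hr.ne', zero_mul] at this
  rw [hq] at hg0
  exact (mul_eq_zero.1 this).resolve_right hg0

end Projective

/-! ### Homomorphisms to the multiplicative group -/

section Divisible

variable {k : Type*} [Field k] [IsAlgClosed k]

theorem units_zpow_surjective (k : Type*) [Field k] [IsAlgClosed k] {m : ℤ} (hm : m ≠ 0) :
    Function.Surjective fun u : kˣ => u ^ m := by
  intro u
  obtain ⟨z, hz⟩ := IsAlgClosed.exists_pow_nat_eq (u : k) (Int.natAbs_pos.2 hm)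
  have hz0 : z ≠ 0 := by
    rintro rfl
    rw [zero_pow (Int.natAbs_ne_zero.2 hm)] at hz
    exact u.ne_zero hz.symm
  have h1 : (Units.mk0 z hz0) ^ m.natAbs = u := Units.ext (by simpa using hz)
  rcases Int.natAbs_eq m with e | e
  · refine ⟨Units.mk0 z hz0, ?_⟩
    dsimp only
    rw [e, zpow_natCast, h1]
  · refine ⟨(Units.mk0 z hz0)⁻¹, ?_⟩
    dsimp only
    rw [e, zpow_neg, zpow_natCast, inv_pow, inv_inv, h1]

/-- A function on a finite family of elements of an abelian group that respects the relations
between them extends to a homomorphism, because `kˣ` is divisible. -/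
theorem exists_hom_of_relations {A J : Type*} [AddCommGroup A] [Fintype J] (a : J → A)
    (c : J → kˣ) (h : ∀ m : J → ℤ, ∑ j, m j • a j = 0 → ∏ j, c j ^ m j = 1) :
    ∃ f : A →+ Additive kˣ, ∀ j, f (a j) = Additive.ofMul (c j) := by
  classical
  let : DivisibleBy (Additive kˣ) ℤ := divisibleByOfSMulRightSurj _ _ fun {m} hm u => by
    obtain ⟨v, hv⟩ := units_zpow_surjective k hm u.toMul
    exact ⟨Additive.ofMul v, congrArg Additive.ofMul hv⟩
  let p : (J → ℤ) →ₗ[ℤ] A := Fintype.linearCombination ℤ a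
  let q : (J → ℤ) →ₗ[ℤ] Additive kˣ := Fintype.linearCombination ℤ fun j => Additive.ofMul (c j)
  have hpq : LinearMap.ker p ≤ LinearMap.ker q := by
    intro m hm
    rw [LinearMap.mem_ker] at hm ⊢
    have h1 := h m (by simpa [p, Fintype.linearCombination_apply] using hm)
    have h2 := congrArg Additive.ofMul h1
    simpa [q, Fintype.linearCombination_apply] using h2
  let r : LinearMap.range p →ₗ[ℤ] Additive kˣ :=
    ((LinearMap.ker p).liftQ q hpq).comp p.quotKerEquivRange.symm.toLinearMap
  have hr : ∀ m, r ⟨p m, m, rfl⟩ = q m := by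
    intro m
    have : p.quotKerEquivRange.symm ⟨p m, m, rfl⟩ = (LinearMap.ker p).mkQ m := by
      rw [LinearEquiv.symm_apply_eq]
      rfl
    simp [r, this]
  obtain ⟨f, hf⟩ := (Module.Baer.of_divisible (Additive kˣ)).extension_property
    (LinearMap.range p).subtype (Submodule.injective_subtype _) r
  refine ⟨f.toAddMonoidHom, fun j => ?_⟩
  have h1 := LinearMap.congr_fun hf ⟨p (Pi.single j 1), Pi.single j 1, rfl⟩
  rw [hr] at h1
  simpa [p, q, Fintype.linearCombination_apply_single] using h1

end Divisible

/-! ### The action on the projective space -/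

section Action

variable {k : Type*} [Field k] {V : Type*} [AddCommGroup V] [Module k V] {H : Type*} [Group H]
  (σ : Representation k H V)

theorem dual_apply_apply (h : H) (φ : Module.Dual k V) (v : V) :
    σ.dual h φ v = φ (σ h⁻¹ v) := rfl

theorem act_mk (h : H) {φ : Module.Dual k V} (hφ : φ ≠ 0) :
    act σ h (Projectivization.mk k φ hφ) = Projectivization.mk k (σ.dual h φ)
      (fun h0 => hφ (dual_injective σ h (h0.trans (map_zero _).symm))) :=
  Projectivization.map_mk _ _ _ _

theorem act_mul (g h : H) (x : ℙ k (Module.Dual k V)) :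
    act σ (g * h) x = act σ g (act σ h x) := by
  induction x using Projectivization.ind with
  | h φ hφ =>
    simp only [act_mk, map_mul]
    rfl

theorem act_one (x : ℙ k (Module.Dual k V)) : act σ 1 x = x := by
  induction x using Projectivization.ind with
  | h φ hφ => simp only [act_mk, map_one, Module.End.one_apply]

theorem act_act_inv (h : H) (x : ℙ k (Module.Dual k V)) : act σ h (act σ h⁻¹ x) = x := by
  rw [← act_mul, mul_inv_cancel, act_one]

theorem exists_rep_act (h : H) (x : ℙ k (Module.Dual k V)) :
    ∃ c : k, c ≠ 0 ∧ (act σ h x).rep = c • σ.dual h x.rep := by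
  obtain ⟨c, hc, e⟩ := exists_rep_mk_eq_smul (k := k) (φ := σ.dual h x.rep)
    (fun h0 => x.rep_nonzero (dual_injective σ h (h0.trans (map_zero _).symm)))
  refine ⟨c, hc, ?_⟩
  rw [← e, ← act_mk σ h x.rep_nonzero, Projectivization.mk_rep]

theorem act_eq_iff (h : H) (x y : ℙ k (Module.Dual k V)) :
    act σ h x = y ↔ ∃ c : k, c ≠ 0 ∧ y.rep = c • σ.dual h x.rep := by
  constructor
  · rintro rfl
    exact exists_rep_act σ h x
  · rintro ⟨c, hc, e⟩
    have h1 : act σ h x = Projectivization.mk k (σ.dual h x.rep)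
        (fun h0 => x.rep_nonzero (dual_injective σ h (h0.trans (map_zero _).symm))) := by
      rw [← act_mk σ h x.rep_nonzero, Projectivization.mk_rep]
    rw [h1, ← y.mk_rep]
    exact (Projectivization.mk_eq_mk_iff' k _ _ _ _).2 ⟨c⁻¹, by
      rw [e, smul_smul, inv_mul_cancel₀ hc, one_smul]⟩

theorem dual_mem_cone {X : Set (ℙ k (Module.Dual k V))}
    (hX : ∀ h : H, ∀ x ∈ X, act σ h x ∈ X) {φ : Module.Dual k V} (hφ : φ ∈ cone X) (h : H) :
    σ.dual h φ ∈ cone X := by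
  obtain ⟨h0, hmem⟩ := hφ
  have := hX h _ hmem
  rw [act_mk] at this
  exact ⟨_, this⟩

/-- The semistable locus is invariant. -/
theorem act_mem_semistable {X : Set (ℙ k (Module.Dual k V))}
    (hX : ∀ h : H, ∀ x ∈ X, act σ h x ∈ X) (h : H) {x : ℙ k (Module.Dual k V)}
    (hx : x ∈ semistable σ X) : act σ h x ∈ semistable σ X := by
  obtain ⟨hxX, m, hm, s, hs, hsx⟩ := hx
  refine ⟨hX h x hxX, m, hm, s, hs, ?_⟩
  obtain ⟨c, hc, e⟩ := exists_rep_act σ h x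
  have hcone := dual_mem_cone σ hX (rep_mem_cone hxX) h
  rw [e, hs.1.apply_smul hcone hc, hs.2 h _ (rep_mem_cone hxX)]
  exact mul_ne_zero (pow_ne_zero _ hc) hsx

end Action

/-! ### Stability for tori -/

section TorusStability

variable {k : Type*} [Field k] {n : ℕ} {T : Subgroup (GL (Fin n) k)}
  {V : Type*} [AddCommGroup V] [Module k V] {σ : Representation k T V}

theorem dual_apply_weight {χ : M T} {v : V} (hv : v ∈ weightSpace σ χ) (t : T)
    (φ : Module.Dual k V) : σ.dual t φ v = (((χ.eval t)⁻¹ : kˣ) : k) * φ v := by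
  rw [dual_apply_apply, hv t⁻¹, eval_inv, map_smul, smul_eq_mul]

/-- The coordinates of a weight vector with respect to a basis of weight vectors are supported on
basis vectors of the same weight. -/
theorem weight_eq_of_repr_ne_zero {m : ℕ} {b : Module.Basis (Fin m) k V} {wt : Fin m → M T}
    (hb : ∀ i, b i ∈ weightSpace σ (wt i)) {χ : M T} {v : V} (hv : v ∈ weightSpace σ χ)
    {i : Fin m} (hi : b.repr v i ≠ 0) : wt i = χ := by
  apply eval_ext
  intro t
  have h1 := hv t
  conv_lhs at h1 => rw [← b.sum_repr v, map_sum]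
  have h2 := congrArg (fun w => b.repr w i) h1
  simp only [map_sum, map_smul, (hb _) t, Finsupp.finsetSum_apply, Finsupp.smul_apply,
    smul_eq_mul, Module.Basis.repr_self] at h2
  rw [Finset.sum_eq_single i] at h2
  · rw [Finsupp.single_eq_same, mul_one, mul_comm] at h2
    exact Units.ext (mul_right_cancel₀ hi h2)
  · intro j _ hj
    rw [Finsupp.single_eq_of_ne (Ne.symm hj)]
    simp
  · simp

variable [FiniteDimensional k V]

theorem mem_stateV {χ : M T} : χ ∈ stateV σ ↔ ∃ v ∈ weightSpace σ χ, v ≠ 0 := by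
  simp only [stateV, Set.Finite.mem_toFinset, Set.mem_ofPred_eq]
  exact Submodule.ne_bot_iff _

theorem mem_stateOf {x : ℙ k (Module.Dual k V)} {χ : M T} :
    χ ∈ stateOf σ x ↔ ∃ v ∈ weightSpace σ χ, x.rep v ≠ 0 := by
  simp only [stateOf, Finset.mem_filter, mem_stateV, and_iff_right_iff_imp]
  rintro ⟨v, hv, h⟩
  refine ⟨v, hv, ?_⟩
  rintro rfl
  exact h (map_zero _)

theorem stateOf_subset (x : ℙ k (Module.Dual k V)) : stateOf σ x ⊆ stateV σ := by
  classical
  exact Finset.filter_subset _ _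

theorem mem_stateOf_mk {φ : Module.Dual k V} (hφ : φ ≠ 0) {χ : M T} :
    χ ∈ stateOf σ (Projectivization.mk k φ hφ) ↔ ∃ v ∈ weightSpace σ χ, φ v ≠ 0 := by
  obtain ⟨c, hc, e⟩ := exists_rep_mk_eq_smul hφ
  rw [mem_stateOf, e]
  simp [hc]

/-- The state is constant on orbits of the torus. -/
theorem stateOf_act (t : T) (x : ℙ k (Module.Dual k V)) :
    stateOf σ (act σ t x) = stateOf σ x := by
  ext χ
  obtain ⟨c, hc, e⟩ := exists_rep_act σ t x
  rw [mem_stateOf, mem_stateOf, e]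
  refine exists_congr fun v => and_congr_right fun hv => ?_
  rw [LinearMap.smul_apply, dual_apply_weight hv]
  simp [hc]

theorem stateOf_nonempty [Infinite k] (hT : IsTorus T) (hσ : IsRationalRep σ)
    (x : ℙ k (Module.Dual k V)) : (stateOf σ x).Nonempty := by
  obtain ⟨m, b, wt, hb⟩ := exists_weightBasis hT σ hσ
  by_contra hno
  apply x.rep_nonzero
  refine b.ext fun i => ?_
  by_contra hi
  exact hno ⟨wt i, mem_stateOf.2 ⟨b i, hb i, hi⟩⟩

/-- The degeneration of `φ ∈ V*` along an integral one-parameter subgroup `g`: up to the scalar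
`cᵃ`, the action of the one-parameter subgroup is a polynomial curve, whose value at `0` is the part
of `φ` on the weights with `g = a`, where `a` is the minimum of `g` on the state of `φ`. -/
theorem exists_degeneration [Infinite k] (hT : IsTorus T) (hσ : IsRationalRep σ)
    (φ : Module.Dual k V) (g : M T →+ ℤ) (a : ℤ)
    (ha : ∀ χ, ∀ v ∈ weightSpace σ χ, φ v ≠ 0 → a ≤ g χ) :
    ∃ Ψ : k → Module.Dual k V, IsPolyCurve Ψ ∧
      (∀ c : kˣ, ∃ t : T, σ.dual t φ = ((c ^ a : kˣ) : k) • Ψ c) ∧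
      (∀ χ, ∀ v ∈ weightSpace σ χ, g χ = a → Ψ 0 v = φ v) ∧
      ∀ χ, ∀ v ∈ weightSpace σ χ, g χ ≠ a → Ψ 0 v = 0 := by
  obtain ⟨m, b, wt, hb⟩ := exists_weightBasis hT σ hσ
  let N : Fin m → ℕ := fun i => (g (wt i) - a).toNat
  let Ψ : k → Module.Dual k V := fun c => b.constr k fun i => c ^ N i * φ (b i)
  have hΨb : ∀ c i, Ψ c (b i) = c ^ N i * φ (b i) := fun c i => by
    simp only [Ψ]
    rw [Module.Basis.constr_basis]
  have hΨ : ∀ c v, Ψ c v = ∑ i, b.repr v i * (c ^ N i * φ (b i)) := by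
    intro c v
    conv_lhs => rw [← b.sum_repr v, map_sum]
    simp only [map_smul, smul_eq_mul, hΨb]
  have hφ : ∀ v, φ v = ∑ i, b.repr v i * φ (b i) := by
    intro v
    conv_lhs => rw [← b.sum_repr v, map_sum]
    simp only [map_smul, smul_eq_mul]
  refine ⟨Ψ, fun v => ⟨∑ i, Polynomial.C (b.repr v i * φ (b i)) * Polynomial.X ^ N i, fun c => ?_⟩,
    fun c => ?_, fun χ v hv hg => ?_, fun χ v hv hg => ?_⟩
  · rw [hΨ, Polynomial.eval_finsetSum]
    refine Finset.sum_congr rfl fun i _ => ?_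
    simp only [Polynomial.eval_mul, Polynomial.eval_C, Polynomial.eval_pow, Polynomial.eval_X]
    ring
  · let h : M T →+ Additive kˣ := ((zmultiplesHom (Additive kˣ)) (Additive.ofMul c)).comp g
    obtain ⟨t, ht⟩ := exists_eval_eq hT h
    have ht' : ∀ χ, χ.eval t = c ^ g χ := fun χ => by
      rw [ht]
      rfl
    refine ⟨t⁻¹, b.ext fun i => ?_⟩
    rw [dual_apply_weight (hb i), LinearMap.smul_apply, hΨb, eval_inv, inv_inv, ht', smul_eq_mul]
    by_cases hi : φ (b i) = 0
    · simp [hi]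
    · have h1 : ((N i : ℕ) : ℤ) = g (wt i) - a :=
        Int.toNat_of_nonneg (sub_nonneg.2 (ha _ _ (hb i) hi))
      have h2 : c ^ g (wt i) = c ^ a * c ^ N i := by
        rw [← zpow_natCast, h1, ← zpow_add]
        congr 1
        ring
      rw [h2]
      push_cast
      ring
  · rw [hΨ, hφ]
    refine Finset.sum_congr rfl fun i _ => ?_
    by_cases hi : b.repr v i = 0
    · simp [hi]
    · have : N i = 0 := by simp [N, weight_eq_of_repr_ne_zero hb hv hi, hg]
      rw [this, pow_zero, one_mul]
  · rw [hΨ]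
    refine Finset.sum_eq_zero fun i _ => ?_
    by_cases hi : b.repr v i = 0
    · simp [hi]
    by_cases hi' : φ (b i) = 0
    · simp [hi']
    have h1 := weight_eq_of_repr_ne_zero hb hv hi
    have h2 := ha _ _ (hb i) hi'
    have : N i ≠ 0 := by
      simp only [N]
      rw [h1] at h2 ⊢
      omega
    simp [this]

/-- If the weights of `x` satisfy a nontrivial relation with natural coefficients, then `x` is
semistable: the corresponding monomial in weight vectors is an invariant section. -/
theorem mem_semistable_of_relation {X : Set (ℙ k (Module.Dual k V))}
    {x : ℙ k (Module.Dual k V)} (hx : x ∈ X) {S : Finset (M T)} (hS : S ⊆ stateOf σ x)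
    {m : M T → ℕ} (hm : ∑ χ ∈ S, m χ • χ = 0) (hpos : 0 < ∑ χ ∈ S, m χ) :
    x ∈ semistable σ X := by
  have h1 : ∀ χ, ∃ v ∈ weightSpace σ χ, χ ∈ S → x.rep v ≠ 0 := by
    intro χ
    by_cases hχ : χ ∈ S
    · obtain ⟨v, hv, h⟩ := mem_stateOf.1 (hS hχ)
      exact ⟨v, hv, fun _ => h⟩
    · exact ⟨0, Submodule.zero_mem _, fun h => absurd h hχ⟩
  choose v hv hvx using h1
  refine ⟨hx, _, hpos, _, ⟨(isHomogeneousPoly_monomial S v m).isSection X, fun t φ _ => ?_⟩, ?_⟩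
  · have h2 : ∏ χ ∈ S, χ.eval t ^ m χ = 1 := by
      have := eval_sum S (fun χ => m χ • χ) t
      rw [hm, eval_zero] at this
      rw [this]
      refine Finset.prod_congr rfl fun χ _ => ?_
      rw [← natCast_zsmul, eval_zsmul, zpow_natCast]
    simp only [dual_apply_weight (hv _), mul_pow, Finset.prod_mul_distrib]
    have h3 : ∏ χ ∈ S, ((((χ.eval t)⁻¹ : kˣ) : k) ^ m χ) = 1 := by
      have h4 := congrArg (fun u : kˣ => ((u⁻¹ : kˣ) : k)) h2
      simpa using h4
    rw [h3, one_mul]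
  · exact Finset.prod_ne_zero_iff.2 fun χ hχ => pow_ne_zero _ (hvx χ hχ)

variable {X : Set (ℙ k (Module.Dual k V))}

theorem exists_mem_stateOf_of_weight {x : ℙ k (Module.Dual k V)} {χ : M T} {v : V}
    (hv : v ∈ weightSpace σ χ) (h : x.rep v ≠ 0) : χ ∈ stateOf σ x :=
  mem_stateOf.2 ⟨v, hv, h⟩

/-- The numerical criterion for semistability: an integral one-parameter subgroup that is
positive on the state of `x` contracts the cone over the orbit to the origin. -/
theorem zeroMemConv_of_mem_semistable [Infinite k] (hT : IsTorus T) (hσ : IsRationalRep σ)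
    (hX : IsClosed[zariskiProj k V] X) (hXT : ∀ t : T, ∀ x ∈ X, act σ t x ∈ X)
    {x : ℙ k (Module.Dual k V)} (hx : x ∈ semistable σ X) : ZeroMemConv (stateOf σ x) := by
  have := charLattice_free hT
  have := charLattice_finite hT
  by_contra hno
  obtain ⟨g, hg⟩ := exists_int_functional_pos hno
  obtain ⟨χ₀, hχ₀, hmin⟩ :=
    Finset.exists_min_image (stateOf σ x) g (stateOf_nonempty hT hσ x)
  obtain ⟨hxX, m, hm, s, hs, hsx⟩ := hx
  obtain ⟨Ψ, hΨ, hΨt, hΨ0, -⟩ := exists_degeneration hT hσ x.rep g (g χ₀)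
    fun χ v hv h => hmin χ (exists_mem_stateOf_of_weight hv h)
  obtain ⟨v₀, hv₀, hne₀⟩ := mem_stateOf.1 hχ₀
  have h0 : Ψ 0 ≠ 0 := by
    intro h0
    apply hne₀
    rw [← hΨ0 χ₀ v₀ hv₀ rfl, h0, LinearMap.zero_apply]
  have hcone : ∀ c, c ≠ 0 → Ψ c ∈ cone X := by
    intro c hc
    obtain ⟨t, ht⟩ := hΨt (Units.mk0 c hc)
    have h1 := dual_mem_cone σ hXT (rep_mem_cone hxX) t
    rw [ht] at h1
    have h2 := smul_mem_cone h1 (Units.ne_zero ((Units.mk0 c hc ^ g χ₀)⁻¹))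
    rwa [smul_smul, ← Units.val_mul, inv_mul_cancel, Units.val_one, one_smul] at h2
  have hcone' : ∀ c, Ψ c ∈ cone X := by
    intro c
    by_cases hc : c = 0
    · rw [hc]
      exact hΨ.limit_mem_cone hX hcone h0
    · exact hcone c hc
  have hpos := hg χ₀ hχ₀
  refine hsx (hΨ.section_eq_zero hs.1 hcone' (r := (g χ₀).toNat * m)
    (Nat.mul_pos (by omega) hm) fun c hc => ?_)
  obtain ⟨t, ht⟩ := hΨt (Units.mk0 c hc)
  have h1 := hs.2 t _ (rep_mem_cone hxX)
  rw [ht, Units.val_mk0, hs.1.apply_smul (hcone' c) (Units.ne_zero _)] at h1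
  rw [← h1]
  congr 1
  have h2 : Units.mk0 c hc ^ g χ₀ = Units.mk0 c hc ^ (g χ₀).toNat := by
    rw [← zpow_natCast, Int.toNat_of_nonneg hpos.le]
  rw [h2, pow_mul]
  simp

/-- If the orbit of a semistable point is closed in the semistable locus, then the origin is in
the relative interior of the convex hull of the state: otherwise the limit along a suitable
one-parameter subgroup is a semistable point with a smaller state. -/
theorem zeroMemRelint_of_isClosedIn_orbit [Infinite k] (hT : IsTorus T) (hσ : IsRationalRep σ)
    (hX : IsClosed[zariskiProj k V] X) (hXT : ∀ t : T, ∀ x ∈ X, act σ t x ∈ X)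
    {x : ℙ k (Module.Dual k V)} (hx : x ∈ semistable σ X)
    (hcl : IsClosedIn (orbit σ x) (semistable σ X)) : ZeroMemRelint (stateOf σ x) := by
  classical
  have := charLattice_free hT
  have := charLattice_finite hT
  by_contra hno
  obtain ⟨g, hg, χ₀, hχ₀, hpos⟩ :=
    exists_int_functional_nonneg (stateOf_nonempty hT hσ x) hno
  obtain ⟨m, hm, hmpos⟩ :=
    (zeroMemConv_of_mem_semistable hT hσ hX hXT hx).exists_nat_relation
  -- the relation is supported on the weights killed by `g`
  have hm0 : ∀ χ ∈ stateOf σ x, g χ ≠ 0 → m χ = 0 := by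
    intro χ hχ hne
    have h1 := congrArg g hm
    rw [map_sum, map_zero, Finset.sum_eq_zero_iff_of_nonneg] at h1
    · have := h1 χ hχ
      rw [map_nsmul, smul_eq_zero] at this
      exact this.resolve_right hne
    · intro ψ hψ
      rw [map_nsmul]
      exact nsmul_nonneg (hg ψ hψ) _
  let S' := (stateOf σ x).filter fun χ => g χ = 0
  have hmS : ∑ χ ∈ S', m χ • χ = 0 := by
    rw [← hm]
    refine Finset.sum_subset (Finset.filter_subset _ _) fun χ hχ hn => ?_
    rw [hm0 χ hχ fun h => hn (Finset.mem_filter.2 ⟨hχ, h⟩), zero_smul]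
  have hmS' : 0 < ∑ χ ∈ S', m χ := by
    rwa [Finset.sum_subset (Finset.filter_subset _ _) fun χ hχ hn =>
      hm0 χ hχ fun h => hn (Finset.mem_filter.2 ⟨hχ, h⟩)]
  obtain ⟨Ψ, hΨ, hΨt, hΨ0, hΨ0'⟩ := exists_degeneration hT hσ x.rep g 0
    fun χ v hv h => hg χ (exists_mem_stateOf_of_weight hv h)
  have h0 : Ψ 0 ≠ 0 := by
    intro h0
    obtain ⟨χ, hχ, -⟩ := Finset.exists_ne_zero_of_sum_ne_zero hmS'.ne'
    obtain ⟨hχ1, hχ2⟩ := Finset.mem_filter.1 hχ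
    obtain ⟨v, hv, hne⟩ := mem_stateOf.1 hχ1
    apply hne
    rw [← hΨ0 χ v hv hχ2, h0, LinearMap.zero_apply]
  have hΨact : ∀ c, c ≠ 0 → ∃ (t : T) (h : Ψ c ≠ 0), Projectivization.mk k (Ψ c) h = act σ t x := by
    intro c hc
    obtain ⟨t, ht⟩ := hΨt (Units.mk0 c hc)
    rw [zpow_zero, Units.val_one, one_smul] at ht
    have hne : Ψ c ≠ 0 := by
      have : Ψ c = σ.dual t x.rep := ht.symm
      rw [this]
      exact fun h0 => x.rep_nonzero (dual_injective σ t (h0.trans (map_zero _).symm))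
    refine ⟨t, hne, ?_⟩
    conv_rhs => rw [← x.mk_rep, act_mk]
    congr 1
    exact ht.symm
  obtain ⟨C, hC, hCeq⟩ := hcl
  have hy : ∀ C : Set (ℙ k (Module.Dual k V)), IsClosed[zariskiProj k V] C → orbit σ x ⊆ C →
      Projectivization.mk k (Ψ 0) h0 ∈ C := by
    intro C hC hsub
    refine mk_mem_of_mem_cone (hΨ.limit_mem_cone hC (fun c hc => ?_) h0) h0
    obtain ⟨t, hne, e⟩ := hΨact c hc
    refine ⟨hne, ?_⟩
    rw [e]
    exact hsub ⟨t, rfl⟩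
  have hyX := hy X hX (by
    rintro _ ⟨t, rfl⟩
    exact hXT t x hx.1)
  have hyC := hy C hC (by
    rw [hCeq]
    exact Set.inter_subset_left)
  have hyss : Projectivization.mk k (Ψ 0) h0 ∈ semistable σ X := by
    refine mem_semistable_of_relation hyX (S := S') (fun χ hχ => ?_) hmS hmS'
    obtain ⟨hχ1, hχ2⟩ := Finset.mem_filter.1 hχ
    obtain ⟨v, hv, hne⟩ := mem_stateOf.1 hχ1
    exact (mem_stateOf_mk h0).2 ⟨v, hv, by rwa [hΨ0 χ v hv hχ2]⟩
  have hyo : Projectivization.mk k (Ψ 0) h0 ∈ orbit σ x := by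
    rw [hCeq]
    exact ⟨hyC, hyss⟩
  obtain ⟨t, ht⟩ := hyo
  have ht' : act σ t x = Projectivization.mk k (Ψ 0) h0 := ht
  have h1 : χ₀ ∈ stateOf σ (Projectivization.mk k (Ψ 0) h0) := by
    rw [← ht', stateOf_act]
    exact hχ₀
  obtain ⟨v, hv, hne⟩ := (mem_stateOf_mk h0).1 h1
  exact hne (hΨ0' χ₀ v hv hpos.ne')

end TorusStability

/-! ### Closed orbits and stabilizers -/

section ClosedOrbits

variable {k : Type*} [Field k] {n : ℕ} {T : Subgroup (GL (Fin n) k)}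
  {V : Type*} [AddCommGroup V] [Module k V]

/-- The closure of the orbit of `x`, cut out by the homogeneous polynomials that vanish on it. -/
def orbitClosure (σ : Representation k T V) (x : ℙ k (Module.Dual k V)) :
    Set (ℙ k (Module.Dual k V)) :=
  {y | ∀ (m : ℕ) (f : Module.Dual k V → k), IsHomogeneousPoly m f →
    (∀ t, f (σ.dual t x.rep) = 0) → f y.rep = 0}

theorem isClosed_orbitClosure (σ : Representation k T V) (x : ℙ k (Module.Dual k V)) :
    IsClosed[zariskiProj k V] (orbitClosure σ x) := by
  let := zariskiProj k V
  rw [← isOpen_compl_iff]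
  have e : (orbitClosure σ x)ᶜ = ⋃₀ {U | ∃ (m : ℕ) (f : Module.Dual k V → k),
      IsHomogeneousPoly m f ∧ (∀ t, f (σ.dual t x.rep) = 0) ∧ U = {y | f y.rep ≠ 0}} := by
    ext y
    constructor
    · intro hy
      have hy' : ¬ ∀ (m : ℕ) (f : Module.Dual k V → k), IsHomogeneousPoly m f →
        (∀ t, f (σ.dual t x.rep) = 0) → f y.rep = 0 := hy
      push Not at hy'
      obtain ⟨m, f, hf, h0, hne⟩ := hy'
      exact ⟨_, ⟨m, f, hf, h0, rfl⟩, hne⟩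
    · rintro ⟨_, ⟨m, f, hf, h0, rfl⟩, hne⟩ hy
      exact hne (hy m f hf h0)
  rw [e]
  refine isOpen_sUnion ?_
  rintro _ ⟨m, f, hf, -, rfl⟩
  exact TopologicalSpace.isOpen_generateFrom_of_mem ⟨m, f, hf, rfl⟩

theorem orbit_subset_orbitClosure (σ : Representation k T V) (x : ℙ k (Module.Dual k V)) :
    orbit σ x ⊆ orbitClosure σ x := by
  rintro _ ⟨t, rfl⟩ m f hf h0
  obtain ⟨c, hc, e⟩ := exists_rep_act σ t x
  change f (act σ t x).rep = 0
  rw [e, hf.2, h0, mul_zero]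

variable [IsAlgClosed k] [FiniteDimensional k V] {σ : Representation k T V}
  {X : Set (ℙ k (Module.Dual k V))}

/-- A semistable point `y` of the closure of the orbit of `x`, where the origin is in the relative
interior of the hull of the state of `x`, lies in the orbit. The coordinates of `y` satisfy the
binomial equations that come from the relations between the weights of `x`. Comparing a positive
relation on the state of `x` with a nontrivial relation on the state of `y` shows that all the
coordinates are nonzero; then they are the values of a homomorphism, that is, of a point of `T`. -/
theorem mem_orbit_of_mem_orbitClosure (hT : IsTorus T) (hσ : IsRationalRep σ)
    {x y : ℙ k (Module.Dual k V)} (hx : ZeroMemRelint (stateOf σ x))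
    (hy : ZeroMemConv (stateOf σ y)) (hyx : y ∈ orbitClosure σ x) : y ∈ orbit σ x := by
  classical
  have := charLattice_free hT
  have := charLattice_finite hT
  set S := stateOf σ x with hS
  have hsv : ∀ χ, ∃ v ∈ weightSpace σ χ, χ ∈ S → x.rep v = 1 := by
    intro χ
    by_cases hχ : χ ∈ S
    · obtain ⟨v, hv, h⟩ := mem_stateOf.1 hχ
      exact ⟨(x.rep v)⁻¹ • v, Submodule.smul_mem _ _ hv, fun _ => by simp [h]⟩
    · exact ⟨0, Submodule.zero_mem _, fun h => absurd h hχ⟩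
  choose sv hsv hsv1 using hsv
  -- linear equations of the orbit
  have hlin : ∀ χ ∈ S, ∀ v ∈ weightSpace σ χ, y.rep v = x.rep v * y.rep (sv χ) := by
    intro χ hχ v hv
    have h1 := hyx 1 _ (isHomogeneousPoly_eval (v - x.rep v • sv χ)) fun t => by
      rw [dual_apply_weight (Submodule.sub_mem _ hv (Submodule.smul_mem _ _ (hsv χ))), map_sub,
        map_smul, hsv1 χ hχ]
      simp
    rw [map_sub, map_smul, smul_eq_mul, sub_eq_zero] at h1
    exact h1
  have hlin0 : ∀ χ ∉ S, ∀ v ∈ weightSpace σ χ, x.rep v = 0 := by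
    intro χ hχ v hv
    by_contra hne
    exact hχ (exists_mem_stateOf_of_weight hv hne)
  have hlin0' : ∀ χ ∉ S, ∀ v ∈ weightSpace σ χ, y.rep v = 0 := by
    intro χ hχ v hv
    refine hyx 1 _ (isHomogeneousPoly_eval v) fun t => ?_
    rw [dual_apply_weight hv, hlin0 χ hχ v hv, mul_zero]
  have hsub : stateOf σ y ⊆ S := by
    intro χ hχ
    by_contra hno
    obtain ⟨v, hv, hne⟩ := mem_stateOf.1 hχ
    exact hne (hlin0' χ hno v hv)
  -- binomial equations of the orbit
  have hbin : ∀ a b : M T → ℕ, ∑ χ ∈ S, a χ • χ = ∑ χ ∈ S, b χ • χ →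
      ∑ χ ∈ S, a χ = ∑ χ ∈ S, b χ →
      ∏ χ ∈ S, y.rep (sv χ) ^ a χ = ∏ χ ∈ S, y.rep (sv χ) ^ b χ := by
    intro a b hab hdeg
    have hb := isHomogeneousPoly_monomial (k := k) S sv b
    rw [← hdeg] at hb
    have h1 := hyx _ _ ((isHomogeneousPoly_monomial S sv a).sub hb) fun t => by
      have h2 : ∀ a : M T → ℕ, ∏ χ ∈ S, σ.dual t x.rep (sv χ) ^ a χ =
          (((∑ χ ∈ S, a χ • χ).eval t⁻¹ : kˣ) : k) := by
        intro a
        rw [eval_sum, Units.coe_prod]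
        refine Finset.prod_congr rfl fun χ hχ => ?_
        rw [dual_apply_weight (hsv χ), hsv1 χ hχ, mul_one, ← natCast_zsmul, eval_zsmul,
          zpow_natCast, eval_inv, Units.val_pow_eq_pow_val]
      rw [Pi.sub_apply, h2, h2, hab, sub_self]
    exact sub_eq_zero.1 h1
  have hc0 : ∀ χ ∈ S, y.rep (sv χ) ≠ 0 := by
    obtain ⟨p, hp, hpos⟩ := hx.exists_nat_relation
    obtain ⟨q, hq, hqpos⟩ := hy.exists_nat_relation
    let q' : M T → ℕ := fun χ => if χ ∈ stateOf σ y then q χ else 0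
    have hq' : ∑ χ ∈ S, q' χ • χ = 0 := by
      rw [← hq]
      symm
      refine (Finset.sum_congr rfl fun χ hχ => ?_).trans
        (Finset.sum_subset hsub fun χ _ hn => ?_)
      · simp [q', hχ]
      · simp [q', hn]
    have hq'' : ∑ χ ∈ S, q' χ = ∑ χ ∈ stateOf σ y, q χ := by
      symm
      refine (Finset.sum_congr rfl fun χ hχ => ?_).trans
        (Finset.sum_subset hsub fun χ _ hn => ?_)
      · simp [q', hχ]
      · simp [q', hn]
    have h1 := hbin (fun χ => (∑ ψ ∈ S, q' ψ) * p χ) (fun χ => (∑ ψ ∈ S, p ψ) * q' χ)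
      (by simp only [mul_smul, ← Finset.smul_sum, hp, hq', smul_zero])
      (by rw [← Finset.mul_sum, ← Finset.mul_sum, mul_comm])
    have h2 : ∏ χ ∈ S, y.rep (sv χ) ^ ((∑ ψ ∈ S, p ψ) * q' χ) ≠ 0 := by
      refine Finset.prod_ne_zero_iff.2 fun χ hχ => ?_
      by_cases hχy : χ ∈ stateOf σ y
      · obtain ⟨v, hv, hne⟩ := mem_stateOf.1 hχy
        rw [hlin χ hχ v hv] at hne
        exact pow_ne_zero _ (right_ne_zero_of_mul hne)
      · simp [q', hχy]
    rw [← h1] at h2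
    intro χ hχ h0
    have h3 := Finset.prod_ne_zero_iff.1 h2 χ hχ
    rw [h0, hq''] at h3
    exact h3 (zero_pow (Nat.mul_pos hqpos (hpos χ hχ)).ne')
  let c : S → kˣ := fun χ => Units.mk0 _ (hc0 χ χ.2)
  obtain ⟨f, hf⟩ := exists_hom_of_relations (A := M T × ℤ) (fun χ : S => ((χ : M T), (1 : ℤ))) c
    (by
      intro m hm
      have hm1 : ∑ χ, m χ • (χ : M T) = 0 := by
        have := congrArg Prod.fst hm
        simpa [Prod.fst_sum] using this
      have hm2 : ∑ χ, m χ = 0 := by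
        have := congrArg Prod.snd hm
        simpa [Prod.snd_sum] using this
      let m' : M T → ℤ := fun χ => if hχ : χ ∈ S then m ⟨χ, hχ⟩ else 0
      have hm' : ∀ χ : S, m' χ = m χ := fun χ => by simp [m']
      have hsplit : ∀ z : ℤ, ((z.toNat : ℤ)) = z + ((-z).toNat : ℤ) := fun z => by omega
      have h1 := hbin (fun χ => (m' χ).toNat) (fun χ => (-m' χ).toNat)
        (by
          rw [← sub_eq_zero, ← Finset.sum_sub_distrib, ← hm1, ← Finset.sum_coe_sort S]
          refine Finset.sum_congr rfl fun χ _ => ?_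
          rw [← natCast_zsmul, ← natCast_zsmul, ← sub_smul, hsplit, add_sub_cancel_right, hm'])
        (by
          zify
          rw [← sub_eq_zero, ← Finset.sum_sub_distrib, ← hm2, ← Finset.sum_coe_sort S]
          refine Finset.sum_congr rfl fun χ _ => ?_
          rw [← hm' χ]
          have := hsplit (m' χ)
          omega)
      have h2 : ∏ χ, c χ ^ (m χ).toNat = ∏ χ, c χ ^ (-m χ).toNat := by
        apply Units.ext
        rw [Units.coe_prod, Units.coe_prod]
        rw [← Finset.prod_coe_sort S, ← Finset.prod_coe_sort S] at h1
        simpa [hm', c] using h1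
      have h3 : ∀ χ, c χ ^ m χ = c χ ^ (m χ).toNat / c χ ^ (-m χ).toNat := by
        intro χ
        rw [div_eq_mul_inv, ← zpow_natCast, ← zpow_natCast, ← zpow_neg, ← zpow_add]
        congr 1
        have := hsplit (m χ)
        omega
      rw [Finset.prod_congr rfl fun χ _ => h3 χ, Finset.prod_div_distrib, h2, div_self'])
  obtain ⟨t, ht⟩ := exists_eval_eq hT (f.comp (AddMonoidHom.inl (M T) ℤ))
  let u : kˣ := (f (0, 1)).toMul
  have hcu : ∀ χ (hχ : χ ∈ S), y.rep (sv χ) = (χ.eval t : k) * u := by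
    intro χ hχ
    have h1 := hf ⟨χ, hχ⟩
    have h2 : f (χ, 1) = f (χ, 0) + f (0, 1) := by
      rw [← map_add, Prod.mk_add_mk, add_zero, zero_add]
    rw [h2] at h1
    have h3 := congrArg (fun z : Additive kˣ => ((z.toMul : kˣ) : k)) h1
    have h4 : χ.eval t = (f (χ, 0)).toMul := ht χ
    rw [h4]
    exact h3.symm
  obtain ⟨N, b, wt, hb⟩ := exists_weightBasis hT σ hσ
  refine ⟨t⁻¹, (act_eq_iff σ _ _ _).2 ⟨u, u.ne_zero, b.ext fun i => ?_⟩⟩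
  rw [LinearMap.smul_apply, dual_apply_weight (hb i), eval_inv, inv_inv, smul_eq_mul]
  by_cases hi : wt i ∈ S
  · rw [hlin _ hi _ (hb i), hcu _ hi]
    ring
  · rw [hlin0 _ hi _ (hb i), hlin0' _ hi _ (hb i)]
    ring

/-- The converse of the numerical criterion for semistability. -/
theorem mem_semistable_of_zeroMemConv (hT : IsTorus T) {x : ℙ k (Module.Dual k V)} (hx : x ∈ X)
    (h : ZeroMemConv (stateOf σ x)) : x ∈ semistable σ X := by
  have := charLattice_free hT
  have := charLattice_finite hT
  obtain ⟨m, hm, hpos⟩ := h.exists_nat_relation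
  exact mem_semistable_of_relation hx subset_rfl hm hpos

/-- If the origin is in the relative interior of the hull of the state, the orbit is closed in the
semistable locus. -/
theorem isClosedIn_orbit (hT : IsTorus T) (hσ : IsRationalRep σ)
    (hX : IsClosed[zariskiProj k V] X) (hXT : ∀ t : T, ∀ x ∈ X, act σ t x ∈ X)
    {x : ℙ k (Module.Dual k V)} (hx : x ∈ X) (h : ZeroMemRelint (stateOf σ x)) :
    IsClosedIn (orbit σ x) (semistable σ X) := by
  refine ⟨orbitClosure σ x, isClosed_orbitClosure σ x, ?_⟩
  ext y
  constructor
  · intro hy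
    refine ⟨orbit_subset_orbitClosure σ x hy, ?_⟩
    obtain ⟨t, rfl⟩ := hy
    exact act_mem_semistable σ hXT t (mem_semistable_of_zeroMemConv hT hx h.zeroMemConv)
  · rintro ⟨hy, hyss⟩
    exact mem_orbit_of_mem_orbitClosure hT hσ h
      (zeroMemConv_of_mem_semistable hT hσ hX hXT hyss) hy

/-- If the state lies in a proper subspace, then the one-parameter subgroups that kill it
stabilize the point. -/
theorem stab_infinite (hT : IsTorus T) (hσ : IsRationalRep σ) {x : ℙ k (Module.Dual k V)}
    {A : Submodule ℝ (MR T)} (hA : A ≠ ⊤) (h : realize (stateOf σ x) ⊆ A) :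
    (stab σ x).Infinite := by
  have := charLattice_free hT
  have := charLattice_finite hT
  obtain ⟨g, hg, hg0⟩ := exists_int_functional_vanishing hA h
  obtain ⟨χ, hχ⟩ : ∃ χ, g χ ≠ 0 := by
    by_contra! h0
    exact hg (AddMonoidHom.ext h0)
  obtain ⟨N, b, wt, hb⟩ := exists_weightBasis hT σ hσ
  intro hfin
  have himg : (Set.univ : Set kˣ) ⊆ (fun t : T => χ.eval t) '' stab σ x := by
    intro u _
    obtain ⟨c, hc⟩ := units_zpow_surjective k hχ u
    obtain ⟨t, ht⟩ := exists_eval_eq hT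
      (((zmultiplesHom (Additive kˣ)) (Additive.ofMul c)).comp g)
    have ht' : ∀ ψ, ψ.eval t = c ^ g ψ := fun ψ => by
      rw [ht]
      rfl
    refine ⟨t, (act_eq_iff σ _ _ _).2 ⟨1, one_ne_zero, b.ext fun i => ?_⟩, ?_⟩
    · rw [one_smul, dual_apply_weight (hb i), ht']
      by_cases hi : x.rep (b i) = 0
      · simp [hi]
      · simp [hg0 _ (exists_mem_stateOf_of_weight (hb i) hi)]
    · exact (ht' χ).trans hc
  have hinf : Infinite kˣ := by
    by_contra hno
    rw [not_infinite_iff_finite] at hno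
    have : (Set.univ : Set k).Finite := by
      refine ((Set.finite_range (Units.val : kˣ → k)).union (Set.finite_singleton 0)).subset
        fun z _ => ?_
      by_cases hz : z = 0
      · exact Or.inr hz
      · exact Or.inl ⟨Units.mk0 z hz, rfl⟩
    exact Set.infinite_univ this
  exact Set.infinite_univ ((hfin.image _).subset himg)

/-- If the state spans `M_ℝ` and its convex hull contains the origin, then all the characters of the
stabilizer are torsion of bounded order. -/
theorem stab_finite (hT : IsTorus T) {x : ℙ k (Module.Dual k V)}
    (h : ZeroMemConv (stateOf σ x)) (hspan : spanR (stateOf σ x) = ⊤) : (stab σ x).Finite := by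
  classical
  have := charLattice_free hT
  have := charLattice_finite hT
  obtain ⟨m, hm, hpos⟩ := h.exists_nat_relation
  set D := ∑ χ ∈ stateOf σ x, m χ with hD
  have h1 : ∀ t ∈ stab σ x, ∀ χ ∈ stateOf σ x, χ.eval t ^ D = 1 := by
    intro t ht
    obtain ⟨c, hc, e⟩ := (act_eq_iff σ t x x).1 ht
    have h2 : ∀ χ ∈ stateOf σ x, χ.eval t = Units.mk0 c hc := by
      intro χ hχ
      obtain ⟨v, hv, hne⟩ := mem_stateOf.1 hχ
      have h3 := LinearMap.congr_fun e v
      rw [LinearMap.smul_apply, dual_apply_weight hv, smul_eq_mul, ← mul_assoc] at h3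
      have h4 : c * (((χ.eval t)⁻¹ : kˣ) : k) = 1 := by
        apply mul_right_cancel₀ hne
        rw [← h3, one_mul]
      have h5 : Units.mk0 c hc * (χ.eval t)⁻¹ = 1 := Units.ext h4
      exact (mul_inv_eq_one.1 h5).symm
    have h3 : Units.mk0 c hc ^ D = 1 := by
      have h4 := eval_sum (stateOf σ x) (fun χ => m χ • χ) t
      rw [hm, eval_zero] at h4
      rw [h4, hD, ← Finset.prod_pow_eq_pow_sum]
      refine Finset.prod_congr rfl fun χ hχ => ?_
      rw [← natCast_zsmul, eval_zsmul, zpow_natCast, h2 χ hχ]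
    intro χ hχ
    rw [h2 χ hχ, h3]
  obtain ⟨b⟩ : Nonempty (Module.Basis (Fin (Module.finrank ℤ (M T))) ℤ (M T)) :=
    ⟨Module.finBasis ℤ (M T)⟩
  choose N c hN hNc using fun i => exists_zsmul_eq_sum hspan (b i)
  let E : ℕ := (∏ i, (N i).natAbs) * D
  have hE : 0 < E :=
    Nat.mul_pos (Finset.prod_pos fun i _ => Int.natAbs_pos.2 (hN i)) hpos
  refine (finite_torsion hT E hE).subset fun t ht => ?_
  have h2 : ∀ i, (b i).eval t ^ E = 1 := by
    intro i
    have h3 : ((b i).eval t ^ N i) ^ D = 1 := by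
      rw [← eval_zsmul, hNc i, eval_sum, ← Finset.prod_pow]
      refine Finset.prod_eq_one fun ψ _ => ?_
      rw [eval_zsmul, ← zpow_natCast, zpow_comm, zpow_natCast, h1 t ht ψ ψ.2, one_zpow]
    obtain ⟨e, he⟩ : N i ∣ ((∏ i, (N i).natAbs : ℕ) : ℤ) :=
      Int.dvd_natCast.2 (Finset.dvd_prod_of_mem (fun i => (N i).natAbs) (Finset.mem_univ i))
    simp only [E]
    rw [pow_mul, ← zpow_natCast ((b i).eval t), he, zpow_mul, ← zpow_natCast, zpow_comm,
      zpow_natCast, h3, one_zpow]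
  intro χ
  have h3 : χ = ∑ i, b.repr χ i • b i := (b.sum_repr χ).symm
  rw [h3, eval_sum, ← Finset.prod_pow]
  refine Finset.prod_eq_one fun i _ => ?_
  rw [eval_zsmul, ← zpow_natCast, zpow_comm, zpow_natCast, h2 i, one_zpow]

/-- The criterion for strict polystability under a torus. -/
theorem mem_strictlyPolystable_iff (hT : IsTorus T) (hσ : IsRationalRep σ)
    (hX : IsClosed[zariskiProj k V] X) (hXT : ∀ t : T, ∀ x ∈ X, act σ t x ∈ X)
    {x : ℙ k (Module.Dual k V)} (hx : x ∈ X) :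
    x ∈ strictlyPolystable σ X ↔
      (∃ A : Submodule ℝ (MR T), A ≠ ⊤ ∧ realize (stateOf σ x) ⊆ A) ∧
        ZeroMemRelint (stateOf σ x) := by
  constructor
  · rintro ⟨⟨hss, -⟩, hinf, hcl⟩
    refine ⟨⟨spanR (stateOf σ x), fun htop => hinf (stab_finite hT ?_ htop),
      Submodule.subset_span⟩, ?_⟩
    · exact zeroMemConv_of_mem_semistable hT hσ hX hXT hss
    · exact zeroMemRelint_of_isClosedIn_orbit hT hσ hX hXT hss hcl
  · rintro ⟨⟨A, hA, hsub⟩, h⟩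
    have hinf := stab_infinite hT hσ hA hsub
    refine ⟨⟨mem_semistable_of_zeroMemConv hT hx h.zeroMemConv, ?_⟩, hinf,
      isClosedIn_orbit hT hσ hX hXT hx h⟩
    rintro ⟨-, m, hm, s, hs, hsx, hfin, -⟩
    exact hinf hfin

end ClosedOrbits

/-! ### The Weyl group -/

section Weyl

variable {k : Type*} [Field k] {n : ℕ} {G T : Subgroup (GL (Fin n) k)}

theorem regularGL_entry (i j : Fin n) :
    (fun h : GL (Fin n) k => (h : Matrix (Fin n) (Fin n) k) i j) ∈ regularGL k n :=
  Algebra.subset_adjoin (Or.inl ⟨i, j, rfl⟩)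

theorem regularGL_conj (g : GL (Fin n) k) {F : GL (Fin n) k → k} (hF : F ∈ regularGL k n) :
    (fun h => F (g⁻¹ * h * g)) ∈ regularGL k n := by
  have key : ∀ i j, (fun h : GL (Fin n) k =>
      ((g⁻¹ * h * g : GL (Fin n) k) : Matrix (Fin n) (Fin n) k) i j) ∈ regularGL k n := by
    intro i j
    have e : (fun h : GL (Fin n) k =>
        ((g⁻¹ * h * g : GL (Fin n) k) : Matrix (Fin n) (Fin n) k) i j) =
        ∑ l, ∑ m, (((g⁻¹ : GL (Fin n) k) : Matrix (Fin n) (Fin n) k) i m *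
          (g : Matrix (Fin n) (Fin n) k) l j) •
            fun h : GL (Fin n) k => (h : Matrix (Fin n) (Fin n) k) m l := by
      funext h
      rw [Units.val_mul, Units.val_mul, Matrix.mul_apply, Finset.sum_apply]
      refine Finset.sum_congr rfl fun l _ => ?_
      rw [Matrix.mul_apply, Finset.sum_apply, Finset.sum_mul]
      refine Finset.sum_congr rfl fun m _ => ?_
      rw [Pi.smul_apply, smul_eq_mul]
      ring
    rw [e]
    exact Subalgebra.sum_mem _ fun l _ => Subalgebra.sum_mem _ fun m _ =>
      Subalgebra.smul_mem _ (regularGL_entry m l) _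
  unfold regularGL at hF
  induction hF using Algebra.adjoin_induction with
  | mem f hf =>
    rcases hf with ⟨i, j, rfl⟩ | ⟨i, j, rfl⟩
    · exact key i j
    · have := regularGL_comp_inv (key i j)
      simpa [mul_assoc] using this
  | algebraMap r => exact Subalgebra.algebraMap_mem _ r
  | add f g _ _ hf hg => exact Subalgebra.add_mem _ hf hg
  | mul f g _ _ hf hg => exact Subalgebra.mul_mem _ hf hg

/-- The automorphism `w` of `M` is induced by conjugation with `g`. -/
def Induces (g : GL (Fin n) k) (w : M T ≃ₗ[ℤ] M T) : Prop :=
  ∀ (χ : M T) (t t' : T), (t' : GL (Fin n) k) = g⁻¹ * t * g → (w χ).eval t = χ.eval t'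

theorem conj_mem {g : GL (Fin n) k} (hg : g ∈ Subgroup.normalizer (T : Set (GL (Fin n) k)))
    (t : T) : g⁻¹ * (t : GL (Fin n) k) * g ∈ T := by
  have := (Subgroup.mem_normalizer_iff.1 (Subgroup.inv_mem _ hg) (t : GL (Fin n) k)).1 t.2
  simpa using this

/-- Conjugation by an element of the normalizer, on characters. -/
def conjChar {g : GL (Fin n) k} (hg : g ∈ Subgroup.normalizer (T : Set (GL (Fin n) k))) :
    M T →+ M T where
  toFun χ := Additive.ofMul (⟨{
      toFun := fun t => χ.eval ⟨_, conj_mem hg t⟩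
      map_one' := by
        rw [← eval_one χ]
        congr 1
        exact Subtype.ext (by simp)
      map_mul' := fun s t => by
        rw [← eval_mul]
        congr 1
        exact Subtype.ext (by simp [mul_assoc]) }, by
    obtain ⟨F, hF, h⟩ := (Additive.toMul χ : charGroup T).2
    exact ⟨_, regularGL_conj g hF, fun t => h ⟨_, conj_mem hg t⟩⟩⟩ : charGroup T)
  map_zero' := eval_ext fun _ => rfl
  map_add' _ _ := eval_ext fun _ => rfl

theorem conjChar_eval {g : GL (Fin n) k}
    (hg : g ∈ Subgroup.normalizer (T : Set (GL (Fin n) k))) (χ : M T) (t : T) :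
    (conjChar hg χ).eval t = χ.eval ⟨_, conj_mem hg t⟩ := rfl

/-- Every element of the normalizer of `T` in `G` induces an element of the Weyl group. -/
theorem exists_induces {g : GL (Fin n) k} (hgG : g ∈ G)
    (hg : g ∈ Subgroup.normalizer (T : Set (GL (Fin n) k))) :
    ∃ w ∈ weylGroup G T, Induces g w := by
  let w : M T ≃+ M T :=
    { conjChar hg with
      invFun := conjChar (Subgroup.inv_mem _ hg)
      left_inv := fun χ => eval_ext fun t => by
        change (conjChar _ (conjChar hg χ)).eval t = _
        rw [conjChar_eval, conjChar_eval]
        congr 1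
        exact Subtype.ext (by simp [mul_assoc])
      right_inv := fun χ => eval_ext fun t => by
        change (conjChar hg (conjChar _ χ)).eval t = _
        rw [conjChar_eval, conjChar_eval]
        congr 1
        exact Subtype.ext (by simp [mul_assoc]) }
  have hw : Induces g w.toIntLinearEquiv := by
    intro χ t t' e
    change (conjChar hg χ).eval t = _
    rw [conjChar_eval]
    congr 1
    exact Subtype.ext e.symm
  exact ⟨_, ⟨g, hgG, hg, hw⟩, hw⟩

theorem Induces.inv {g : GL (Fin n) k} {w : M T ≃ₗ[ℤ] M T} (h : Induces g w) :
    Induces g⁻¹ w⁻¹ := by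
  intro χ t t' e
  have := h (w⁻¹ χ) t' t (by rw [e]; simp [mul_assoc])
  rw [← this]
  simp

theorem mem_moveState {w : M T ≃ₗ[ℤ] M T} {S : Finset (M T)} {χ : M T} :
    χ ∈ moveState w S ↔ w⁻¹ χ ∈ S := by
  simp only [moveState, Finset.mem_map_equiv]
  rfl

theorem apply_mem_moveState {w : M T ≃ₗ[ℤ] M T} {S : Finset (M T)} {χ : M T} :
    w χ ∈ moveState w S ↔ χ ∈ S := by
  rw [mem_moveState]
  simp

theorem moveState_one (S : Finset (M T)) : moveState (1 : M T ≃ₗ[ℤ] M T) S = S := by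
  ext χ
  simp [mem_moveState]

theorem moveState_mul (w w' : M T ≃ₗ[ℤ] M T) (S : Finset (M T)) :
    moveState (w * w') S = moveState w (moveState w' S) := by
  ext χ
  simp [mem_moveState]

theorem moveState_inv_eq {w : M T ≃ₗ[ℤ] M T} {S S' : Finset (M T)} :
    moveState w⁻¹ S = S' ↔ S = moveState w S' := by
  constructor
  · rintro rfl
    rw [← moveState_mul, mul_inv_cancel, moveState_one]
  · rintro rfl
    rw [← moveState_mul, inv_mul_cancel, moveState_one]

variable {V : Type*} [AddCommGroup V] [Module k V]

theorem apply_mem_weightSpace (hle : T ≤ G) (ρ : Representation k G V) (g : G)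
    (hg : (g : GL (Fin n) k) ∈ Subgroup.normalizer (T : Set (GL (Fin n) k)))
    {w : M T ≃ₗ[ℤ] M T} (hw : Induces (g : GL (Fin n) k) w) {χ : M T} {v : V}
    (hv : v ∈ weightSpace (restrict hle ρ) χ) :
    ρ g v ∈ weightSpace (restrict hle ρ) (w χ) := by
  intro t
  rw [hw χ t ⟨_, conj_mem hg t⟩ rfl]
  have h1 := hv ⟨_, conj_mem hg t⟩
  change ρ (Subgroup.inclusion hle t) (ρ g v) = _
  have h2 : Subgroup.inclusion hle t * g =
      g * Subgroup.inclusion hle ⟨_, conj_mem hg t⟩ := by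
    apply Subtype.ext
    simp [mul_assoc]
  rw [← Module.End.mul_apply, ← map_mul, h2, map_mul, Module.End.mul_apply]
  change ρ (Subgroup.inclusion hle ⟨_, conj_mem hg t⟩) v = _ at h1
  rw [h1, map_smul]

variable [FiniteDimensional k V]

/-- The Weyl group permutes the weights of a representation of `G`. -/
theorem moveState_stateV (hle : T ≤ G) (ρ : Representation k G V) {w : M T ≃ₗ[ℤ] M T}
    (hw : w ∈ weylGroup G T) :
    moveState w (stateV (restrict hle ρ)) = stateV (restrict hle ρ) := by
  have key : ∀ w ∈ weylGroup G T, ∀ χ ∈ stateV (restrict hle ρ),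
      w χ ∈ stateV (restrict hle ρ) := by
    rintro w ⟨g, hgG, hg, hw⟩ χ hχ
    obtain ⟨v, hv, hne⟩ := mem_stateV.1 hχ
    refine mem_stateV.2 ⟨_, apply_mem_weightSpace hle ρ ⟨g, hgG⟩ hg hw hv, fun h0 => hne ?_⟩
    have := congrArg (ρ (⟨g, hgG⟩ : G)⁻¹) h0
    rwa [map_zero, ← Module.End.mul_apply, ← map_mul, inv_mul_cancel, map_one,
      Module.End.one_apply] at this
  ext χ
  rw [mem_moveState]
  constructor
  · intro h
    simpa using key w hw _ h
  · exact key w⁻¹ (Subgroup.inv_mem _ hw) χ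

/-- The normalizer of `T` acts on states through the Weyl group. -/
theorem stateOf_act_normalizer (hle : T ≤ G) (ρ : Representation k G V) (g : G)
    (hg : (g : GL (Fin n) k) ∈ Subgroup.normalizer (T : Set (GL (Fin n) k)))
    {w : M T ≃ₗ[ℤ] M T} (hw : Induces (g : GL (Fin n) k) w) (x : ℙ k (Module.Dual k V)) :
    stateOf (restrict hle ρ) (act ρ g x) = moveState w (stateOf (restrict hle ρ) x) := by
  obtain ⟨c, hc, e⟩ := exists_rep_act ρ g x
  have hinv : Induces ((g⁻¹ : G) : GL (Fin n) k) w⁻¹ := hw.inv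
  have hginv : ((g⁻¹ : G) : GL (Fin n) k) ∈ Subgroup.normalizer (T : Set (GL (Fin n) k)) :=
    Subgroup.inv_mem _ hg
  ext χ
  rw [mem_moveState, mem_stateOf, mem_stateOf, e]
  constructor
  · rintro ⟨v, hv, hne⟩
    refine ⟨ρ g⁻¹ v, apply_mem_weightSpace hle ρ g⁻¹ hginv hinv hv, fun h0 => hne ?_⟩
    rw [LinearMap.smul_apply, dual_apply_apply, h0, smul_zero]
  · rintro ⟨v, hv, hne⟩
    refine ⟨ρ g v, ?_, ?_⟩
    · have := apply_mem_weightSpace hle ρ g hg hw hv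
      simpa using this
    · rw [LinearMap.smul_apply, dual_apply_apply, ← Module.End.mul_apply, ← map_mul,
        inv_mul_cancel, map_one, Module.End.one_apply]
      exact smul_ne_zero hc hne

/-- The representation of a linear group on column vectors. -/
def naturalRep (H : Subgroup (GL (Fin n) k)) : Representation k H (Fin n → k) :=
  ((Matrix.toLinAlgEquiv' : Matrix (Fin n) (Fin n) k ≃ₐ[k] _) : _ →* _).comp
    ((Units.coeHom _).comp H.subtype)

theorem naturalRep_apply (H : Subgroup (GL (Fin n) k)) (h : H) (v : Fin n → k) :
    naturalRep H h v = (((h : GL (Fin n) k) : Matrix (Fin n) (Fin n) k)).mulVec v := rfl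

theorem isRationalRep_naturalRep (H : Subgroup (GL (Fin n) k)) :
    IsRationalRep (naturalRep H) := by
  intro v l
  refine ⟨∑ i, ∑ j, (v j * l (Pi.single i 1)) •
    fun h : GL (Fin n) k => (h : Matrix (Fin n) (Fin n) k) i j, ?_, fun h => ?_⟩
  · exact Subalgebra.sum_mem _ fun i _ => Subalgebra.sum_mem _ fun j _ =>
      Subalgebra.smul_mem _ (regularGL_entry i j) _
  · change l (naturalRep H h v) = _
    rw [naturalRep_apply, Finset.sum_apply]
    conv_lhs => rw [← Finset.univ_sum_single (Matrix.mulVec _ v), map_sum]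
    refine Finset.sum_congr rfl fun i _ => ?_
    rw [Finset.sum_apply]
    have : ∀ r : k, (Pi.single i r : Fin n → k) = r • Pi.single i 1 := fun r => by
      rw [← Pi.single_smul, smul_eq_mul, mul_one]
    rw [this, map_smul, smul_eq_mul, Matrix.mulVec, dotProduct, Finset.sum_mul]
    refine Finset.sum_congr rfl fun j _ => ?_
    rw [Pi.smul_apply, smul_eq_mul]
    ring

/-- An element of the Weyl group is determined by its action on the weights of the natural
representation, because `T` acts faithfully and diagonalizably on column vectors. -/
theorem eq_one_of_fixes_weights [Infinite k] (hT : IsTorus T) {w : M T ≃ₗ[ℤ] M T}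
    (hw : w ∈ weylGroup G T) (h : ∀ χ ∈ stateV (naturalRep T), w χ = χ) : w = 1 := by
  obtain ⟨g, hgG, hg, hind⟩ := hw
  obtain ⟨m, b, wt, hb⟩ := exists_weightBasis hT _ (isRationalRep_naturalRep T)
  have hconj : ∀ t : T, (⟨_, conj_mem hg t⟩ : T) = t := by
    intro t
    have h1 : naturalRep T ⟨_, conj_mem hg t⟩ = naturalRep T t := by
      refine b.ext fun i => ?_
      rw [hb i, hb i, ← hind (wt i) t _ rfl,
        h _ (mem_stateV.2 ⟨b i, hb i, b.ne_zero i⟩)]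
    apply Subtype.ext
    apply Units.ext
    exact (Matrix.toLinAlgEquiv' (R := k) (n := Fin n)).injective h1
  refine LinearEquiv.ext fun χ => eval_ext fun t => ?_
  rw [hind χ t ⟨_, conj_mem hg t⟩ rfl, hconj]
  rfl

theorem finite_weylGroup [Infinite k] (hT : IsTorus T) (hle : T ≤ G) :
    Finite (weylGroup G T) := by
  have hinv : ∀ w : weylGroup G T, ∀ χ ∈ stateV (naturalRep T),
      (w : M T ≃ₗ[ℤ] M T) χ ∈ stateV (naturalRep T) := by
    intro w χ hχ
    have h1 : moveState (w : M T ≃ₗ[ℤ] M T) (stateV (naturalRep T)) = stateV (naturalRep T) :=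
      moveState_stateV hle (naturalRep G) w.2
    rw [← h1]
    exact apply_mem_moveState.2 hχ
  let f : weylGroup G T → (stateV (naturalRep T) → stateV (naturalRep T)) :=
    fun w χ => ⟨_, hinv w χ χ.2⟩
  refine Finite.of_injective f fun w w' h => ?_
  have h1 : (w : M T ≃ₗ[ℤ] M T)⁻¹ * w' = 1 := by
    refine eq_one_of_fixes_weights hT
      (Subgroup.mul_mem _ (Subgroup.inv_mem _ w.2) w'.2) fun χ hχ => ?_
    have h2 : (w : M T ≃ₗ[ℤ] M T) χ = (w' : M T ≃ₗ[ℤ] M T) χ :=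
      congrArg Subtype.val (congrFun h ⟨χ, hχ⟩)
    rw [LinearEquiv.mul_apply, ← h2]
    simp
  exact Subtype.ext (inv_mul_eq_one.1 h1)

end Weyl

/-! ### Weyl group actions on functionals, and chambers -/

section Chambers

variable {k : Type*} [Field k] {n : ℕ} {G T : Subgroup (GL (Fin n) k)}

/-- The extension to `M_ℝ` of an automorphism of `M`. -/
noncomputable def realEquiv (w : M T ≃ₗ[ℤ] M T) : MR T ≃ₗ[ℝ] MR T :=
  LinearEquiv.baseChange ℤ ℝ (M T) (M T) w

theorem realEquiv_toMR (w : M T ≃ₗ[ℤ] M T) (χ : M T) : realEquiv w (toMR χ) = toMR (w χ) := rfl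

/-- The right action of automorphisms of `M` on `N_ℝ`. -/
noncomputable def moveNR (w : M T ≃ₗ[ℤ] M T) (lam : NR T) : NR T :=
  lam.comp (realEquiv w).toLinearMap

theorem moveNR_toMR (w : M T ≃ₗ[ℤ] M T) (lam : NR T) (χ : M T) :
    moveNR w lam (toMR χ) = lam (toMR (w χ)) := rfl

theorem moveNR_mul (w w' : M T ≃ₗ[ℤ] M T) (lam : NR T) :
    moveNR (w * w') lam = moveNR w' (moveNR w lam) := NR_ext fun _ => rfl

theorem moveNR_ne_zero {w : M T ≃ₗ[ℤ] M T} {lam : NR T} (h : lam ≠ 0) : moveNR w lam ≠ 0 := by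
  intro h0
  apply h
  refine NR_ext fun χ => ?_
  have := LinearMap.congr_fun h0 (toMR (w⁻¹ χ))
  rw [moveNR_toMR] at this
  simpa using this

theorem realize_moveState (w : M T ≃ₗ[ℤ] M T) (S : Finset (M T)) :
    realize (moveState w S) = realEquiv w '' realize S := by
  ext x
  constructor
  · rintro ⟨χ, hχ, rfl⟩
    refine ⟨toMR (w⁻¹ χ), ⟨_, mem_moveState.1 hχ, rfl⟩, ?_⟩
    rw [realEquiv_toMR]
    simp
  · rintro ⟨_, ⟨χ, hχ, rfl⟩, rfl⟩
    exact ⟨w χ, apply_mem_moveState.2 hχ, rfl⟩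

theorem spanR_moveState (w : M T ≃ₗ[ℤ] M T) (S : Finset (M T)) :
    spanR (moveState w S) = (spanR S).map (realEquiv w).toLinearMap := by
  unfold spanR
  rw [realize_moveState, Submodule.map_span]
  rfl

theorem mem_inter {S : Finset (M T)} {A : Submodule ℝ (MR T)} {χ : M T} :
    χ ∈ inter S A ↔ χ ∈ S ∧ toMR χ ∈ A := by
  classical
  exact Finset.mem_filter

theorem mem_geState {S : Finset (M T)} {lam : NR T} {χ : M T} :
    χ ∈ geState S lam ↔ χ ∈ S ∧ 0 ≤ lam (toMR χ) := by
  classical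
  exact Finset.mem_filter

theorem mem_eqState {S : Finset (M T)} {lam : NR T} {χ : M T} :
    χ ∈ eqState S lam ↔ χ ∈ S ∧ lam (toMR χ) = 0 := by
  classical
  exact Finset.mem_filter

theorem moveState_inter (w : M T ≃ₗ[ℤ] M T) (S : Finset (M T)) (A : Submodule ℝ (MR T)) :
    moveState w (inter S A) = inter (moveState w S) (A.map (realEquiv w).toLinearMap) := by
  ext χ
  rw [mem_moveState, mem_inter, mem_inter, mem_moveState]
  refine and_congr_right fun _ => ?_
  have e : toMR χ = realEquiv w (toMR (w⁻¹ χ)) := by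
    rw [realEquiv_toMR]
    simp
  rw [e]
  exact ((Submodule.mem_map_equiv (e := realEquiv w) A).trans
    (by rw [LinearEquiv.symm_apply_apply])).symm

theorem moveState_geState (w : M T ≃ₗ[ℤ] M T) (S : Finset (M T)) (lam : NR T) :
    geState S (moveNR w lam) = moveState w⁻¹ (geState (moveState w S) lam) := by
  ext χ
  rw [mem_moveState, mem_geState, mem_geState, mem_moveState, moveNR_toMR]
  simp

theorem zeroMemRelint_moveState [Module.Finite ℤ (M T)] {w : M T ≃ₗ[ℤ] M T}
    {S : Finset (M T)} (h : ZeroMemRelint S) : ZeroMemRelint (moveState w S) := by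
  rw [zeroMemRelint_iff] at h ⊢
  obtain ⟨⟨χ, hχ⟩, h⟩ := h
  refine ⟨⟨w χ, apply_mem_moveState.2 hχ⟩, fun lam hlam ψ hψ => ?_⟩
  have := h (moveNR w lam) (fun χ hχ => hlam _ (apply_mem_moveState.2 hχ)) _ (mem_moveState.1 hψ)
  rw [moveNR_toMR] at this
  simpa using this

theorem map_realEquiv_ne_top (w : M T ≃ₗ[ℤ] M T) {A : Submodule ℝ (MR T)} (hA : A ≠ ⊤) :
    A.map (realEquiv w).toLinearMap ≠ ⊤ := by
  intro h
  apply hA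
  rw [eq_top_iff]
  intro x _
  have h1 : realEquiv w x ∈ A.map (realEquiv w).toLinearMap := by
    rw [h]
    trivial
  obtain ⟨y, hy, e⟩ := h1
  rwa [← (realEquiv w).injective e]

theorem moveState_mem_polystableStates [Module.Finite ℤ (M T)] {Ξ : Finset (M T)}
    {w : M T ≃ₗ[ℤ] M T} (hw : moveState w Ξ = Ξ) {S : Finset (M T)}
    (hS : S ∈ polystableStates Ξ) : moveState w S ∈ polystableStates Ξ := by
  obtain ⟨A, hA, hSA, hspan, h⟩ := hS
  refine ⟨_, map_realEquiv_ne_top w hA, ?_, ?_, zeroMemRelint_moveState h⟩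
  · conv_lhs => rw [hSA, moveState_inter, hw]
  · rw [spanR_moveState, hspan]

theorem ne_top_of_le_ker {lam : NR T} (hlam : lam ≠ 0)
    {A : Submodule ℝ (MR T)} (hA : A ≤ LinearMap.ker lam) : A ≠ ⊤ := by
  rintro rfl
  exact hlam (LinearMap.ker_eq_top.1 (top_le_iff.1 hA))

theorem two_mul_form_eq {N : Type*} [AddCommGroup N] [Module ℝ N] {B : N → N → ℝ}
    (hsub : ∀ x y r z, B x (y - r • z) = B x y - r * B x z) (hsymm : ∀ x y, B x y = B y x)
    {p f : N} {c : ℝ} (h : B (p - c • f) (f - (2 : ℝ) • f) = B p f) :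
    2 * B p f = c * B f f := by
  rw [hsub, hsymm _ f, hsub, hsymm f p] at h
  linarith

/-- A scalar product on `N_ℝ` that is invariant under the Weyl group, obtained by averaging. -/
theorem exists_invariant_form [Module.Free ℤ (M T)] [Module.Finite ℤ (M T)]
    [Finite (weylGroup G T)] :
    ∃ B : NR T → NR T → ℝ,
      (∀ s ∈ weylGroup G T, ∀ lam nu, B (moveNR s lam) (moveNR s nu) = B lam nu) ∧
      (∀ lam nu r nu', B lam (nu - r • nu') = B lam nu - r * B lam nu') ∧
      (∀ lam nu, B lam nu = B nu lam) ∧ ∀ lam, lam ≠ 0 → 0 < B lam lam := by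
  classical
  have := Fintype.ofFinite (weylGroup G T)
  let b := Module.finBasis ℤ (M T)
  let B : NR T → NR T → ℝ := fun lam nu =>
    ∑ w : weylGroup G T, ∑ i, lam (toMR (w.1 (b i))) * nu (toMR (w.1 (b i)))
  refine ⟨B, fun s hs lam nu => ?_, fun lam nu r nu' => ?_, fun lam nu => ?_, fun lam hlam => ?_⟩
  · exact Fintype.sum_equiv (Equiv.mulLeft (⟨s, hs⟩ : weylGroup G T)) _ _ fun w => rfl
  · simp only [B, Finset.mul_sum, ← Finset.sum_sub_distrib]
    refine Finset.sum_congr rfl fun w _ => Finset.sum_congr rfl fun i _ => ?_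
    rw [LinearMap.sub_apply, LinearMap.smul_apply, smul_eq_mul]
    ring
  · exact Finset.sum_congr rfl fun w _ => Finset.sum_congr rfl fun i _ => mul_comm _ _
  · have hnn : ∀ w : weylGroup G T, 0 ≤ ∑ i, lam (toMR (w.1 (b i))) * lam (toMR (w.1 (b i))) :=
      fun w => Finset.sum_nonneg fun i _ => mul_self_nonneg _
    refine Finset.sum_pos' (fun w _ => hnn w) ⟨1, Finset.mem_univ _, ?_⟩
    refine lt_of_le_of_ne (hnn 1) fun h0 => hlam ?_
    have h1 := (Finset.sum_eq_zero_iff_of_nonneg fun i _ => mul_self_nonneg _).1 h0.symm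
    have h2 : (restrictNR lam).toIntLinearMap = 0 := b.ext fun i =>
      mul_self_eq_zero.1 (h1 i (Finset.mem_univ i))
    exact NR_ext fun χ => LinearMap.congr_fun h2 χ

/-- The action of a reflection on `N_ℝ`. -/
theorem moveNR_reflection {s : M T ≃ₗ[ℤ] M T} {α : MR T} {f : Module.Dual ℝ (MR T)}
    (hs : ∀ χ : M T, toMR (s χ) = toMR χ - f (toMR χ) • α) (lam : NR T) :
    moveNR s lam = lam - lam α • f := by
  refine NR_ext fun χ => ?_
  rw [moveNR_toMR, hs, map_sub, map_smul, LinearMap.sub_apply, LinearMap.smul_apply,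
    smul_eq_mul, smul_eq_mul, mul_comm]

/-- The translates of a chamber under the Weyl group cover `N_ℝ`. For an invariant scalar product,
choose the translate `mu ∘ w` whose product with the generic point `p` of the chamber is maximal;
if it were outside of the chamber, a reflection would increase this product. -/
theorem exists_moveNR_mem_chamber [Module.Free ℤ (M T)] [Module.Finite ℤ (M T)]
    [Finite (weylGroup G T)] {F : Set (NR T)} (hF : IsFundamentalChamber G T F) (mu : NR T) :
    ∃ w ∈ weylGroup G T, moveNR w mu ∈ F := by
  obtain ⟨p, -, rfl⟩ := hF
  obtain ⟨B, hBinv, hBsub, hBsymm, hBpos⟩ := exists_invariant_form (G := G) (T := T)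
  obtain ⟨w, hw⟩ := Finite.exists_max fun w : weylGroup G T => B p (moveNR w.1 mu)
  obtain ⟨w, hwW⟩ := w
  replace hw : ∀ v ∈ weylGroup G T, B p (moveNR v mu) ≤ B p (moveNR w mu) :=
    fun v hv => hw ⟨v, hv⟩
  refine ⟨w, hwW, fun α hα hpα => ?_⟩
  by_contra hneg
  obtain ⟨s, hs, f, hfα, hsf⟩ := hα
  have hmove := moveNR_reflection hsf
  have hf0 : f ≠ 0 := fun h0 =>
    two_ne_zero (hfα.symm.trans (LinearMap.congr_fun h0 α) : (2 : ℝ) = 0)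
  have hmf : moveNR s f = f - (2 : ℝ) • f :=
    (hmove f).trans (congrArg (fun r : ℝ => f - r • f) hfα)
  have hBpf : 2 * B p f = p α * B f f :=
    two_mul_form_eq hBsub hBsymm ((congrArg₂ B (hmove p) hmf).symm.trans (hBinv s hs p f))
  have hmax := hw _ (Subgroup.mul_mem _ hwW hs)
  have hrefl : moveNR (w * s) mu = moveNR w mu - (moveNR w mu α) • f :=
    (moveNR_mul w s mu).trans (hmove _)
  have hcalc := ((congrArg (B p) hrefl).trans (hBsub _ _ _ _)).symm.trans_le hmax
  have hpos : 0 < 2 * B p f := hBpf.symm ▸ mul_pos hpα (hBpos f hf0)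
  generalize moveNR w mu α = r at hneg hcalc
  generalize B p f = z at hpos hcalc
  generalize B p (moveNR w mu) = y at hcalc
  nlinarith

end Chambers

/-! ### The algorithm -/

section AlgorithmCorrectness

variable {k : Type*} [Field k] {n : ℕ} {T : Subgroup (GL (Fin n) k)}

/-- A loop that only adds members collects the contributions of all of its steps. -/
theorem mem_foldl_iff {α β : Type*} (f : Finset α → β → Finset α) (R : β → α → Prop)
    (hf : ∀ P b Y, Y ∈ f P b ↔ Y ∈ P ∨ R b Y) (l : List β) (P : Finset α) (Y : α) :
    Y ∈ l.foldl f P ↔ Y ∈ P ∨ ∃ b ∈ l, R b Y := by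
  induction l generalizing P with
  | nil => simp
  | cons b l ih =>
    rw [List.foldl_cons, ih, hf]
    simp only [List.mem_cons, exists_eq_or_imp]
    tauto

theorem mem_loopInput (Ξ : Finset (M T)) (input : List (NR T)) (S : Finset (M T)) :
    (S ∈ (loopInput Ξ input).1 ↔
        ∃ lam ∈ input, ZeroMemRelint (eqState Ξ lam) ∧ S = eqState Ξ lam) ∧
      (S ∈ (loopInput Ξ input).2 ↔
        ∃ lam ∈ input, ZeroMemConv (eqState Ξ lam) ∧ S = eqState Ξ lam) := by
  classical
  unfold loopInput
  have key : ∀ (l : List (NR T)) (Q : Finset (Finset (M T)) × Finset (Finset (M T))),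
      l.foldl (fun Q lam =>
        (if ZeroMemRelint (eqState Ξ lam) then insert (eqState Ξ lam) Q.1 else Q.1,
          if ZeroMemConv (eqState Ξ lam) then insert (eqState Ξ lam) Q.2 else Q.2)) Q =
      (l.foldl (fun P lam =>
        if ZeroMemRelint (eqState Ξ lam) then insert (eqState Ξ lam) P else P) Q.1,
       l.foldl (fun P lam =>
        if ZeroMemConv (eqState Ξ lam) then insert (eqState Ξ lam) P else P) Q.2) := by
    intro l
    induction l with
    | nil => intro Q; rfl
    | cons lam l ih => intro Q; rw [List.foldl_cons, ih]; rfl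
  have step : ∀ (p : NR T → Prop) (P : Finset (Finset (M T))) (lam : NR T) (Y : Finset (M T)),
      Y ∈ (if p lam then insert (eqState Ξ lam) P else P) ↔ Y ∈ P ∨ p lam ∧ Y = eqState Ξ lam := by
    intro p P lam Y
    by_cases h : p lam <;> simp [h, or_comm]
  constructor
  · convert (mem_foldl_iff _ (fun lam Y => ZeroMemRelint (eqState Ξ lam) ∧ Y = eqState Ξ lam)
      (step fun lam => ZeroMemRelint (eqState Ξ lam)) input ∅ S) using 1
    · convert Iff.rfl using 2
      exact (congrArg Prod.fst (key input (∅, ∅))).symm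
    · simp
  · convert (mem_foldl_iff _ (fun lam Y => ZeroMemConv (eqState Ξ lam) ∧ Y = eqState Ξ lam)
      (step fun lam => ZeroMemConv (eqState Ξ lam)) input ∅ S) using 1
    · convert Iff.rfl using 2
      exact (congrArg Prod.snd (key input (∅, ∅))).symm
    · simp

theorem mem_loopSubsets (Ξ : Finset (M T)) {enum : Finset (Finset (M T)) → List (Finset (M T))}
    (henum : IsEnumeration enum) (P Sp : Finset (Finset (M T))) (Y : Finset (M T)) :
    Y ∈ loopSubsets Ξ enum P Sp ↔ Y ∈ P ∨ ∃ S ∈ Sp, ∃ S' ⊆ S,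
      dimConv S' < dimConv S ∧ ZeroMemRelint S' ∧ Y = inter Ξ (spanR S') := by
  classical
  unfold loopSubsets
  refine (mem_foldl_iff _ (fun S Y => ∃ S' ⊆ S,
    dimConv S' < dimConv S ∧ ZeroMemRelint S' ∧ Y = inter Ξ (spanR S')) ?_ _ _ _).trans ?_
  · intro P S Y
    refine (mem_foldl_iff _ (fun S' Y =>
      dimConv S' < dimConv S ∧ ZeroMemRelint S' ∧ Y = inter Ξ (spanR S')) ?_ _ _ _).trans ?_
    · intro P S' Y
      by_cases h : dimConv S' < dimConv S
      · by_cases h' : ZeroMemRelint S'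
        · simp [h, h', or_comm]
        · simp [h, h']
      · simp [h]
    · simp only [henum _ _, Finset.mem_powerset]
  · simp only [henum _ _]

variable {weyl : List (M T ≃ₗ[ℤ] M T)} {W : Subgroup (M T ≃ₗ[ℤ] M T)}

open Classical in
/-- The inner part of the third loop removes the other members of the orbit of `S`. -/
theorem mem_foldl_erase (l : List (M T ≃ₗ[ℤ] M T)) (S : Finset (M T))
    (P : Finset (Finset (M T))) (Y : Finset (M T)) :
    Y ∈ l.foldl (fun P w => if moveState w S ≠ S ∧ moveState w S ∈ P
        then P.erase (moveState w S) else P) P ↔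
      Y ∈ P ∧ ∀ w ∈ l, moveState w S = Y → Y = S := by
  induction l generalizing P with
  | nil => simp
  | cons w l ih =>
    rw [List.foldl_cons, ih, List.forall_mem_cons]
    by_cases h : moveState w S ≠ S ∧ moveState w S ∈ P
    · rw [if_pos h, Finset.mem_erase]
      constructor
      · rintro ⟨⟨h1, h2⟩, h3⟩
        exact ⟨h2, fun e => absurd e.symm h1, h3⟩
      · rintro ⟨h1, h2, h3⟩
        refine ⟨⟨fun e => h.1 ?_, h1⟩, h3⟩
        rw [← e, h2 e.symm]
    · rw [if_neg h]
      constructor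
      · rintro ⟨h1, h2⟩
        refine ⟨h1, fun e => ?_, h2⟩
        by_contra hne
        exact h ⟨fun h' => hne (e.symm.trans h'), e ▸ h1⟩
      · rintro ⟨h1, h2, h3⟩
        exact ⟨h1, h3⟩

open Classical in
/-- The third loop keeps members of `P` only, meets all the orbits of the members of `P`, and keeps
at most one member of each orbit that it has treated. -/
theorem foldl_weyl_spec (hweyl : ∀ w, w ∈ weyl ↔ w ∈ W) (l : List (Finset (M T)))
    (P Q : Finset (Finset (M T)))
    (hQ : Q = l.foldl (fun P S =>
      if S ∈ P then
        weyl.foldl (fun P w => if moveState w S ≠ S ∧ moveState w S ∈ P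
          then P.erase (moveState w S) else P) P
      else P) P) :
    Q ⊆ P ∧ (∀ Y ∈ P, ∃ w ∈ W, moveState w Y ∈ Q) ∧
      ∀ S ∈ l, S ∈ Q → ∀ w ∈ W, moveState w S ∈ Q → moveState w S = S := by
  induction l generalizing P with
  | nil =>
    subst hQ
    exact ⟨subset_rfl, fun Y hY => ⟨1, W.one_mem, by rwa [moveState_one]⟩, by simp⟩
  | cons S l ih =>
    rw [List.foldl_cons] at hQ
    obtain ⟨h1, h2, h3⟩ := ih _ hQ
    by_cases hS : S ∈ P
    · simp only [hS, if_true] at h1 h2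
      have hmem := mem_foldl_erase weyl S P
      have hSS : S ∈ weyl.foldl (fun P w => if moveState w S ≠ S ∧ moveState w S ∈ P
          then P.erase (moveState w S) else P) P := (hmem S).2 ⟨hS, fun _ _ _ => rfl⟩
      refine ⟨fun Y hY => ((hmem Y).1 (h1 hY)).1, fun Y hY => ?_, ?_⟩
      · by_cases hY' : ∀ w ∈ weyl, moveState w S = Y → Y = S
        · exact h2 Y ((hmem Y).2 ⟨hY, hY'⟩)
        · push Not at hY'
          obtain ⟨w, hw, rfl, -⟩ := hY'
          obtain ⟨w', hw', hQ'⟩ := h2 S hSS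
          refine ⟨w' * w⁻¹, W.mul_mem hw' (W.inv_mem ((hweyl w).1 hw)), ?_⟩
          rwa [← moveState_mul, inv_mul_cancel_right]
      · rw [List.forall_mem_cons]
        exact ⟨fun _ w hw hwS => ((hmem _).1 (h1 hwS)).2 w ((hweyl w).2 hw) rfl, h3⟩
    · simp only [hS, if_false] at h1 h2
      refine ⟨h1, h2, ?_⟩
      rw [List.forall_mem_cons]
      exact ⟨fun hSQ => absurd (h1 hSQ) hS, h3⟩

/-- The third loop chooses representatives of the orbits of the members of `P`. -/
theorem loopWeyl_spec (hweyl : ∀ w, w ∈ weyl ↔ w ∈ W)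
    {enum : Finset (Finset (M T)) → List (Finset (M T))} (henum : IsEnumeration enum)
    (P : Finset (Finset (M T))) :
    loopWeyl weyl enum P ⊆ P ∧ (∀ Y ∈ P, ∃ w ∈ W, moveState w Y ∈ loopWeyl weyl enum P) ∧
      ∀ S ∈ loopWeyl weyl enum P, ∀ w ∈ W, moveState w S ∈ loopWeyl weyl enum P →
        moveState w S = S := by
  obtain ⟨h1, h2, h3⟩ := foldl_weyl_spec hweyl (enum P) P (loopWeyl weyl enum P) rfl
  exact ⟨h1, h2, fun S hS => h3 S ((henum P S).2 (h1 hS)) hS⟩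

end AlgorithmCorrectness

/-! ### Polystable states and correctness of the algorithm -/

section Correctness

variable {k : Type*} [Field k] {n : ℕ} {G T : Subgroup (GL (Fin n) k)} {Ξ : Finset (M T)}

/-- The intersection of `Ξ` with the span of a state that is not full and has the origin in the
relative interior of its hull is a polystable state. -/
theorem inter_spanR_mem_polystableStates [Module.Finite ℤ (M T)] {S : Finset (M T)}
    (hS : S ⊆ Ξ) (htop : spanR S ≠ ⊤) (h : ZeroMemRelint S) :
    inter Ξ (spanR S) ∈ polystableStates Ξ ∧ spanR (inter Ξ (spanR S)) = spanR S := by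
  have hsub : S ⊆ inter Ξ (spanR S) := fun χ hχ =>
    mem_inter.2 ⟨hS hχ, Submodule.subset_span (toMR_mem_realize hχ)⟩
  have hspan : spanR (inter Ξ (spanR S)) = spanR S := by
    apply le_antisymm
    · refine Submodule.span_le.2 ?_
      rintro _ ⟨χ, hχ, rfl⟩
      exact (mem_inter.1 hχ).2
    · exact Submodule.span_mono (Set.image_mono (by exact_mod_cast hsub))
  exact ⟨⟨spanR S, htop, rfl, hspan, h.mono hsub fun χ hχ => (mem_inter.1 hχ).2⟩, hspan⟩

theorem spanR_eqState_le_ker (lam : NR T) : spanR (eqState Ξ lam) ≤ LinearMap.ker lam := by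
  refine Submodule.span_le.2 ?_
  rintro _ ⟨χ, hχ, rfl⟩
  exact (mem_eqState.1 hχ).2

theorem inter_spanR_eqState (lam : NR T) : inter Ξ (spanR (eqState Ξ lam)) = eqState Ξ lam := by
  ext χ
  rw [mem_inter, mem_eqState]
  constructor
  · rintro ⟨h1, h2⟩
    exact ⟨h1, spanR_eqState_le_ker lam h2⟩
  · rintro ⟨h1, h2⟩
    exact ⟨h1, Submodule.subset_span (toMR_mem_realize (mem_eqState.2 ⟨h1, h2⟩))⟩

theorem finite_PsF (Ξ : Finset (M T)) (F : Set (NR T)) : (PsF Ξ F).Finite := by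
  refine (Ξ.powerset.finite_toSet).subset ?_
  rintro S ⟨-, lam, -, -, rfl⟩
  rw [Finset.mem_coe, Finset.mem_powerset]
  exact fun χ hχ => (mem_geState.1 hχ).1

/-- Every state `Ξ_{lam ≥ 0}` is contained in a maximal one. -/
theorem exists_maximal_geState (Ξ : Finset (M T)) {lam : NR T} (hlam : lam ≠ 0) :
    ∃ mu : NR T, mu ≠ 0 ∧ geState Ξ lam ⊆ geState Ξ mu ∧
      Maximal (fun S' => ∃ lam : NR T, lam ≠ 0 ∧ S' = geState Ξ lam) (geState Ξ mu) := by
  have hfin : {S' | ∃ lam : NR T, lam ≠ 0 ∧ S' = geState Ξ lam}.Finite := by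
    refine (Ξ.powerset.finite_toSet).subset ?_
    rintro S ⟨lam, -, rfl⟩
    rw [Finset.mem_coe, Finset.mem_powerset]
    exact fun χ hχ => (mem_geState.1 hχ).1
  obtain ⟨S, hle, hmax⟩ := hfin.exists_le_maximal ⟨lam, hlam, rfl⟩
  obtain ⟨mu, hmu, rfl⟩ := hmax.prop
  exact ⟨mu, hmu, hle, hmax⟩

/-- Being one of the maximal states `Ξ_{lam ≥ 0}` is invariant under automorphisms of `Ξ`. -/
theorem maximal_geState_moveNR {w : M T ≃ₗ[ℤ] M T} (hw : moveState w Ξ = Ξ) {mu : NR T}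
    (h : Maximal (fun S' => ∃ lam : NR T, lam ≠ 0 ∧ S' = geState Ξ lam) (geState Ξ mu))
    (hmu : mu ≠ 0) :
    Maximal (fun S' => ∃ lam : NR T, lam ≠ 0 ∧ S' = geState Ξ lam)
      (geState Ξ (moveNR w mu)) := by
  have key : ∀ lam : NR T, geState Ξ (moveNR w lam) = moveState w⁻¹ (geState Ξ lam) := by
    intro lam
    rw [moveState_geState, hw]
  refine ⟨⟨_, moveNR_ne_zero hmu, rfl⟩, ?_⟩
  rintro _ ⟨lam, hlam, rfl⟩ hle
  have e : lam = moveNR w (moveNR w⁻¹ lam) := by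
    rw [← moveNR_mul, inv_mul_cancel]
    exact NR_ext fun _ => rfl
  rw [e, key] at hle ⊢
  rw [key] at hle ⊢
  intro χ hχ
  rw [mem_moveState] at hχ ⊢
  refine h.2 ⟨moveNR w⁻¹ lam, moveNR_ne_zero hlam, rfl⟩ (fun ψ hψ => ?_) hχ
  have := hle (apply_mem_moveState.2 hψ)
  exact apply_mem_moveState.1 this

/-- Every polystable state is, up to the Weyl group, contained in `Ξ_{lam = 0}` for some `lam` of
the input of the algorithm. -/
theorem exists_input_supset [Module.Free ℤ (M T)] [Module.Finite ℤ (M T)]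
    [Finite (weylGroup G T)] {F : Set (NR T)} (hF : IsFundamentalChamber G T F)
    (hΞ : ∀ w ∈ weylGroup G T, moveState w Ξ = Ξ) {input : List (NR T)}
    (hin : Presents Ξ F input) {S : Finset (M T)} (hS : S ∈ polystableStates Ξ) :
    ∃ lam ∈ input, ∃ w ∈ weylGroup G T, moveState w S ⊆ eqState Ξ lam := by
  obtain ⟨A, hA, hSA, hspan, hrel⟩ := hS
  obtain ⟨lam, hlam, hle⟩ := Submodule.exists_le_ker_of_lt_top A (lt_top_iff_ne_top.2 hA)
  obtain ⟨mu, hmu, hsub, hmax⟩ := exists_maximal_geState Ξ hlam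
  obtain ⟨w, hw, hwF⟩ := exists_moveNR_mem_chamber hF mu
  have hmem : geState Ξ (moveNR w mu) ∈ PsF Ξ F :=
    ⟨maximal_geState_moveNR (hΞ w hw) hmax hmu, _, hwF, moveNR_ne_zero hmu, rfl⟩
  rw [← hin.2] at hmem
  obtain ⟨nu, hnu, hnu'⟩ := hmem
  refine ⟨nu, hnu, w⁻¹, Subgroup.inv_mem _ hw, ?_⟩
  have hSge : moveState w⁻¹ S ⊆ geState Ξ nu := by
    rw [← hnu', moveState_geState, hΞ w hw]
    intro χ hχ
    rw [mem_moveState] at hχ ⊢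
    apply hsub
    rw [hSA, mem_inter] at hχ
    exact mem_geState.2 ⟨hχ.1, le_of_eq (hle hχ.2).symm⟩
  -- a functional that is nonnegative on a polystable state vanishes on it
  have hzero := ((zeroMemRelint_iff _).1 (zeroMemRelint_moveState (w := w⁻¹) hrel)).2 nu
    fun χ hχ => (mem_geState.1 (hSge hχ)).2
  exact fun χ hχ => mem_eqState.2 ⟨(mem_geState.1 (hSge hχ)).1, hzero χ hχ⟩

/-- The states found by the first two loops are polystable states, and they meet every orbit of
the Weyl group on the polystable states. -/
theorem loopSubsets_spec [Module.Free ℤ (M T)] [Module.Finite ℤ (M T)]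
    [Finite (weylGroup G T)] {F : Set (NR T)} (hF : IsFundamentalChamber G T F)
    (hΞ : ∀ w ∈ weylGroup G T, moveState w Ξ = Ξ) {input : List (NR T)}
    (hin : Presents Ξ F input) {enum : Finset (Finset (M T)) → List (Finset (M T))}
    (henum : IsEnumeration enum) :
    (∀ S ∈ loopSubsets Ξ enum (loopInput Ξ input).1 (loopInput Ξ input).2,
      S ∈ polystableStates Ξ) ∧
    ∀ S ∈ polystableStates Ξ, ∃ w ∈ weylGroup G T,
      moveState w S ∈ loopSubsets Ξ enum (loopInput Ξ input).1 (loopInput Ξ input).2 := by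
  constructor
  · intro S hS
    rw [mem_loopSubsets Ξ henum] at hS
    rcases hS with hS | ⟨S₁, hS₁, S', hS', hdim, hrel, rfl⟩
    · obtain ⟨lam, hlam, hrel, rfl⟩ := (mem_loopInput Ξ input S).1.1 hS
      have := (inter_spanR_mem_polystableStates (Ξ := Ξ)
        (fun χ hχ => (mem_eqState.1 hχ).1)
        (ne_top_of_le_ker (hin.1 lam hlam).2 (spanR_eqState_le_ker lam)) hrel).1
      rwa [inter_spanR_eqState] at this
    · obtain ⟨lam, hlam, -, rfl⟩ := (mem_loopInput Ξ input S₁).2.1 hS₁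
      refine (inter_spanR_mem_polystableStates (fun χ hχ => (mem_eqState.1 (hS' hχ)).1)
        (ne_top_of_le_ker (hin.1 lam hlam).2
          (le_trans (Submodule.span_mono ?_) (spanR_eqState_le_ker (Ξ := Ξ) lam))) hrel).1
      exact Set.image_mono (by exact_mod_cast hS')
  · intro S hS
    obtain ⟨lam, hlam, w, hw, hsub⟩ := exists_input_supset hF hΞ hin hS
    refine ⟨w, hw, ?_⟩
    obtain ⟨A, hA, hSA, hspan, hrel⟩ := moveState_mem_polystableStates (hΞ w hw) hS
    have hconv := hrel.zeroMemConv.mono hsub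
    have hle : spanR (moveState w S) ≤ spanR (eqState Ξ lam) :=
      Submodule.span_mono (Set.image_mono (by exact_mod_cast hsub))
    rw [mem_loopSubsets Ξ henum]
    by_cases hdim : dimConv (moveState w S) < dimConv (eqState Ξ lam)
    · refine Or.inr ⟨eqState Ξ lam, (mem_loopInput Ξ input _).2.2 ⟨lam, hlam, hconv, rfl⟩,
        _, hsub, hdim, hrel, ?_⟩
      rw [hspan]
      exact hSA
    · rw [finrank_spanR_eq_dimConv hconv, finrank_spanR_eq_dimConv hrel.zeroMemConv,
        not_lt] at hdim
      have heq : moveState w S = eqState Ξ lam := by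
        rw [hSA, ← hspan, Submodule.eq_of_le_of_finrank_le hle hdim, inter_spanR_eqState]
      rw [heq] at hrel ⊢
      exact Or.inl ((mem_loopInput Ξ input _).1.2 ⟨lam, hlam, hrel, rfl⟩)

/-- Correctness of the algorithm: its output is a set of representatives of the orbits of the Weyl
group on the polystable states. -/
theorem polystableAlgorithm_spec [Module.Free ℤ (M T)] [Module.Finite ℤ (M T)]
    [Finite (weylGroup G T)] {F : Set (NR T)} (hF : IsFundamentalChamber G T F)
    (hΞ : ∀ w ∈ weylGroup G T, moveState w Ξ = Ξ) {input : List (NR T)}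
    (hin : Presents Ξ F input) {enum : Finset (Finset (M T)) → List (Finset (M T))}
    (henum : IsEnumeration enum) {weyl : List (M T ≃ₗ[ℤ] M T)}
    (hweyl : ∀ w, w ∈ weyl ↔ w ∈ weylGroup G T) :
    (∀ S ∈ polystableAlgorithm Ξ weyl enum input, S ∈ polystableStates Ξ) ∧
    ∀ S ∈ polystableStates Ξ, ∃! S', S' ∈ polystableAlgorithm Ξ weyl enum input ∧
      ∃ w ∈ weylGroup G T, S = moveState w S' := by
  obtain ⟨h1, h2⟩ := loopSubsets_spec hF hΞ hin henum
  obtain ⟨h3, h4, h5⟩ := loopWeyl_spec hweyl henum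
    (loopSubsets Ξ enum (loopInput Ξ input).1 (loopInput Ξ input).2)
  refine ⟨fun S hS => h1 S (h3 hS), fun S hS => ?_⟩
  obtain ⟨w, hw, hwS⟩ := h2 S hS
  obtain ⟨w', hw', hwS'⟩ := h4 _ hwS
  rw [← moveState_mul] at hwS'
  refine ⟨moveState (w' * w) S, ⟨hwS', (w' * w)⁻¹,
    Subgroup.inv_mem _ (Subgroup.mul_mem _ hw' hw), ?_⟩, ?_⟩
  · rw [← moveState_mul, inv_mul_cancel, moveState_one]
  · rintro S' ⟨hS', v, hv, rfl⟩
    rw [← moveState_mul] at hwS' ⊢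
    exact (h5 S' hS' _ (Subgroup.mul_mem _ (Subgroup.mul_mem _ hw' hw) hv) hwS').symm

end Correctness

/-! ### Strata -/

section Strata

variable {k : Type*} [Field k] {n : ℕ} {G T : Subgroup (GL (Fin n) k)}
  {V : Type*} [AddCommGroup V] [Module k V]

theorem IsRationalRep.restrict {ρ : Representation k G V} (hρ : IsRationalRep ρ) (hle : T ≤ G) :
    IsRationalRep (restrict hle ρ) := by
  intro v l
  obtain ⟨F, hF, h⟩ := hρ v l
  exact ⟨F, hF, fun t => h (Subgroup.inclusion hle t)⟩

theorem isClosed_univ_zariskiProj :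
    IsClosed[zariskiProj k V] (Set.univ : Set (ℙ k (Module.Dual k V))) := by
  let := zariskiProj k V
  exact isClosed_univ

/-- A point with infinite stabilizer in `T` is not stable for `G`. -/
theorem notMem_stable_of_mem_strictlyPolystable (hle : T ≤ G) {ρ : Representation k G V}
    {X : Set (ℙ k (Module.Dual k V))}
    {x : ℙ k (Module.Dual k V)} (hx : x ∈ strictlyPolystable (restrict hle ρ) X) :
    x ∉ stable ρ X := by
  rintro ⟨-, m, -, s, -, -, hfin, -⟩
  refine hx.2.1 (Set.Finite.of_finite_image (f := Subgroup.inclusion hle) (hfin.subset ?_)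
    (Subgroup.inclusion_injective hle).injOn)
  rintro _ ⟨t, ht, rfl⟩
  exact ht

variable [IsAlgClosed k] [FiniteDimensional k V]

/-- Every nonempty set of weights is the state of a point of `ℙ(V*)`. -/
theorem exists_stateOf_eq (hT : IsTorus T) {σ : Representation k T V} (hσ : IsRationalRep σ)
    {S : Finset (M T)} (hS : S ⊆ stateV σ) (hne : S.Nonempty) :
    ∃ x : ℙ k (Module.Dual k V), stateOf σ x = S := by
  classical
  obtain ⟨m, b, wt, hb⟩ := exists_weightBasis hT σ hσ
  let φ : Module.Dual k V := b.constr k fun i => if wt i ∈ S then (1 : k) else 0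
  have hφ : ∀ i, φ (b i) = if wt i ∈ S then (1 : k) else 0 := fun i => by
    simp only [φ]
    rw [Module.Basis.constr_basis]
  have hφv : ∀ v, φ v = ∑ i, b.repr v i * if wt i ∈ S then (1 : k) else 0 := by
    intro v
    conv_lhs => rw [← b.sum_repr v, map_sum]
    simp only [map_smul, smul_eq_mul, hφ]
  have hwt : ∀ χ ∈ S, ∃ i, wt i = χ := by
    intro χ hχ
    obtain ⟨v, hv, hv0⟩ := mem_stateV.1 (hS hχ)
    obtain ⟨i, hi⟩ : ∃ i, b.repr v i ≠ 0 := by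
      by_contra! h0
      exact hv0 (b.repr.map_eq_zero_iff.1 (Finsupp.ext h0))
    exact ⟨i, weight_eq_of_repr_ne_zero hb hv hi⟩
  have hφ0 : φ ≠ 0 := by
    obtain ⟨χ, hχ⟩ := hne
    obtain ⟨i, rfl⟩ := hwt χ hχ
    intro h0
    have := hφ i
    rw [h0, if_pos hχ] at this
    exact zero_ne_one this
  refine ⟨Projectivization.mk k φ hφ0, ?_⟩
  ext χ
  rw [mem_stateOf_mk]
  constructor
  · rintro ⟨v, hv, hne⟩
    by_contra hχ
    apply hne
    rw [hφv]
    refine Finset.sum_eq_zero fun i _ => ?_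
    by_cases hi : b.repr v i = 0
    · simp [hi]
    · rw [weight_eq_of_repr_ne_zero hb hv hi, if_neg hχ, mul_zero]
  · intro hχ
    obtain ⟨i, rfl⟩ := hwt χ hχ
    exact ⟨b i, hb i, by rw [hφ, if_pos hχ]; exact one_ne_zero⟩

variable {σ : Representation k T V} {X : Set (ℙ k (Module.Dual k V))}

theorem mem_stratum_iff (hT : IsTorus T) (hσ : IsRationalRep σ)
    (hX : IsClosed[zariskiProj k V] X) (hXT : ∀ t : T, ∀ x ∈ X, act σ t x ∈ X)
    {A : Submodule ℝ (MR T)} {x : ℙ k (Module.Dual k V)} :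
    x ∈ stratum σ X A ↔
      x ∈ X ∧ A ≠ ⊤ ∧ spanR (stateOf σ x) = A ∧ ZeroMemRelint (stateOf σ x) := by
  constructor
  · rintro ⟨hx, rfl, hrel⟩
    have hxX : x ∈ X := hx.1.1.1
    obtain ⟨⟨B, hB, hsub⟩, -⟩ := (mem_strictlyPolystable_iff hT hσ hX hXT hxX).1 hx
    refine ⟨hxX, fun htop => hB ?_, rfl, hrel⟩
    exact top_le_iff.1 (htop ▸ Submodule.span_le.2 hsub)
  · rintro ⟨hxX, hA, rfl, hrel⟩
    exact ⟨(mem_strictlyPolystable_iff hT hσ hX hXT hxX).2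
      ⟨⟨_, hA, Submodule.subset_span⟩, hrel⟩, rfl, hrel⟩

/-- Every polystable state is the state of a point of its stratum in `ℙ(V*)`. -/
theorem exists_mem_stratum (hT : IsTorus T) (hσ : IsRationalRep σ) {S : Finset (M T)}
    (hS : S ∈ polystableStates (stateV σ)) :
    ∃ x ∈ stratum σ Set.univ (spanR S), stateOf σ x = S := by
  obtain ⟨A, hA, hSA, hspan, hrel⟩ := hS
  obtain ⟨x, rfl⟩ := exists_stateOf_eq hT hσ (S := S)
    (fun χ hχ => by rw [hSA] at hχ; exact (mem_inter.1 hχ).1)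
    (hrel.zeroMemConv.nonempty)
  refine ⟨x, (mem_stratum_iff hT hσ isClosed_univ_zariskiProj fun _ _ _ => trivial).2
    ⟨trivial, ?_, rfl, hrel⟩, rfl⟩
  rwa [hspan]

/-- The state attached to a strictly polystable point. -/
theorem inter_spanR_stateOf_mem (hT : IsTorus T) {A : Submodule ℝ (MR T)} (hA : A ≠ ⊤)
    {x : ℙ k (Module.Dual k V)} (hspan : spanR (stateOf σ x) = A)
    (hrel : ZeroMemRelint (stateOf σ x)) :
    inter (stateV σ) A ∈ polystableStates (stateV σ) ∧ spanR (inter (stateV σ) A) = A := by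
  have := charLattice_finite hT
  subst hspan
  exact inter_spanR_mem_polystableStates (stateOf_subset x) hA hrel

/-- Elements of the normalizer permute the strata. -/
theorem act_mem_stratum (hT : IsTorus T) (hle : T ≤ G) {ρ : Representation k G V}
    (hρ : IsRationalRep ρ) (hX : IsClosed[zariskiProj k V] X)
    (hGX : ∀ g : G, ∀ x ∈ X, act ρ g x ∈ X) (g : G)
    (hg : (g : GL (Fin n) k) ∈ Subgroup.normalizer (T : Set (GL (Fin n) k)))
    {w : M T ≃ₗ[ℤ] M T} (hw : Induces (g : GL (Fin n) k) w) {A : Submodule ℝ (MR T)}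
    {x : ℙ k (Module.Dual k V)} (hx : x ∈ stratum (restrict hle ρ) X A) :
    act ρ g x ∈ stratum (restrict hle ρ) X (A.map (realEquiv w).toLinearMap) := by
  have := charLattice_finite hT
  have hXT : ∀ t : T, ∀ x ∈ X, act (restrict hle ρ) t x ∈ X := fun t x hx =>
    hGX (Subgroup.inclusion hle t) x hx
  rw [mem_stratum_iff hT (hρ.restrict hle) hX hXT] at hx ⊢
  obtain ⟨hxX, hA, hspan, hrel⟩ := hx
  refine ⟨hGX g x hxX, map_realEquiv_ne_top w hA, ?_, ?_⟩
  · rw [stateOf_act_normalizer hle ρ g hg hw, spanR_moveState, hspan]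
  · rw [stateOf_act_normalizer hle ρ g hg hw]
    exact zeroMemRelint_moveState hrel

/-- The strictly polystable locus is the union of the translates of the strata of any set `P` of
polystable states that meets every orbit of the Weyl group; the same holds for its intersection with
a `G`-stable set `Y`. -/
theorem inter_strictlyPolystable_eq (hT : IsTorus T) (hle : T ≤ G) {ρ : Representation k G V}
    (hρ : IsRationalRep ρ) (hX : IsClosed[zariskiProj k V] X)
    (hGX : ∀ g : G, ∀ x ∈ X, act ρ g x ∈ X) {Y : Set (ℙ k (Module.Dual k V))}
    (hGY : ∀ g : G, ∀ x ∈ Y, act ρ g x ∈ Y) {P : Finset (Finset (M T))}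
    (hP : ∀ S ∈ polystableStates (stateV (restrict hle ρ)),
      ∃ S' ∈ P, ∃ w ∈ weylGroup G T, S = moveState w S') :
    Y ∩ strictlyPolystable (restrict hle ρ) X =
      ⋃ S ∈ P, ⋃ g ∈ {g : G | (g : GL (Fin n) k) ∈
        Subgroup.normalizer (T : Set (GL (Fin n) k))},
          act ρ g '' (Y ∩ stratum (restrict hle ρ) X (spanR S)) := by
  have hXT : ∀ t : T, ∀ x ∈ X, act (restrict hle ρ) t x ∈ X := fun t x hx =>
    hGX (Subgroup.inclusion hle t) x hx
  ext x
  simp only [Set.mem_iUnion]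
  constructor
  · rintro ⟨hxY, hx⟩
    have hxX : x ∈ X := hx.1.1.1
    obtain ⟨⟨B, hB, hsub⟩, hrel⟩ :=
      (mem_strictlyPolystable_iff hT (hρ.restrict hle) hX hXT hxX).1 hx
    have htop : spanR (stateOf (restrict hle ρ) x) ≠ ⊤ := fun htop =>
      hB (top_le_iff.1 (htop ▸ Submodule.span_le.2 hsub))
    obtain ⟨hmem, hspan⟩ := inter_spanR_stateOf_mem hT htop rfl hrel
    obtain ⟨S', hS', w, ⟨g, hgG, hg, hgw⟩, hw⟩ := hP _ hmem
    have hg' : ((⟨g, hgG⟩ : G) : GL (Fin n) k) ∈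
      Subgroup.normalizer (T : Set (GL (Fin n) k)) := hg
    have hginv : (((⟨g, hgG⟩ : G)⁻¹ : G) : GL (Fin n) k) ∈
      Subgroup.normalizer (T : Set (GL (Fin n) k)) := Subgroup.inv_mem _ hg
    have hinv : Induces (((⟨g, hgG⟩ : G)⁻¹ : G) : GL (Fin n) k) w⁻¹ := Induces.inv hgw
    refine ⟨S', hS', ⟨g, hgG⟩, hg', act ρ (⟨g, hgG⟩ : G)⁻¹ x, ⟨hGY _ _ hxY, ?_⟩,
      act_act_inv ρ _ x⟩
    have h1 := act_mem_stratum hT hle hρ hX hGX _ hginv hinv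
      (show x ∈ stratum (restrict hle ρ) X (spanR (stateOf (restrict hle ρ) x)) from
        ⟨hx, rfl, hrel⟩)
    rw [← hspan, ← spanR_moveState, moveState_inv_eq.2 hw] at h1
    exact h1
  · rintro ⟨S, -, g, hg, y, ⟨hyY, hy⟩, rfl⟩
    obtain ⟨w, -, hw⟩ := exists_induces g.2 hg
    exact ⟨hGY g y hyY, (act_mem_stratum hT hle hρ hX hGX g hg hw hy).1⟩

end Strata

end TPolystable

open TPolystable in
theorem theorem1p2 {k : Type*} [Field k] [IsAlgClosed k] {n : ℕ}
    (G T : Subgroup (GL (Fin n) k)) (hG : IsSemisimpleGroup G) (hT : IsMaximalTorus G T)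
    {V : Type*} [AddCommGroup V] [Module k V] [FiniteDimensional k V]
    (ρ : Representation k G V) (hρ : IsRationalRep ρ)
    (X : Set (ℙ k (Module.Dual k V))) (hX : IsProjectiveVariety X)
    (hGX : ∀ g : G, ∀ x ∈ X, act ρ g x ∈ X)
    (F : Set (NR T)) (hF : IsFundamentalChamber G T F)
    (σ : Representation k T V) (hσ : σ = restrict hT.le ρ)
    (Ξ : Finset (M T)) (hΞ : Ξ = stateV σ) :
    -- the Weyl group and the input of the algorithm are finite
    Finite (weylGroup G T) ∧ (PsF Ξ F).Finite ∧
    -- the criterion for strict `T`-polystability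
    (∀ x ∈ X, x ∈ strictlyPolystable σ X ↔
      (∃ A : Submodule ℝ (MR T), A ≠ ⊤ ∧ realize (stateOf σ x) ⊆ A) ∧
        ZeroMemRelint (stateOf σ x)) ∧
    -- the index set of the strata in `ℙ(V*)`, and generic points of the strata
    (∀ A : Submodule ℝ (MR T), (stratum σ Set.univ A).Nonempty ↔
      ∃ S ∈ polystableStates Ξ, spanR S = A) ∧
    (∀ S ∈ polystableStates Ξ, ∃ x ∈ stratum σ Set.univ (spanR S), stateOf σ x = S) ∧
    -- correctness of the algorithm
    ∀ (weyl : List (M T ≃ₗ[ℤ] M T)) (enum : Finset (Finset (M T)) → List (Finset (M T)))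
      (input : List (NR T)),
      (∀ w, w ∈ weyl ↔ w ∈ weylGroup G T) → IsEnumeration enum → Presents Ξ F input →
      -- the output consists of one member of each Weyl group orbit of `polystableStates Ξ`
      (∀ S ∈ polystableAlgorithm Ξ weyl enum input, S ∈ polystableStates Ξ) ∧
      (∀ S ∈ polystableStates Ξ, ∃! S', S' ∈ polystableAlgorithm Ξ weyl enum input ∧
        ∃ w ∈ weylGroup G T, S = moveState w S') ∧
      -- up to the Weyl group, the output determines the strictly `T`-polystable locus of `X`
      (strictlyPolystable σ X =
        ⋃ S ∈ polystableAlgorithm Ξ weyl enum input,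
          ⋃ g ∈ {g : G | (g : GL (Fin n) k) ∈ Subgroup.normalizer (T : Set (GL (Fin n) k))},
            act ρ g '' stratum σ X (spanR S)) ∧
      -- the same for the part of this locus that is strictly semistable for `G`
      (semistable ρ X \ stable ρ X) ∩ strictlyPolystable σ X =
        ⋃ S ∈ polystableAlgorithm Ξ weyl enum input,
          ⋃ g ∈ {g : G | (g : GL (Fin n) k) ∈ Subgroup.normalizer (T : Set (GL (Fin n) k))},
            act ρ g '' (semistable ρ X ∩ stratum σ X (spanR S)) := by
  subst hσ hΞ
  have hTor : IsTorus T := hT.prop.1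
  have hle : T ≤ G := hT.le
  have hσ : IsRationalRep (restrict hle ρ) := hρ.restrict hle
  have hXT : ∀ t : T, ∀ x ∈ X, act (restrict hle ρ) t x ∈ X := fun t x hx =>
    hGX (Subgroup.inclusion hle t) x hx
  have := charLattice_free hTor
  have := charLattice_finite hTor
  have hW : Finite (weylGroup G T) := finite_weylGroup hTor hle
  refine ⟨hW, finite_PsF _ F, fun x hx => mem_strictlyPolystable_iff hTor hσ hX.1 hXT hx,
    fun A => ⟨?_, ?_⟩, fun S hS => exists_mem_stratum hTor hσ hS, ?_⟩
  · rintro ⟨x, hx⟩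
    obtain ⟨-, hA, hspan, hrel⟩ := (mem_stratum_iff hTor hσ isClosed_univ_zariskiProj
      fun _ _ _ => trivial).1 hx
    exact ⟨_, inter_spanR_stateOf_mem hTor hA hspan hrel⟩
  · rintro ⟨S, hS, rfl⟩
    obtain ⟨x, hx, -⟩ := exists_mem_stratum hTor hσ hS
    exact ⟨x, hx⟩
  · intro weyl enum input hweyl henum hin
    obtain ⟨h1, h2⟩ := polystableAlgorithm_spec hF
      (fun w hw => moveState_stateV hle ρ hw) hin henum hweyl
    have hP : ∀ S ∈ polystableStates (stateV (restrict hle ρ)),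
        ∃ S' ∈ polystableAlgorithm (stateV (restrict hle ρ)) weyl enum input,
          ∃ w ∈ weylGroup G T, S = moveState w S' := by
      intro S hS
      obtain ⟨S', ⟨hS', hw⟩, -⟩ := h2 S hS
      exact ⟨S', hS', hw⟩
    refine ⟨h1, h2, ?_, ?_⟩
    · have := inter_strictlyPolystable_eq hTor hle hρ hX.1 hGX (Y := Set.univ)
        (fun _ _ _ => trivial) hP
      simpa only [Set.univ_inter] using this
    · rw [← inter_strictlyPolystable_eq hTor hle hρ hX.1 hGX
        (fun g x hx => act_mem_semistable ρ hGX g hx) hP]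
      ext x
      constructor
      · rintro ⟨⟨hss, -⟩, hps⟩
        exact ⟨hss, hps⟩
      · rintro ⟨hss, hps⟩
        exact ⟨⟨hss, notMem_stable_of_mem_strictlyPolystable hle hps⟩, hps⟩
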